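/- Fix an o-minimal structure expanding the real field; "definable" means definable in it, with real parameters. For linear subspaces $E,F\subset\mathbb R^n$ put $\delta(E,F)=\sup\{d(u,F): u\in E,\ |u|=1\}$ (and $\delta(0,F)=0$). Let $X,Y\subset\mathbb R^n$ be disjoint connected definable $C^2$ submanifolds with $\dim X=k$ and $\dim Y=k+1$, such that $X\subset\overline{Y}$ and $X\cup Y$ is locally closed in $\mathbb R^n$. Assume that $Y$ is connected near $X$, that is, for every $x\in X$ the set $Y\cap B(x,\varepsilon)$ is connected for all sufficiently small $\varepsilon>0$. Assume that at every point $x\in X$ the pair $(Y,X)$ satisfies (a) Whitney's condition $(a)$: $\delta(T_xX,T_yY)\to 0$ as $y\to x$, $y\in Y$; ($r_{\int}$) in some definable $C^2$ coordinate system of $\mathbb R^n$ around $x$ which identifies $x$ with $0$ and $X$ with a neighbourhood of $0$ in $\mathbb R^k\times 0$, the function $$r(t)=\sup_{y\in Y,\ |\pi(y)|=t}\frac{\delta(\mathbb R^k\times 0,\,T_yY)}{|y-\pi(y)|}\in[0,\infty]$$ (with $Y$ read in the domain of these coordinates, $\pi$ the orthogonal projection onto $\mathbb R^k\times 0$, and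 $\sup\emptyset=0$) satisfies $\int_0^\varepsilon r(t)\,dt<\infty$ for some $\varepsilon>0$. Then $X\cup Y$ is a $C^1$ submanifold with boundary of $\mathbb R^n$, of dimension $k+1$, with boundary $X$. -/

import Mathlib

open Set Filter Topology MeasureTheory
open scoped ENNReal

noncomputable section

/-- The Euclidean space `ℝⁿ`. -/
abbrev Eucl (n : ℕ) : Type := EuclideanSpace ℝ (Fin n)

/-! ### O-minimal structures on the real field

A structure is given by a first-order language `L` interpreted on `ℝ`; definable means definable
by an `L`-formula with arbitrary real parameters. -/

/-- The `L`-structure on `ℝ` is an o-minimal structure expanding the real field: the graphs of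
addition and multiplication are definable (hence so is the order), and every definable subset
of `ℝ` is a finite union of intervals (points, bounded or unbounded intervals). -/
structure IsOMinimal (L : FirstOrder.Language) [L.Structure ℝ] : Prop where
  definable_add : (univ : Set ℝ).Definable L {v : Fin 3 → ℝ | v 0 + v 1 = v 2}
  definable_mul : (univ : Set ℝ).Definable L {v : Fin 3 → ℝ | v 0 * v 1 = v 2}
  finite_union : ∀ s : Set ℝ, (univ : Set ℝ).Definable₁ L s →
    ∃ I : Set (Set ℝ), I.Finite ∧ (∀ J ∈ I, J.OrdConnected) ∧ s = ⋃₀ I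

/-- Definable subsets of `ℝⁿ`. -/
def IsDefinableSet (L : FirstOrder.Language) [L.Structure ℝ] {n : ℕ} (A : Set (Eucl n)) : Prop :=
  (univ : Set ℝ).Definable L {v : Fin n → ℝ | WithLp.toLp 2 v ∈ A}

/-- The local homeomorphism `φ` of `ℝⁿ` is definable, that is, its graph (over its open domain)
is a definable subset of `ℝⁿ × ℝⁿ`. -/
def IsDefinableChart (L : FirstOrder.Language) [L.Structure ℝ] {n : ℕ}
    (φ : OpenPartialHomeomorph (Eucl n) (Eucl n)) : Prop :=
  (univ : Set ℝ).Definable L {v : Fin n ⊕ Fin n → ℝ |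
    WithLp.toLp 2 (fun i => v (Sum.inl i)) ∈ φ.source ∧
      φ (WithLp.toLp 2 (fun i => v (Sum.inl i))) = WithLp.toLp 2 (fun i => v (Sum.inr i))}

/-! ### Submanifolds of `ℝⁿ` -/

/-- The coordinate subspace `ℝᵈ × 0` of `ℝⁿ`. -/
def flat (n d : ℕ) : Submodule ℝ (Eucl n) where
  carrier := {z | ∀ i : Fin n, d ≤ i.val → z i = 0}
  add_mem' := by
    intro a b ha hb i hi
    simp [ha i hi, hb i hi]
  zero_mem' := by
    intro i _
    simp
  smul_mem' := by
    intro c a ha i hi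
    simp [ha i hi]

/-- The closed half-space `{z ∈ ℝᵏ⁺¹ × 0 : z_{k+1} ≥ 0}` of `ℝᵏ⁺¹ × 0 ⊆ ℝⁿ`; the last of the
`k + 1` coordinates has index `k`. -/
def halfFlat (n k : ℕ) : Set (Eucl n) :=
  {z | z ∈ flat n (k + 1) ∧ ∀ i : Fin n, i.val = k → 0 ≤ z i}

/-- `φ` is a `C^p` coordinate system on an open subset of `ℝⁿ`. -/
def IsCpChart (p : ℕ) {n : ℕ} (φ : OpenPartialHomeomorph (Eucl n) (Eucl n)) : Prop :=
  ContDiffOn ℝ p φ φ.source ∧ ContDiffOn ℝ p φ.symm φ.target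

/-- `M` is an (embedded) `C^p` submanifold of `ℝⁿ`, without boundary, of dimension `d`. -/
def IsCpSubmanifold (p d : ℕ) {n : ℕ} (M : Set (Eucl n)) : Prop :=
  d ≤ n ∧ ∀ x ∈ M, ∃ φ : OpenPartialHomeomorph (Eucl n) (Eucl n),
    x ∈ φ.source ∧ IsCpChart p φ ∧ φ.IsImage M (flat n d)

/-- `M` is an (embedded) `C^p` submanifold with boundary of `ℝⁿ`, of dimension `k + 1`, and its
boundary is `B`: near a point of `B` the pair `(M, B)` is, in suitable `C^p` coordinates, the
pair (half-space of `ℝᵏ⁺¹`, `ℝᵏ`), and near the other points of `M` the set `M` is `ℝᵏ⁺¹`. -/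
def IsCpSubmanifoldWithBoundary (p k : ℕ) {n : ℕ} (M B : Set (Eucl n)) : Prop :=
  k + 1 ≤ n ∧ B ⊆ M ∧
  (∀ x ∈ B, ∃ φ : OpenPartialHomeomorph (Eucl n) (Eucl n),
    x ∈ φ.source ∧ IsCpChart p φ ∧ φ.IsImage M (halfFlat n k) ∧ φ.IsImage B (flat n k)) ∧
  (∀ x ∈ M \ B, ∃ φ : OpenPartialHomeomorph (Eucl n) (Eucl n),
    x ∈ φ.source ∧ IsCpChart p φ ∧ φ.IsImage M (flat n (k + 1)))

/-- The tangent space at `y` of a submanifold `M` of `ℝⁿ`: the vectors that are velocities at `y`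
of curves in `M` (these already form a subspace when `M` is a `C¹` submanifold and `y ∈ M`). -/
def tangentSpaceOf {n : ℕ} (M : Set (Eucl n)) (y : Eucl n) : Submodule ℝ (Eucl n) :=
  Submodule.span ℝ {v | ∃ γ : ℝ → Eucl n, γ 0 = y ∧ (∀ᶠ t in 𝓝 0, γ t ∈ M) ∧ HasDerivAt γ v 0}

/-! ### The regularity conditions -/

/-- `δ(E, F) = sup {d(u, F) : u ∈ E, |u| = 1}`, which is `0` for `E = 0`. -/
def gapDist {n : ℕ} (E F : Submodule ℝ (Eucl n)) : ℝ≥0∞ :=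
  ⨆ (u : Eucl n) (_ : u ∈ E) (_ : ‖u‖ = 1), Metric.infEDist u (F : Set (Eucl n))

/-- Whitney's condition `(a)` for `(Y, X)` at `x ∈ X`. -/
def ConditionA {n : ℕ} (Y X : Set (Eucl n)) (x : Eucl n) : Prop :=
  Tendsto (fun y => gapDist (tangentSpaceOf X x) (tangentSpaceOf Y y)) (𝓝[Y] x) (𝓝 0)

/-- `r(t) = sup {δ(ℝᵏ × 0, T_y Y) / |y - π(y)| : y ∈ Y, |π(y)| = t}`, a value in `[0, ∞]`, where
`π` is the orthogonal projection of `ℝⁿ` onto `ℝᵏ × 0`. -/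
def ratioFun {n : ℕ} (k : ℕ) (Y : Set (Eucl n)) (t : ℝ) : ℝ≥0∞ :=
  ⨆ (y : Eucl n) (_ : y ∈ Y) (_ : ‖(flat n k).starProjection y‖ = t),
    gapDist (flat n k) (tangentSpaceOf Y y) / edist y ((flat n k).starProjection y)

/-- The condition `(r_∫)` for `(Y, X)` at `x ∈ X`, `k = dim X`: in some definable `C²` coordinates
around `x` which identify `x` with `0` and `X` with a neighbourhood of `0` in `ℝᵏ × 0`, the function
`r` of (the image of) `Y` has a finite integral over `[0, ε]` for some `ε > 0`. -/
def ConditionRInt (L : FirstOrder.Language) [L.Structure ℝ] {n : ℕ} (k : ℕ)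
    (Y X : Set (Eucl n)) (x : Eucl n) : Prop :=
  ∃ φ : OpenPartialHomeomorph (Eucl n) (Eucl n),
    x ∈ φ.source ∧ φ x = 0 ∧ IsCpChart 2 φ ∧ IsDefinableChart L φ ∧ φ.IsImage X (flat n k) ∧
    ∃ ε : ℝ, 0 < ε ∧ ∫⁻ t in Icc 0 ε, ratioFun k (φ '' (φ.source ∩ Y)) t < ∞

end

/-! Near a point of X, work in the coordinates of the integral condition: X is ℝᵏ × 0, and y = x + h
with x = π(y) and h normal. Everything reduces to showing that the unit normal direction h/|h| has a
limit θ at the point and that the tangent spaces of Y tend to ℝᵏ ⊕ ℝθ.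

The direction h becomes tangent to Y (`eventually_exists_tangent_near_normalPart`). Otherwise curve
selection gives a definable curve x(s) + h(s) in Y along which h keeps a relative distance η from
the tangent space T. One-variable o-minimality makes h' nearly radial. Since x' + h' lies in T, the
component of x' orthogonal to T is at least (η/2)ρ', where ρ = |h|. With τ = |x|, it is also at most
2τ'r(τ)ρ. Hence ρ'/ρ ≤ (4/η) r(τ)τ', where the left side has infinite integral and the right side a
finite one.

With condition (a), T is then close to ℝᵏ ⊕ ℝh, so y ↦ (x, |h|) is a local diffeomorphism from Y to
a box. Local closedness of X ∪ Y makes it proper, hence a covering of a simply connected box, and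
connectedness of Y near X leaves one sheet: Y has a parametrization Ψ(x, ρ) (`exists_isCylParam`).

The direction (Ψ - x)/ρ converges along the fibre over the origin because it is bounded and
definable. Its derivative in x is bounded by 5r(|x|), so moving from the fibre to (x, ρ) changes it
by at most 5∫r over [0, |x|], which tends to 0 (`IsCylParam.exists_tendsto_normalDir`).

The same holds at every point of X in its own chart, and C¹ coordinate changes preserve the
conclusion (`HasTangentHalfSpace.map`). In one fixed chart, Ψ - x, extended oddly in ρ, is therefore
C¹ across ρ = 0 (`IsCylParam.contDiffOn_cylExt`), and the inverse function theorem gives the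
boundary chart (`IsCylParam.exists_boundary_chart`). -/

/-! ### Definable predicates and functions -/

section Definability

variable {L : FirstOrder.Language} [L.Structure ℝ] {α β : Type}

/-- A predicate on tuples of reals is definable, with real parameters. -/
def DefPred (L : FirstOrder.Language) [L.Structure ℝ] (P : (α → ℝ) → Prop) : Prop :=
  (univ : Set ℝ).Definable L {v | P v}

/-- A real function of tuples of reals is definable, with real parameters. -/
def DefFn (L : FirstOrder.Language) [L.Structure ℝ] (f : (α → ℝ) → ℝ) : Prop :=
  (univ : Set ℝ).DefinableFun L f

/-- A vector function of tuples of reals is definable. -/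
def DefVec (L : FirstOrder.Language) [L.Structure ℝ] {n : ℕ} (f : (α → ℝ) → Eucl n) : Prop :=
  ∀ i, DefFn L fun v => f v i

/-- A real function of a real variable is definable. -/
def DefReal (L : FirstOrder.Language) [L.Structure ℝ] (f : ℝ → ℝ) : Prop :=
  DefFn L fun v : Fin 1 → ℝ => f (v 0)

namespace DefPred

theorem and {P Q : (α → ℝ) → Prop} (hP : DefPred L P) (hQ : DefPred L Q) :
    DefPred L fun v => P v ∧ Q v := Set.Definable.inter hP hQ

theorem or {P Q : (α → ℝ) → Prop} (hP : DefPred L P) (hQ : DefPred L Q) :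
    DefPred L fun v => P v ∨ Q v := Set.Definable.union hP hQ

theorem not {P : (α → ℝ) → Prop} (hP : DefPred L P) : DefPred L fun v => ¬ P v :=
  Set.Definable.compl hP

theorem imp {P Q : (α → ℝ) → Prop} (hP : DefPred L P) (hQ : DefPred L Q) :
    DefPred L fun v => P v → Q v := by
  simpa only [imp_iff_not_or] using hP.not.or hQ

theorem reindex {P : (α → ℝ) → Prop} (hP : DefPred L P) (σ : α → β) :
    DefPred L fun w : β → ℝ => P fun i => w (σ i) := Set.Definable.preimage_comp σ hP

theorem comp [Finite β] {P : (β → ℝ) → Prop} (hP : DefPred L P) {F : (α → ℝ) → β → ℝ}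
    (hF : ∀ i, DefFn L fun v => F v i) : DefPred L fun v => P (F v) :=
  Set.Definable.preimage_map (F := F) hF hP

theorem exVec {n : ℕ} {P : (α → ℝ) → Eucl n → Prop}
    (hP : DefPred L fun w : α ⊕ Fin n → ℝ =>
      P (fun i => w (.inl i)) (WithLp.toLp 2 fun i => w (.inr i))) :
    DefPred L fun v => ∃ y, P v y := by
  have h := Set.Definable.exists_of_finite hP
  unfold DefPred
  convert! h using 1
  ext v
  exact ⟨fun ⟨y, hy⟩ => ⟨y.ofLp, hy⟩, fun ⟨y, hy⟩ => ⟨WithLp.toLp 2 y, hy⟩⟩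

theorem allVec {n : ℕ} {P : (α → ℝ) → Eucl n → Prop}
    (hP : DefPred L fun w : α ⊕ Fin n → ℝ =>
      P (fun i => w (.inl i)) (WithLp.toLp 2 fun i => w (.inr i))) :
    DefPred L fun v => ∀ y, P v y := by
  simpa using (exVec (P := fun v y => ¬ P v y) hP.not).not

theorem ex {P : (α → ℝ) → ℝ → Prop}
    (hP : DefPred L fun w : α ⊕ Fin 1 → ℝ => P (fun i => w (.inl i)) (w (.inr 0))) :
    DefPred L fun v => ∃ x, P v x := by
  have h := Set.Definable.exists_of_finite hP
  unfold DefPred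
  convert! h using 1
  ext v
  exact ⟨fun ⟨y, hy⟩ => ⟨fun _ => y, hy⟩, fun ⟨y, hy⟩ => ⟨y 0, hy⟩⟩

theorem all {P : (α → ℝ) → ℝ → Prop}
    (hP : DefPred L fun w : α ⊕ Fin 1 → ℝ => P (fun i => w (.inl i)) (w (.inr 0))) :
    DefPred L fun v => ∀ x, P v x := by
  simpa using (ex (P := fun v y => ¬ P v y) hP.not).not

theorem mem {n : ℕ} {A : Set (Eucl n)} (hA : IsDefinableSet L A) {f : (α → ℝ) → Eucl n}
    (hf : DefVec L f) : DefPred L fun v => f v ∈ A :=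
  DefPred.comp (P := fun w => WithLp.toLp 2 w ∈ A) hA (F := fun v => (f v).ofLp) hf

end DefPred

namespace DefFn

theorem proj (i : α) : DefFn L fun v => v i := Set.DefinableFun.proj L

theorem const (c : ℝ) : DefFn L fun _ : α → ℝ => c := L.definableFun_const α (mem_univ c)

theorem of_graph {f : (α → ℝ) → ℝ}
    (h : DefPred L fun w : α ⊕ Fin 1 → ℝ => f (fun i => w (.inl i)) = w (.inr 0)) : DefFn L f := by
  have := h.reindex (Sum.elim some (fun _ => none) : α ⊕ Fin 1 → Option α)
  exact this

theorem comp [Finite β] {f : (β → ℝ) → ℝ} (hf : DefFn L f) {F : (α → ℝ) → β → ℝ}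
    (hF : ∀ i, DefFn L fun v => F v i) : DefFn L fun v => f (F v) :=
  Set.DefinableFun.comp (g := F) hF hf

theorem reindex {f : (α → ℝ) → ℝ} (hf : DefFn L f) (σ : α → β) :
    DefFn L fun w : β → ℝ => f fun i => w (σ i) := by
  apply of_graph
  have := DefPred.reindex (L := L) (P := fun v : Option α → ℝ => f (fun i => v (some i)) = v none) hf
    (fun j : Option α => (j.elim (Sum.inr 0) fun i => Sum.inl (σ i) : β ⊕ Fin 1))
  exact this

end DefFn

theorem DefPred.eq {f g : (α → ℝ) → ℝ} (hf : DefFn L f) (hg : DefFn L g) :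
    DefPred L fun v => f v = g v := Set.DefinableFun.ofPred_eq hf hg

theorem DefVec.toLp {n : ℕ} (σ : Fin n → α) : DefVec L fun v => WithLp.toLp 2 fun i => v (σ i) :=
  fun _ => DefFn.proj _

theorem DefReal.comp {f : ℝ → ℝ} (hf : DefReal L f) {g : (α → ℝ) → ℝ} (hg : DefFn L g) :
    DefFn L fun v => f (g v) :=
  DefFn.comp (f := fun v : Fin 1 → ℝ => f (v 0)) hf (F := fun v _ => g v) fun _ => hg

variable [hL : Fact (IsOMinimal L)]

namespace DefFn

theorem add {f g : (α → ℝ) → ℝ} (hf : DefFn L f) (hg : DefFn L g) :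
    DefFn L fun v => f v + g v := by
  apply of_graph
  refine DefPred.comp (P := fun v : Fin 3 → ℝ => v 0 + v 1 = v 2) hL.out.definable_add
    (F := fun w : α ⊕ Fin 1 → ℝ => ![f fun i => w (.inl i), g fun i => w (.inl i), w (.inr 0)]) ?_
  intro i
  fin_cases i
  exacts [hf.reindex _, hg.reindex _, proj _]

theorem mul {f g : (α → ℝ) → ℝ} (hf : DefFn L f) (hg : DefFn L g) :
    DefFn L fun v => f v * g v := by
  apply of_graph
  refine DefPred.comp (P := fun v : Fin 3 → ℝ => v 0 * v 1 = v 2) hL.out.definable_mul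
    (F := fun w : α ⊕ Fin 1 → ℝ => ![f fun i => w (.inl i), g fun i => w (.inl i), w (.inr 0)]) ?_
  intro i
  fin_cases i
  exacts [hf.reindex _, hg.reindex _, proj _]

theorem neg {f : (α → ℝ) → ℝ} (hf : DefFn L f) : DefFn L fun v => - f v := by
  simpa using (const (-1)).mul hf

theorem sub {f g : (α → ℝ) → ℝ} (hf : DefFn L f) (hg : DefFn L g) :
    DefFn L fun v => f v - g v := by
  simpa [sub_eq_add_neg] using hf.add hg.neg

theorem sum {ι : Type} (s : Finset ι) {f : ι → (α → ℝ) → ℝ} (hf : ∀ i, DefFn L (f i)) :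
    DefFn L fun v => ∑ i ∈ s, f i v := by
  classical
  induction s using Finset.induction_on with
  | empty => simpa using const (L := L) (α := α) 0
  | insert a s ha ih => simpa [Finset.sum_insert ha] using (hf a).add ih

end DefFn

namespace DefPred

/-- The order comes from the field structure: the nonnegative reals are the squares. -/
theorem le {f g : (α → ℝ) → ℝ} (hf : DefFn L f) (hg : DefFn L g) :
    DefPred L fun v => f v ≤ g v := by
  have : DefPred L fun v => ∃ z, f v + z * z = g v :=
    .ex (.eq ((hf.reindex _).add ((DefFn.proj _).mul (DefFn.proj _))) (hg.reindex _))
  convert! this using 3 with v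
  constructor
  · intro h
    exact ⟨√(g v - f v), by rw [Real.mul_self_sqrt (by linarith)]; ring⟩
  · rintro ⟨z, hz⟩
    nlinarith [mul_self_nonneg z]

theorem lt {f g : (α → ℝ) → ℝ} (hf : DefFn L f) (hg : DefFn L g) :
    DefPred L fun v => f v < g v := by
  simpa using (le hg hf).not

end DefPred

namespace DefFn

theorem inv {f : (α → ℝ) → ℝ} (hf : DefFn L f) : DefFn L fun v => (f v)⁻¹ := by
  apply of_graph
  have h1 : DefFn L fun w : α ⊕ Fin 1 → ℝ => f fun i => w (.inl i) := hf.reindex _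
  have h2 : DefFn L fun w : α ⊕ Fin 1 → ℝ => w (.inr 0) := proj _
  -- The second alternative encodes the convention `0⁻¹ = 0`.
  have := DefPred.or (.eq (h1.mul h2) (const 1)) (.and (.eq h1 (const 0)) (.eq h2 (const 0)))
  convert! this using 3 with w
  generalize f (fun i => w (.inl i)) = a
  generalize w (.inr 0) = b
  by_cases ha : a = 0
  · simp [ha, eq_comm]
  · simp only [ha, false_and, or_false]
    rw [inv_eq_iff_eq_inv, eq_comm, inv_eq_iff_eq_inv, eq_comm, ← mul_right_inj' ha,
      mul_inv_cancel₀ ha, eq_comm]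

theorem div {f g : (α → ℝ) → ℝ} (hf : DefFn L f) (hg : DefFn L g) :
    DefFn L fun v => f v / g v := by
  simpa [div_eq_mul_inv] using hf.mul hg.inv

theorem sqrt {f : (α → ℝ) → ℝ} (hf : DefFn L f) : DefFn L fun v => √(f v) := by
  apply of_graph
  have h1 : DefFn L fun w : α ⊕ Fin 1 → ℝ => f fun i => w (.inl i) := hf.reindex _
  have h2 : DefFn L fun w : α ⊕ Fin 1 → ℝ => w (.inr 0) := proj _
  have := DefPred.or (.and (.le (const 0) h2) (.eq (h2.mul h2) h1))
    (.and (.lt h1 (const 0)) (.eq h2 (const 0)))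
  convert! this using 3 with w
  generalize f (fun i => w (.inl i)) = a
  generalize w (.inr 0) = b
  rcases lt_or_ge a 0 with ha | ha
  · rw [Real.sqrt_eq_zero_of_nonpos ha.le]
    constructor
    · exact fun h => Or.inr ⟨ha, h.symm⟩
    · rintro (⟨_, h⟩ | h)
      · nlinarith [mul_self_nonneg b]
      · exact h.2.symm
  · constructor
    · rintro rfl
      exact Or.inl ⟨Real.sqrt_nonneg _, Real.mul_self_sqrt ha⟩
    · rintro (⟨h0, h⟩ | h)
      · rw [← h, Real.sqrt_mul_self h0]
      · linarith [h.1]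

theorem abs {f : (α → ℝ) → ℝ} (hf : DefFn L f) : DefFn L fun v => |f v| := by
  simpa [← Real.sqrt_mul_self_eq_abs] using (hf.mul hf).sqrt

end DefFn

namespace DefVec

theorem inner {n : ℕ} {f g : (α → ℝ) → Eucl n} (hf : DefVec L f) (hg : DefVec L g) :
    DefFn L fun v => inner ℝ (f v) (g v) := by
  simpa [PiLp.inner_apply] using DefFn.sum Finset.univ fun i => (hg i).mul (hf i)

theorem norm {n : ℕ} {f : (α → ℝ) → Eucl n} (hf : DefVec L f) : DefFn L fun v => ‖f v‖ := by
  simpa [EuclideanSpace.norm_eq, pow_two, ← Real.sqrt_mul_self_eq_abs] using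
    (DefFn.sum Finset.univ fun i => (hf i).abs.mul (hf i).abs).sqrt

theorem sub {n : ℕ} {f g : (α → ℝ) → Eucl n} (hf : DefVec L f) (hg : DefVec L g) :
    DefVec L fun v => f v - g v := fun i => (hf i).sub (hg i)

end DefVec

end Definability

/-! ### Definable functions of one real variable -/

section OneVariable

variable {L : FirstOrder.Language} [L.Structure ℝ] [hL : Fact (IsOMinimal L)]

theorem Set.OrdConnected.eventually_nhdsGT_mem_or_notMem {J : Set ℝ} (hJ : J.OrdConnected) (a : ℝ) :
    (∀ᶠ x in 𝓝[>] a, x ∈ J) ∨ ∀ᶠ x in 𝓝[>] a, x ∉ J := by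
  by_cases h : ∀ᶠ x in 𝓝[>] a, x ∉ J
  · exact Or.inr h
  left
  have h' : ∃ᶠ x in 𝓝[>] a, x ∈ J := h
  obtain ⟨p, hpJ, hp⟩ := (h'.and_eventually self_mem_nhdsWithin).exists
  filter_upwards [Ioo_mem_nhdsGT hp] with x hx
  obtain ⟨q, hqJ, hq⟩ := (h'.and_eventually (Ioo_mem_nhdsGT hx.1)).exists
  exact hJ.out hqJ hpJ ⟨hq.2.le, hx.2.le⟩

/-- This zero-one law for germs is the only place where the finiteness axiom is used; all later
one-variable results come from it. A finite union of intervals either contains a right neighbourhood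
of `a` inside one interval or misses one entirely. -/
theorem eventually_nhdsGT_or_not {P : ℝ → Prop} (hP : DefPred L fun v : Fin 1 → ℝ => P (v 0))
    (a : ℝ) : (∀ᶠ x in 𝓝[>] a, P x) ∨ ∀ᶠ x in 𝓝[>] a, ¬ P x := by
  obtain ⟨I, hI, hJ, hs⟩ := hL.out.finite_union {x | P x} hP
  by_cases h : ∃ J ∈ I, ∀ᶠ x in 𝓝[>] a, x ∈ J
  · obtain ⟨J, hJI, hx⟩ := h
    left
    filter_upwards [hx] with x hx
    have : x ∈ {x | P x} := hs ▸ ⟨J, hJI, hx⟩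
    exact this
  · right
    have : ∀ᶠ x in 𝓝[>] a, ∀ J ∈ I, x ∉ J := by
      rw [Filter.eventually_all_finite hI]
      intro J hJI
      exact ((hJ J hJI).eventually_nhdsGT_mem_or_notMem a).resolve_left fun h' => h ⟨J, hJI, h'⟩
    filter_upwards [this] with x hx hPx
    have : x ∈ ⋃₀ I := hs ▸ hPx
    obtain ⟨J, hJI, hxJ⟩ := this
    exact hx J hJI hxJ

theorem eventually_nhdsLT_or_not {P : ℝ → Prop} (hP : DefPred L fun v : Fin 1 → ℝ => P (v 0))
    (a : ℝ) : (∀ᶠ x in 𝓝[<] a, P x) ∨ ∀ᶠ x in 𝓝[<] a, ¬ P x := by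
  have h : Tendsto (fun x : ℝ => -x) (𝓝[<] a) (𝓝[>] (-a)) := by
    refine tendsto_nhdsWithin_iff.2 ⟨(continuous_neg.tendsto a).mono_left nhdsWithin_le_nhds, ?_⟩
    filter_upwards [self_mem_nhdsWithin] with x (hx : x < a)
    exact neg_lt_neg hx
  have hP' : DefPred L fun v : Fin 1 → ℝ => P (-(v 0)) :=
    DefPred.comp (P := fun w : Fin 1 → ℝ => P (w 0)) hP (F := fun v _ => -(v 0))
      fun _ => (DefFn.proj _).neg
  rcases eventually_nhdsGT_or_not (P := fun x => P (-x)) hP' (-a) with h' | h'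
  · exact Or.inl (by simpa using h.eventually h')
  · exact Or.inr (by simpa using h.eventually h')

/-- Real induction: the supremum of the times up to which `f u` remains a lower bound is attained by
the left condition, and could be exceeded by the right condition if it were less than `v`. -/
theorem monotoneOn_Ioo_of_eventually {f : ℝ → ℝ} {a b : ℝ}
    (hr : ∀ x ∈ Ioo a b, ∀ᶠ y in 𝓝[>] x, f x ≤ f y)
    (hl : ∀ x ∈ Ioo a b, ∀ᶠ y in 𝓝[<] x, f y ≤ f x) : MonotoneOn f (Ioo a b) := by
  intro u hu v hv huv
  set S := {t | t ∈ Icc u v ∧ ∀ s ∈ Icc u t, f u ≤ f s} with hS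
  have hne : S.Nonempty := ⟨u, ⟨le_refl _, huv⟩, fun s hs => by
    rw [le_antisymm hs.2 hs.1]⟩
  have hbdd : BddAbove S := ⟨v, fun t ht => ht.1.2⟩
  set c := sSup S
  have huc : u ≤ c := le_csSup hbdd ⟨⟨le_refl _, huv⟩, fun s hs => by rw [le_antisymm hs.2 hs.1]⟩
  have hcv : c ≤ v := csSup_le hne fun t ht => ht.1.2
  have hc : c ∈ Ioo a b := ⟨hu.1.trans_le huc, hcv.trans_lt hv.2⟩
  have hlt : ∀ s, u ≤ s → s < c → f u ≤ f s := by
    intro s hus hsc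
    obtain ⟨t, ht, hst⟩ := exists_lt_of_lt_csSup hne hsc
    exact ht.2 s ⟨hus, hst.le⟩
  have hfc : f u ≤ f c := by
    rcases huc.eq_or_lt with h | h
    · rw [← h]
    · obtain ⟨y, hy, hy'⟩ := ((hl c hc).and (Ioo_mem_nhdsLT h)).exists
      exact (hlt y hy'.1.le hy'.2).trans hy
  have hcS : ∀ s ∈ Icc u c, f u ≤ f s := by
    intro s hs
    rcases hs.2.eq_or_lt with h | h
    · rw [h]; exact hfc
    · exact hlt s hs.1 h
  rcases hcv.eq_or_lt with h | h
  · rw [← h]; exact hfc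
  · exfalso
    obtain ⟨d, hd, hd'⟩ := mem_nhdsGT_iff_exists_Ioo_subset.1 (hr c hc)
    have hd : c < d := hd
    obtain ⟨e, he, he'⟩ := exists_between (lt_min hd h)
    have heS : e ∈ S := by
      refine ⟨⟨huc.trans he.le, (he'.trans_le (min_le_right _ _)).le⟩, fun s hs => ?_⟩
      rcases le_or_gt s c with h1 | h1
      · exact hcS s ⟨hs.1, h1⟩
      · exact hfc.trans (hd' ⟨h1, hs.2.trans_lt (he'.trans_le (min_le_left _ _))⟩)
    exact absurd (le_csSup hbdd heS) (not_le.2 he)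

/-- Each such point is the last maximum of `f` on some interval with rational endpoints, and an
interval has at most one last maximum. -/
theorem countable_weak_localMax {f : ℝ → ℝ} :
    {x | (∀ᶠ y in 𝓝[>] x, f y < f x) ∧ ∀ᶠ y in 𝓝[<] x, f y ≤ f x}.Countable := by
  set A := {x | (∀ᶠ y in 𝓝[>] x, f y < f x) ∧ ∀ᶠ y in 𝓝[<] x, f y ≤ f x} with hA
  have key : ∀ x : A, ∃ p q : ℚ, (p : ℝ) < x ∧ (x : ℝ) < q ∧
      (∀ y ∈ Ioo (p : ℝ) x, f y ≤ f x) ∧ ∀ y ∈ Ioo (x : ℝ) q, f y < f x := by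
    rintro ⟨x, hr, hl⟩
    obtain ⟨q, hq, hq'⟩ := mem_nhdsGT_iff_exists_Ioo_subset.1 hr
    obtain ⟨p, hp, hp'⟩ := mem_nhdsLT_iff_exists_Ioo_subset.1 hl
    obtain ⟨q1, h1, h2⟩ := exists_rat_btwn (show x < q from hq)
    obtain ⟨p1, h3, h4⟩ := exists_rat_btwn (show p < x from hp)
    exact ⟨p1, q1, h4, h1, fun y hy => hp' ⟨h3.trans hy.1, hy.2⟩,
      fun y hy => hq' ⟨hy.1, hy.2.trans h2⟩⟩
  choose p q hp hq h1 h2 using key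
  have hinj : Function.Injective fun x : A => (p x, q x) := by
    have aux : ∀ x y : A, p x = p y → q x = q y → ¬ (x : ℝ) < y := by
      intro x y hpe hqe hxy
      have e1 := h1 y x ⟨by rw [← hpe]; exact hp x, hxy⟩
      have e2 := h2 x y ⟨hxy, by rw [hqe]; exact hq y⟩
      exact absurd e1 (not_le.2 e2)
    intro x y hxy
    simp only [Prod.mk.injEq] at hxy
    exact Subtype.ext (le_antisymm (not_lt.1 (aux y x hxy.1.symm hxy.2.symm))
      (not_lt.1 (aux x y hxy.1 hxy.2)))
  exact hinj.countable

theorem not_eventually_nhdsGT_of_countable {A : Set ℝ} (hA : A.Countable) (a : ℝ) :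
    ¬ ∀ᶠ x in 𝓝[>] a, x ∈ A := by
  intro h
  obtain ⟨b, hb, hb'⟩ := mem_nhdsGT_iff_exists_Ioo_subset.1 h
  exact absurd (Cardinal.Real.Ioo_countable_iff.1 (hA.mono hb')) (not_le.2 (mem_Ioi.1 hb))

/-! ### Monotonicity, differentiability and limits of definable functions -/

namespace DefReal

theorem sub {f g : ℝ → ℝ} (hf : DefReal L f) (hg : DefReal L g) : DefReal L fun x => f x - g x :=
  DefFn.sub hf hg

theorem div {f g : ℝ → ℝ} (hf : DefReal L f) (hg : DefReal L g) : DefReal L fun x => f x / g x :=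
  DefFn.div hf hg

theorem eventually_le_right {f : ℝ → ℝ} (hf : DefReal L f) :
    DefPred L fun v : Fin 1 → ℝ => ∀ᶠ y in 𝓝[>] (v 0), f (v 0) ≤ f y := by
  have : DefPred L fun v : Fin 1 → ℝ => ∃ d, v 0 < d ∧ ∀ y, v 0 < y → y < d → f (v 0) ≤ f y := by
    refine .ex (.and (.lt (.proj _) (.proj _)) (.all (.imp (.lt (.proj _) (.proj _))
      (.imp (.lt (.proj _) (.proj _)) (.le ?_ ?_)))))
    exacts [hf.comp (.proj _), hf.comp (.proj _)]
  convert! this using 3 with v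
  rw [Filter.Eventually, mem_nhdsGT_iff_exists_Ioo_subset]
  simp only [subset_def, mem_Ioo, mem_Ioi, and_imp]
  rfl

theorem eventually_le_left {f : ℝ → ℝ} (hf : DefReal L f) :
    DefPred L fun v : Fin 1 → ℝ => ∀ᶠ y in 𝓝[<] (v 0), f y ≤ f (v 0) := by
  have : DefPred L fun v : Fin 1 → ℝ => ∃ d, d < v 0 ∧ ∀ y, d < y → y < v 0 → f y ≤ f (v 0) := by
    refine .ex (.and (.lt (.proj _) (.proj _)) (.all (.imp (.lt (.proj _) (.proj _))
      (.imp (.lt (.proj _) (.proj _)) (.le ?_ ?_)))))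
    exacts [hf.comp (.proj _), hf.comp (.proj _)]
  convert! this using 3 with v
  rw [Filter.Eventually, mem_nhdsLT_iff_exists_Ioo_subset]
  simp only [subset_def, mem_Ioo, mem_Iio, and_imp]
  rfl

/-- A definable function is monotone or antitone on a right neighbourhood of each point. -/
theorem exists_monotoneOn_or_antitoneOn {f : ℝ → ℝ} (hf : DefReal L f) (a : ℝ) :
    ∃ b > a, MonotoneOn f (Ioo a b) ∨ AntitoneOn f (Ioo a b) := by
  have germR : ∀ x, ¬ (∀ᶠ y in 𝓝[>] x, f x ≤ f y) → ∀ᶠ y in 𝓝[>] x, f y < f x := by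
    intro x hx
    simpa using (eventually_nhdsGT_or_not (P := fun y => f x ≤ f y)
      (DefPred.le (DefFn.const (f x)) hf) x).resolve_left hx
  have germL : ∀ x, ¬ (∀ᶠ y in 𝓝[<] x, f y ≤ f x) → ∀ᶠ y in 𝓝[<] x, f x < f y := by
    intro x hx
    simpa using (eventually_nhdsLT_or_not (P := fun y => f y ≤ f x)
      (DefPred.le hf (DefFn.const (f x))) x).resolve_left hx
  have ev : ∀ {P : ℝ → Prop}, (∀ᶠ x in 𝓝[>] a, P x) → ∃ b > a, ∀ x ∈ Ioo a b, P x := by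
    intro P hP
    obtain ⟨b, hb, hb'⟩ := mem_nhdsGT_iff_exists_Ioo_subset.1 hP
    exact ⟨b, hb, hb'⟩
  -- Both one-sided behaviours are constant near `a`. If they agree, `f` is monotone or antitone. If
  -- they disagree, every point near `a` is a local extremum, strict on one side, which countability
  -- forbids; minima become maxima after the change `f ↦ -f(-·)`.
  rcases eventually_nhdsGT_or_not (P := fun x => ∀ᶠ y in 𝓝[>] x, f x ≤ f y)
      hf.eventually_le_right a with hR | hR <;>
    rcases eventually_nhdsGT_or_not (P := fun x => ∀ᶠ y in 𝓝[<] x, f y ≤ f x)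
      hf.eventually_le_left a with hl | hl
  · obtain ⟨b, hb, h⟩ := ev (hR.and hl)
    exact ⟨b, hb, Or.inl (monotoneOn_Ioo_of_eventually (fun x hx => (h x hx).1)
      fun x hx => (h x hx).2)⟩
  · exfalso
    refine not_eventually_nhdsGT_of_countable
      ((countable_weak_localMax (f := fun x => - f (-x))).image Neg.neg) a ?_
    filter_upwards [hR, hl] with x h1 h2
    refine ⟨-x, ⟨?_, ?_⟩, neg_neg x⟩
    · have := tendsto_neg_nhdsGT_neg (a := x) |>.eventually (germL x h2)
      simpa using this
    · have := tendsto_neg_nhdsLT_neg (a := x) |>.eventually h1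
      simpa using this
  · exfalso
    refine not_eventually_nhdsGT_of_countable (countable_weak_localMax (f := f)) a ?_
    filter_upwards [hR, hl] with x h1 h2
    exact ⟨germR x h1, h2⟩
  · obtain ⟨b, hb, h⟩ := ev (hR.and hl)
    refine ⟨b, hb, Or.inr ?_⟩
    have : MonotoneOn (fun x => - f x) (Ioo a b) := by
      refine monotoneOn_Ioo_of_eventually (fun x hx => ?_) fun x hx => ?_
      · filter_upwards [germR x (h x hx).1] with y hy using neg_le_neg hy.le
      · filter_upwards [germL x (h x hx).2] with y hy using neg_le_neg hy.le
    exact fun x hx y hy hxy => neg_le_neg_iff.1 (this hx hy hxy)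

theorem hasDerivAt_pred {f : ℝ → ℝ} (hf : DefReal L f) {α : Type} {c x : (α → ℝ) → ℝ}
    (hc : DefFn L c) (hx : DefFn L x) : DefPred L fun v => HasDerivAt f (c v) (x v) := by
  have : DefPred L fun v => ∀ ε, 0 < ε → ∃ δ, 0 < δ ∧ ∀ y, |y - x v| < δ →
      |f y - f (x v) - (y - x v) * c v| ≤ ε * |y - x v| := by
    refine .all (.imp (.lt (.const _) (.proj _)) (.ex (.and (.lt (.const _) (.proj _)) (.all
      (.imp (.lt (.abs (.sub (.proj _) ?_)) (.proj _)) (.le (.abs (.sub (.sub ?_ ?_) (.mul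
        (.sub (.proj _) ?_) ?_))) (.mul (.proj _) (.abs (.sub (.proj _) ?_)))))))))
    · exact hx.reindex fun i => Sum.inl (Sum.inl (Sum.inl i))
    · exact hf.comp (.proj _)
    · exact hf.comp (hx.reindex fun i => Sum.inl (Sum.inl (Sum.inl i)))
    · exact hx.reindex fun i => Sum.inl (Sum.inl (Sum.inl i))
    · exact hc.reindex fun i => Sum.inl (Sum.inl (Sum.inl i))
    · exact hx.reindex fun i => Sum.inl (Sum.inl (Sum.inl i))
  convert! this using 3 with v
  rw [hasDerivAt_iff_isLittleO, Asymptotics.isLittleO_iff]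
  refine forall_congr' fun ε => imp_congr_right fun _ => ?_
  simp only [Metric.eventually_nhds_iff, Real.dist_eq, Real.norm_eq_abs, smul_eq_mul]

theorem deriv {f : ℝ → ℝ} (hf : DefReal L f) : DefReal L (deriv f) := by
  apply DefFn.of_graph
  have h : DefPred L fun w : Fin 1 ⊕ Fin 1 → ℝ => HasDerivAt f (w (.inr 0)) (w (.inl 0)) ∨
      (¬ ∃ c, HasDerivAt f c (w (.inl 0))) ∧ w (.inr 0) = 0 :=
    .or (hf.hasDerivAt_pred (.proj _) (.proj _))
      (.and (.not (.ex (hf.hasDerivAt_pred (.proj _) (.proj _)))) (.eq (.proj _) (.const _)))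
  convert! h using 3 with w
  by_cases hd : DifferentiableAt ℝ f (w (.inl 0))
  · constructor
    · intro h; left; rw [← h]; exact hd.hasDerivAt
    · rintro (h | h)
      · exact h.deriv
      · exact absurd ⟨_, hd.hasDerivAt⟩ h.1
  · rw [deriv_zero_of_not_differentiableAt hd]
    constructor
    · intro h; right; exact ⟨fun ⟨c, hc⟩ => hd hc.differentiableAt, h.symm⟩
    · rintro (h | h)
      · exact absurd h.differentiableAt hd
      · exact h.2.symm

/-- By the zero-one law `f` is differentiable everywhere or nowhere just to the right of `a`. The
second case contradicts Lebesgue's theorem, as `f` is monotone or antitone there. -/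
theorem eventually_differentiableAt {f : ℝ → ℝ} (hf : DefReal L f) (a : ℝ) :
    ∀ᶠ x in 𝓝[>] a, DifferentiableAt ℝ f x := by
  have hdef : DefPred L fun v : Fin 1 → ℝ => ∃ c, HasDerivAt f c (v 0) :=
    .ex (hf.hasDerivAt_pred (.proj _) (.proj _))
  rcases eventually_nhdsGT_or_not (P := fun x => ∃ c, HasDerivAt f c x) hdef a with h | h
  · exact h.mono fun x ⟨c, hc⟩ => hc.differentiableAt
  · exfalso
    obtain ⟨b, hb, hmono⟩ := hf.exists_monotoneOn_or_antitoneOn a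
    obtain ⟨d, hd, hd'⟩ := mem_nhdsGT_iff_exists_Ioo_subset.1 h
    have hae : ∀ᵐ x, x ∈ Ioo a b → DifferentiableWithinAt ℝ f (Ioo a b) x := by
      rcases hmono with hm | hm
      · exact hm.ae_differentiableWithinAt_of_mem
      · filter_upwards [hm.neg.ae_differentiableWithinAt_of_mem] with x hx hxm
        simpa using (hx hxm).neg
    have hlt : a < min b d := lt_min hb hd
    have h0 : volume (Ioo a (min b d)) = 0 := by
      refine measure_mono_null (fun x hx => ?_) hae
      have hxb : x ∈ Ioo a b := ⟨hx.1, hx.2.trans_le (min_le_left _ _)⟩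
      intro hx'
      exact hd' ⟨hx.1, hx.2.trans_le (min_le_right _ _)⟩ ⟨_, ((hx' hxb).differentiableAt
        (Ioo_mem_nhds hxb.1 hxb.2)).hasDerivAt⟩
    rw [Real.volume_Ioo, ENNReal.ofReal_eq_zero] at h0
    linarith

/-- By the zero-one law the values cannot cross a rational level infinitely often, so there are no
upcrossings. -/
theorem exists_tendsto_ereal {f : ℝ → ℝ} (hf : DefReal L f) (a : ℝ) :
    ∃ l : EReal, Tendsto (fun x => (f x : EReal)) (𝓝[>] a) (𝓝 l) := by
  refine tendsto_of_no_upcrossings (EReal.denseRange_ratCast) ?_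
  rintro _ ⟨p, rfl⟩ _ ⟨q, rfl⟩ hpq ⟨h1, h2⟩
  have hp : ∀ x, ((f x : EReal) < ((p : ℝ) : EReal)) ↔ f x < p := fun x => EReal.coe_lt_coe_iff
  have hq : ∀ x, (((q : ℝ) : EReal) < (f x : EReal)) ↔ (q : ℝ) < f x :=
    fun x => EReal.coe_lt_coe_iff
  have hpq : (p : ℝ) < q := EReal.coe_lt_coe_iff.1 hpq
  simp only [hp] at h1
  simp only [hq] at h2
  rcases eventually_nhdsGT_or_not (P := fun x => f x < p) (.lt hf (.const _)) a with h | h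
  · obtain ⟨x, hx, hx'⟩ := (h2.and_eventually h).exists
    linarith
  · exact h1 h

theorem exists_tendsto_of_abs_le {f : ℝ → ℝ} (hf : DefReal L f) {a C : ℝ}
    (hC : ∀ᶠ x in 𝓝[>] a, |f x| ≤ C) : ∃ l : ℝ, Tendsto f (𝓝[>] a) (𝓝 l) := by
  obtain ⟨l, hl⟩ := hf.exists_tendsto_ereal a
  have h1 : l ≤ (C : EReal) := le_of_tendsto hl
    (hC.mono fun x hx => EReal.coe_le_coe_iff.2 (abs_le.1 hx).2)
  have h2 : ((-C : ℝ) : EReal) ≤ l := ge_of_tendsto hl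
    (hC.mono fun x hx => EReal.coe_le_coe_iff.2 (abs_le.1 hx).1)
  induction l using EReal.rec with
  | bot => simp at h2
  | top => simp at h1
  | coe l => exact ⟨l, EReal.tendsto_coe.1 hl⟩

/-- A limit of the quotient of definable functions is a limit of the quotient of the derivatives. -/
theorem tendsto_deriv_div {f g : ℝ → ℝ} (hf : DefReal L f) (hg : DefReal L g) {a c : ℝ}
    (hfa : Tendsto f (𝓝[>] a) (𝓝 0)) (hga : Tendsto g (𝓝[>] a) (𝓝 0))
    (hg' : ∀ᶠ x in 𝓝[>] a, _root_.deriv g x ≠ 0)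
    (hc : Tendsto (fun x => f x / g x) (𝓝[>] a) (𝓝 c)) :
    Tendsto (fun x => _root_.deriv f x / _root_.deriv g x) (𝓝[>] a) (𝓝 c) := by
  -- L'Hôpital's rule is used backwards: the quotient of derivatives is definable and so has some
  -- extended limit, which the rule passes on to `f / g` and thus forces to be `c`.
  obtain ⟨l, hl⟩ := (hf.deriv.div hg.deriv).exists_tendsto_ereal a
  have hop : ∀ F : Filter ℝ, Tendsto (fun x => _root_.deriv f x / _root_.deriv g x) (𝓝[>] a) F →
      Tendsto (fun x => f x / g x) (𝓝[>] a) F := fun F hF =>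
    deriv.lhopital_zero_nhdsGT (hf.eventually_differentiableAt a) hg' hfa hga hF
  induction l using EReal.rec with
  | bot => exact absurd hc (not_tendsto_nhds_of_tendsto_atBot
      (hop _ (EReal.tendsto_coe_nhds_bot_iff.1 hl)) c)
  | top => exact absurd hc (not_tendsto_nhds_of_tendsto_atTop
      (hop _ (EReal.tendsto_coe_nhds_top_iff.1 hl)) c)
  | coe l =>
    have hl' := EReal.tendsto_coe.1 hl
    rwa [tendsto_nhds_unique hc (hop _ hl')]

/-- A definable function that is positive near `a` and tends to `0` at `a` has positive derivative
near `a`. -/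
theorem eventually_deriv_pos {g : ℝ → ℝ} (hg : DefReal L g) {a : ℝ}
    (hpos : ∀ᶠ x in 𝓝[>] a, 0 < g x) (hga : Tendsto g (𝓝[>] a) (𝓝 0)) :
    ∀ᶠ x in 𝓝[>] a, 0 < _root_.deriv g x := by
  refine (eventually_nhdsGT_or_not (P := fun x => 0 < _root_.deriv g x)
    (.lt (.const _) hg.deriv) a).resolve_right fun h => ?_
  obtain ⟨b, hb, hb'⟩ := mem_nhdsGT_iff_exists_Ioo_subset.1
    ((h.and hpos).and (hg.eventually_differentiableAt a))
  have hanti : AntitoneOn g (Ioo a b) := by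
    refine antitoneOn_of_deriv_nonpos (convex_Ioo a b)
      (fun x hx => (hb' hx).2.continuousAt.continuousWithinAt)
      (fun x hx => (hb' (interior_subset hx)).2.differentiableWithinAt)
      (fun x hx => not_lt.1 (hb' (interior_subset hx)).1.1)
  obtain ⟨x, hx⟩ := exists_between (show a < b from hb)
  have hle : g x ≤ 0 := ge_of_tendsto hga (by
    filter_upwards [Ioo_mem_nhdsGT hx.1] with y hy
    exact hanti ⟨hy.1, hy.2.trans hx.2⟩ hx hy.2.le)
  exact absurd (hb' hx).1.2 (not_lt.2 hle)

end DefReal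
end OneVariable

/-! ### Definable choice and curve selection -/

section Choice

variable {L : FirstOrder.Language} [L.Structure ℝ] [hL : Fact (IsOMinimal L)]

/-- Makes the graph of `sInf` first-order, including its default value `0` when no greatest lower
bound exists. -/
theorem Real.sInf_eq_iff_isGLB {A : Set ℝ} {c : ℝ} :
    sInf A = c ↔ IsGLB A c ∨ (¬ ∃ d, IsGLB A d) ∧ c = 0 := by
  by_cases h : ∃ d, IsGLB A d
  · obtain ⟨d, hd⟩ := h
    have hne : A.Nonempty := hd.nonempty
    constructor
    · rintro rfl
      exact Or.inl (isGLB_csInf hne hd.bddBelow)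
    · rintro (h | h)
      · exact h.csInf_eq hne
      · exact absurd ⟨d, hd⟩ h.1
  · have h0 : sInf A = 0 := by
      rcases A.eq_empty_or_nonempty with rfl | hne
      · exact Real.sInf_empty
      · exact Real.sInf_of_not_bddBelow fun hb => h ⟨_, isGLB_csInf hne hb⟩
    rw [h0]
    constructor
    · exact fun hc => Or.inr ⟨h, hc.symm⟩
    · rintro (h' | h')
      · exact absurd ⟨c, h'⟩ h
      · exact h'.2.symm

theorem DefFn.sInf {α : Type} {S : (α → ℝ) → ℝ → Prop}
    (hS : DefPred L fun w : α ⊕ Fin 1 → ℝ => S (fun i => w (.inl i)) (w (.inr 0))) :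
    DefFn L fun v => sInf {x | S v x} := by
  have hS' : ∀ {β : Type} (σ : α → β) (j : β),
      DefPred L fun w : β → ℝ => S (fun i => w (σ i)) (w j) := fun σ j =>
    hS.reindex (Sum.elim σ fun _ => j)
  have hglb : ∀ {β : Type} (σ : α → β) (j : β),
      DefPred L fun w : β → ℝ => IsGLB {x | S (fun i => w (σ i)) x} (w j) := by
    intro β σ j
    have : DefPred L fun w : β → ℝ => (∀ x, S (fun i => w (σ i)) x → w j ≤ x) ∧
        ∀ d, (∀ x, S (fun i => w (σ i)) x → d ≤ x) → d ≤ w j := by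
      refine .and (.all (.imp ?_ (.le (.proj _) (.proj _)))) (.all (.imp (.all (.imp ?_
        (.le (.proj _) (.proj _)))) (.le (.proj _) (.proj _))))
      · exact hS' (fun i => Sum.inl (σ i)) (Sum.inr 0)
      · exact hS' (fun i => Sum.inl (Sum.inl (σ i))) (Sum.inr 0)
    exact this
  apply DefFn.of_graph
  simp only [Real.sInf_eq_iff_isGLB]
  exact .or (hglb _ _) (.and (.not (.ex (hglb (fun i => Sum.inl (Sum.inl i)) (Sum.inr 0))))
    (.eq (.proj _) (.const _)))

/-- Definable choice for families of bounded subsets of the line. -/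
theorem exists_defFn_choice {α : Type} [Finite α] {S : (α → ℝ) → ℝ → Prop}
    (hS : DefPred L fun w : α ⊕ Fin 1 → ℝ => S (fun i => w (.inl i)) (w (.inr 0)))
    (hb : ∀ v, ∃ C, ∀ x, S v x → |x| ≤ C) :
    ∃ e : (α → ℝ) → ℝ, DefFn L e ∧ ∀ v, (∃ x, S v x) → S v (e v) := by
  classical
  have hS' : ∀ {f : (α → ℝ) → ℝ}, DefFn L f → DefPred L fun v => S v (f v) := fun {f} hf => by
    have := DefPred.comp (P := fun w : α ⊕ Fin 1 → ℝ => S (fun i => w (.inl i)) (w (.inr 0))) hS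
      (F := fun v => Sum.elim v fun _ => f v)
      (by rintro (i | i); exacts [.proj _, hf])
    exact this
  -- The infimum `a v` is chosen if it belongs to the set. If not, the zero-one law puts an interval
  -- just above `a v` into the set, and the midpoint between `a v` and the first later gap `b v` is
  -- chosen.
  set a : (α → ℝ) → ℝ := fun v => sInf {x | S v x} with ha_def
  have ha : DefFn L a := .sInf hS
  set b : (α → ℝ) → ℝ := fun v => sInf {x | a v < x ∧ ¬ S v x}
  have hbD : DefFn L b := .sInf (S := fun v x => a v < x ∧ ¬ S v x)
    (.and (.lt (ha.reindex _) (.proj _)) hS.not)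
  refine ⟨fun v => if S v (a v) then a v else (a v + b v) / 2,
    Set.DefinableFun.ite (hS' ha) ha (DefFn.div (ha.add hbD) (.const 2)), fun v ⟨x₀, hx₀⟩ => ?_⟩
  by_cases hmin : S v (a v)
  · simp only [hmin, if_true]
  simp only [hmin, if_false]
  obtain ⟨C, hC⟩ := hb v
  have hbdd : BddBelow {x | S v x} := ⟨-C, fun x hx => (abs_le.1 (hC x hx)).1⟩
  have hglb : IsGLB {x | S v x} (a v) := isGLB_csInf ⟨x₀, hx₀⟩ hbdd
  have hdef : DefPred L fun w : Fin 1 → ℝ => S v (w 0) := by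
    have := DefPred.comp (P := fun w : α ⊕ Fin 1 → ℝ => S (fun i => w (.inl i)) (w (.inr 0))) hS
      (F := fun w : Fin 1 → ℝ => Sum.elim v fun _ => w 0)
      (by rintro (i | i); exacts [.const _, .proj _])
    exact this
  have hev : ∀ᶠ x in 𝓝[>] (a v), S v x := by
    refine (eventually_nhdsGT_or_not hdef (a v)).resolve_right fun h => ?_
    obtain ⟨d, hd, hd'⟩ := mem_nhdsGT_iff_exists_Ioo_subset.1 h
    have hle : d ≤ a v := by
      refine hglb.2 fun x hx => not_lt.1 fun hxd => ?_
      rcases (hglb.1 hx).eq_or_lt with h1 | h1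
      · exact hmin (h1 ▸ hx)
      · exact hd' ⟨h1, hxd⟩ hx
    exact absurd hle (not_le.2 hd)
  obtain ⟨d, hd, hd'⟩ := mem_nhdsGT_iff_exists_Ioo_subset.1 hev
  have hd : a v < d := hd
  have hne : {x | a v < x ∧ ¬ S v x}.Nonempty := by
    refine ⟨max (a v) C + 1, by linarith [le_max_left (a v) C], fun h => ?_⟩
    have := (abs_le.1 (hC _ h)).2
    linarith [le_max_right (a v) C]
  have hdb : d ≤ b v := le_csInf hne fun x hx => not_lt.1 fun hxd => hx.2 (hd' ⟨hx.1, hxd⟩)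
  by_contra hcon
  have : b v ≤ (a v + b v) / 2 := csInf_le ⟨a v, fun x hx => hx.1.le⟩ ⟨by linarith, hcon⟩
  linarith

/-- Induction on the number of coordinates: the first is chosen in the projection of the fibre, the
others in the fibre over that choice. -/
theorem exists_defMap_choice (n : ℕ) : ∀ {α : Type} [Finite α] {S : (α → ℝ) → (Fin n → ℝ) → Prop},
    DefPred L (fun w : α ⊕ Fin n → ℝ => S (fun i => w (.inl i)) fun i => w (.inr i)) →
    (∀ v, ∃ C, ∀ y, S v y → ∀ i, |y i| ≤ C) →
    ∃ F : (α → ℝ) → Fin n → ℝ, (∀ i, DefFn L fun v => F v i) ∧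
      ∀ v, (∃ y, S v y) → S v (F v) := by
  induction n with
  | zero =>
    intro α _ S _ _
    exact ⟨fun _ => Fin.elim0, fun i => i.elim0, fun v ⟨y, hy⟩ => by
      rwa [Subsingleton.elim y Fin.elim0] at hy⟩
  | succ n ih =>
    intro α _ S hS hb
    obtain ⟨e, he, he'⟩ := exists_defFn_choice
      (S := fun v x => ∃ y : Eucl n, S v (Fin.cons x y.ofLp)) (L := L) (α := α) (by
        refine .exVec ?_
        have := hS.reindex (Sum.elim (fun i => Sum.inl (Sum.inl i))
          (Fin.cons (Sum.inl (Sum.inr 0)) fun i => Sum.inr i) :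
            α ⊕ Fin (n + 1) → (α ⊕ Fin 1) ⊕ Fin n)
        convert! this using 3 with w
        funext i
        refine Fin.cases ?_ (fun i => ?_) i <;> rfl) (by
        intro v
        obtain ⟨C, hC⟩ := hb v
        exact ⟨C, fun x ⟨y, hy⟩ => by simpa using hC _ hy 0⟩)
    obtain ⟨F, hF, hF'⟩ := ih (S := fun v y => S v (Fin.cons (e v) y)) (α := α) (by
        have := DefPred.comp (L := L) hS
          (F := fun w : α ⊕ Fin n → ℝ => Sum.elim (fun i => w (.inl i))
            (Fin.cons (e fun i => w (.inl i)) fun i => w (.inr i))) (by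
          rintro (i | i)
          · exact .proj _
          · refine Fin.cases ?_ (fun i => ?_) i
            · exact he.reindex _
            · exact .proj _)
        exact this) (by
        intro v
        obtain ⟨C, hC⟩ := hb v
        exact ⟨C, fun y hy i => by simpa using hC _ hy i.succ⟩)
    refine ⟨fun v => Fin.cons (e v) (F v), fun i => ?_, fun v ⟨y, hy⟩ => ?_⟩
    · refine Fin.cases ?_ (fun i => ?_) i
      · exact he
      · exact hF i
    · apply hF' v
      obtain ⟨y', hy'⟩ := he' v ⟨y 0, WithLp.toLp 2 (Fin.tail y), by
        simpa [Fin.cons_self_tail] using hy⟩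
      exact ⟨_, hy'⟩

/-- Curve selection: a definable set accumulating at the origin contains a definable curve that
tends to the origin. -/
theorem exists_definable_curve {n : ℕ} {B : Set (Eucl n)} (hB : IsDefinableSet L B)
    (h0 : (0 : Eucl n) ∈ closure B) :
    ∃ γ : ℝ → Eucl n, (∀ i, DefReal L fun s => γ s i) ∧ ∀ s > 0, γ s ∈ B ∧ ‖γ s‖ < s := by
  -- The parameter is the radius, which also gives the bound on the fibres that choice requires.
  obtain ⟨F, hF, hF'⟩ := exists_defMap_choice n (L := L) (α := Fin 1)
    (S := fun v y => WithLp.toLp 2 y ∈ B ∧ ‖(WithLp.toLp 2 y : Eucl n)‖ < v 0)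
    (.and (.mem hB (.toLp _)) (.lt (DefVec.norm (.toLp _)) (.proj _)))
    fun v => ⟨v 0, fun y hy i => (PiLp.norm_apply_le (WithLp.toLp 2 y : Eucl n) i).trans hy.2.le⟩
  refine ⟨fun s => WithLp.toLp 2 (F fun _ => s), fun i => ?_, fun s hs => ?_⟩
  · exact DefFn.comp (hF i) (F := fun v : Fin 1 → ℝ => fun _ => v 0) fun _ => .proj _
  · apply hF' fun _ => s
    obtain ⟨y, hy, hys⟩ := Metric.mem_closure_iff.1 h0 s hs
    exact ⟨y.ofLp, hy, by simpa [dist_eq_norm] using hys⟩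

end Choice

/-! ### Coordinate subspaces, charts and tangent spaces -/

section Tangent

variable {n k d : ℕ}

theorem mem_flat {z : Eucl n} : z ∈ flat n d ↔ ∀ i : Fin n, d ≤ i.val → z i = 0 := Iff.rfl

theorem flat_mono {d e : ℕ} (h : d ≤ e) : flat n d ≤ flat n e :=
  fun _ hz i hi => hz i (h.trans hi)

theorem finrank_flat (h : d ≤ n) : Module.finrank ℝ (flat n d) = d := by
  let e : flat n d ≃ₗ[ℝ] (Fin d → ℝ) :=
    { toFun := fun z i => z.1 (Fin.castLE h i)
      invFun := fun v => ⟨WithLp.toLp 2 fun i : Fin n => if hi : i.val < d then v ⟨i.val, hi⟩ else 0,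
        fun i hi => by simp [not_lt.2 hi]⟩
      map_add' := fun _ _ => rfl
      map_smul' := fun _ _ => rfl
      left_inv := fun z => by
        ext i
        by_cases hi : i.val < d
        · simp [hi]
        · simpa [hi] using (z.2 i (not_lt.1 hi)).symm
      right_inv := fun v => by ext i; simp }
  rw [e.finrank_eq, Module.finrank_fin_fun]

theorem flat_starProjection_apply (y : Eucl n) (i : Fin n) :
    (flat n d).starProjection y i = if i.val < d then y i else 0 := by
  have : (flat n d).starProjection y =
      WithLp.toLp 2 fun i : Fin n => if i.val < d then y i else 0 := by
    refine Submodule.eq_starProjection_of_mem_of_inner_eq_zero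
      (mem_flat.2 fun i hi => by simp [not_lt.2 hi]) ?_
    intro w hw
    rw [PiLp.inner_apply]
    refine Finset.sum_eq_zero fun i _ => ?_
    by_cases hi : i.val < d
    · simp [hi]
    · simp [hw i (not_lt.1 hi)]
  rw [this]

/-- The component of `y` normal to `ℝᵈ × 0`. -/
noncomputable def normalPart (n d : ℕ) : Eucl n →L[ℝ] Eucl n :=
  ContinuousLinearMap.id ℝ _ - (flat n d).starProjection

theorem normalPart_apply (y : Eucl n) : normalPart n d y = y - (flat n d).starProjection y := rfl

theorem starProjection_add_normalPart (y : Eucl n) :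
    (flat n d).starProjection y + normalPart n d y = y := by simp [normalPart_apply]

theorem normalPart_mem_orthogonal (y : Eucl n) : normalPart n d y ∈ (flat n d)ᗮ :=
  Submodule.sub_starProjection_mem_orthogonal y

theorem normalPart_eq_zero_iff {y : Eucl n} : normalPart n d y = 0 ↔ y ∈ flat n d := by
  rw [normalPart_apply, sub_eq_zero, eq_comm, Submodule.starProjection_eq_self_iff]

theorem inner_normalPart_left (y v : Eucl n) :
    inner ℝ (normalPart n d y) (normalPart n d v) = inner ℝ (normalPart n d y) v := by
  conv_rhs => rw [← starProjection_add_normalPart (d := d) v, inner_add_right]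
  rw [Submodule.inner_left_of_mem_orthogonal (Submodule.starProjection_apply_mem _ _)
    (normalPart_mem_orthogonal y), zero_add]

theorem norm_normalPart_le (y : Eucl n) : ‖normalPart n d y‖ ≤ ‖y‖ := by
  have h := inner_normalPart_left (d := d) y y
  rw [real_inner_self_eq_norm_mul_norm] at h
  have h2 := real_inner_le_norm (normalPart n d y) y
  by_contra hcon
  have := norm_nonneg y
  nlinarith

theorem norm_starProjection_flat_le (y : Eucl n) : ‖(flat n d).starProjection y‖ ≤ ‖y‖ :=
  Submodule.norm_starProjection_apply_le _ _

theorem IsCpChart.mono {p q : ℕ} (h : q ≤ p) {φ : OpenPartialHomeomorph (Eucl n) (Eucl n)}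
    (hφ : IsCpChart p φ) : IsCpChart q φ :=
  ⟨hφ.1.of_le (by exact_mod_cast h), hφ.2.of_le (by exact_mod_cast h)⟩

theorem IsCpChart.symm {p : ℕ} {φ : OpenPartialHomeomorph (Eucl n) (Eucl n)}
    (hφ : IsCpChart p φ) : IsCpChart p φ.symm :=
  ⟨by simpa using hφ.2, by simpa using hφ.1⟩

theorem IsCpChart.trans {p : ℕ} {φ ψ : OpenPartialHomeomorph (Eucl n) (Eucl n)}
    (hφ : IsCpChart p φ) (hψ : IsCpChart p ψ) : IsCpChart p (φ.trans ψ) := by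
  constructor
  · rw [OpenPartialHomeomorph.coe_trans]
    exact hψ.1.comp (hφ.1.mono fun x hx => by simp at hx; exact hx.1)
      fun x hx => by simp at hx; exact hx.2
  · rw [OpenPartialHomeomorph.coe_trans_symm]
    exact hφ.2.comp (hψ.2.mono fun x hx => by simp at hx; exact hx.1)
      fun x hx => by simp at hx; exact hx.2

theorem IsCpChart.contDiffAt {p : ℕ} {φ : OpenPartialHomeomorph (Eucl n) (Eucl n)}
    (hφ : IsCpChart p φ) {x : Eucl n} (hx : x ∈ φ.source) : ContDiffAt ℝ p φ x :=
  hφ.1.contDiffAt (φ.open_source.mem_nhds hx)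

/-- The derivative of a chart is invertible, and its inverse is the derivative of the inverse. -/
theorem IsCpChart.exists_equiv {φ : OpenPartialHomeomorph (Eucl n) (Eucl n)}
    (hφ : IsCpChart 1 φ) {x : Eucl n} (hx : x ∈ φ.source) :
    ∃ A : Eucl n ≃L[ℝ] Eucl n, HasStrictFDerivAt φ (A : Eucl n →L[ℝ] Eucl n) x ∧
      HasStrictFDerivAt φ.symm (A.symm : Eucl n →L[ℝ] Eucl n) (φ x) := by
  have h1 : HasStrictFDerivAt φ (fderiv ℝ φ x) x := (hφ.contDiffAt hx).hasStrictFDerivAt (by simp)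
  have h2 : HasStrictFDerivAt φ.symm (fderiv ℝ φ.symm (φ x)) (φ x) :=
    (hφ.symm.contDiffAt (φ.map_source hx)).hasStrictFDerivAt (by simp)
  have e1 : (fderiv ℝ φ.symm (φ x)).comp (fderiv ℝ φ x) = ContinuousLinearMap.id ℝ _ := by
    refine HasFDerivAt.unique (h2.hasFDerivAt.comp x h1.hasFDerivAt)
      ((hasFDerivAt_id x).congr_of_eventuallyEq ?_)
    filter_upwards [φ.open_source.mem_nhds hx] with z hz using φ.left_inv hz
  have e2 : (fderiv ℝ φ x).comp (fderiv ℝ φ.symm (φ x)) = ContinuousLinearMap.id ℝ _ := by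
    have h1' : HasFDerivAt φ (fderiv ℝ φ x) (φ.symm (φ x)) := by
      rw [φ.left_inv hx]; exact h1.hasFDerivAt
    refine HasFDerivAt.unique (h1'.comp (φ x) h2.hasFDerivAt)
      ((hasFDerivAt_id (φ x)).congr_of_eventuallyEq ?_)
    filter_upwards [φ.open_target.mem_nhds (φ.map_source hx)] with z hz using φ.right_inv hz
  exact ⟨ContinuousLinearEquiv.equivOfInverse _ _ (fun v => DFunLike.congr_fun e1 v)
    fun v => DFunLike.congr_fun e2 v, h1, h2⟩

theorem map_tangentSpaceOf_le {M M' : Set (Eucl n)} {f : Eucl n → Eucl n} {y : Eucl n}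
    {A : Eucl n →L[ℝ] Eucl n} (hf : HasFDerivAt f A y) (hM : ∀ᶠ z in 𝓝[M] y, f z ∈ M') :
    (tangentSpaceOf M y).map (A : Eucl n →ₗ[ℝ] Eucl n) ≤ tangentSpaceOf M' (f y) := by
  rw [tangentSpaceOf, Submodule.map_span, Submodule.span_le]
  rintro _ ⟨v, ⟨γ, h0, hγM, hγ⟩, rfl⟩
  refine Submodule.subset_span ⟨fun t => f (γ t), congrArg f h0, ?_, ?_⟩
  · have : Tendsto γ (𝓝 0) (𝓝[M] y) :=
      tendsto_nhdsWithin_iff.2 ⟨h0 ▸ hγ.continuousAt.tendsto, hγM⟩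
    exact this.eventually hM
  · exact HasFDerivAt.comp_hasDerivAt (0 : ℝ) (by rw [h0]; exact hf) hγ

theorem Submodule.tangentSpaceOf_eq (F : Submodule ℝ (Eucl n)) {y : Eucl n} (hy : y ∈ F) :
    tangentSpaceOf (F : Set (Eucl n)) y = F := by
  apply le_antisymm
  · rw [tangentSpaceOf, Submodule.span_le]
    rintro v ⟨γ, h0, hγM, hγ⟩
    have hc : IsClosed (F : Set (Eucl n)) := F.closed_of_finiteDimensional
    have := hasDerivAt_iff_tendsto_slope.1 hγ
    refine hc.mem_of_tendsto this ?_
    filter_upwards [nhdsWithin_le_nhds hγM] with t ht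
    rw [slope_def_module]
    exact F.smul_mem _ (F.sub_mem ht (h0 ▸ hy))
  · intro v hv
    refine Submodule.subset_span ⟨fun t => y + t • v, by simp, ?_, ?_⟩
    · exact .of_forall fun t => F.add_mem hy (F.smul_mem _ hv)
    · simpa using ((hasDerivAt_id (0 : ℝ)).smul_const v).const_add y

/-- Tangent spaces are transported by charts. -/
theorem tangentSpaceOf_isImage {φ : OpenPartialHomeomorph (Eucl n) (Eucl n)} {M M' : Set (Eucl n)}
    (hM : φ.IsImage M M') {y : Eucl n} (hy : y ∈ φ.source) {A : Eucl n ≃L[ℝ] Eucl n}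
    (hA : HasFDerivAt φ (A : Eucl n →L[ℝ] Eucl n) y)
    (hA' : HasFDerivAt φ.symm (A.symm : Eucl n →L[ℝ] Eucl n) (φ y)) {v : Eucl n} :
    v ∈ tangentSpaceOf M y ↔ A v ∈ tangentSpaceOf M' (φ y) := by
  constructor
  · intro hv
    refine map_tangentSpaceOf_le hA ?_ ⟨v, hv, rfl⟩
    filter_upwards [self_mem_nhdsWithin, nhdsWithin_le_nhds (φ.open_source.mem_nhds hy)]
      with z hz hz' using (hM hz').2 hz
  · intro hv
    have := map_tangentSpaceOf_le (M' := M) hA' ?_ ⟨_, hv, rfl⟩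
    · simpa [φ.left_inv hy] using this
    filter_upwards [self_mem_nhdsWithin,
      nhdsWithin_le_nhds (φ.open_target.mem_nhds (φ.map_source hy))] with z hz hz'
    exact (hM.symm hz').2 hz

theorem finrank_tangentSpaceOf {M : Set (Eucl n)} (hM : IsCpSubmanifold 1 d M) {y : Eucl n}
    (hy : y ∈ M) : Module.finrank ℝ (tangentSpaceOf M y) = d := by
  obtain ⟨hd, h⟩ := hM
  obtain ⟨ψ, hyψ, hψ, hMψ⟩ := h y hy
  obtain ⟨A, hA, hA'⟩ := hψ.exists_equiv hyψ
  have : tangentSpaceOf M y = (flat n d).map (A.symm.toLinearEquiv : Eucl n →ₗ[ℝ] Eucl n) := by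
    ext v
    rw [tangentSpaceOf_isImage hMψ hyψ hA.hasFDerivAt hA'.hasFDerivAt,
      Submodule.tangentSpaceOf_eq _ ((hMψ hyψ).2 hy)]
    constructor
    · intro hv; exact ⟨A v, hv, by simp⟩
    · rintro ⟨w, hw, rfl⟩; simpa using hw
  rw [this, LinearEquiv.finrank_map_eq, finrank_flat hd]

/-- Limits of secants are tangent. -/
theorem mem_tangentSpaceOf_of_tendsto_secant {M : Set (Eucl n)} (hM : IsCpSubmanifold 1 d M)
    {y u : Eucl n} (hy : y ∈ M) {ι : Type*} {l : Filter ι} [l.NeBot] {z : ι → Eucl n}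
    (hz : Tendsto z l (𝓝 y)) (hzM : ∀ᶠ i in l, z i ∈ M)
    (hu : Tendsto (fun i => ‖z i - y‖⁻¹ • (z i - y)) l (𝓝 u)) : u ∈ tangentSpaceOf M y := by
  obtain ⟨hd, h⟩ := hM
  obtain ⟨ψ, hyψ, hψ, hMψ⟩ := h y hy
  obtain ⟨A, hA, hA'⟩ := hψ.exists_equiv hyψ
  rw [tangentSpaceOf_isImage hMψ hyψ hA.hasFDerivAt hA'.hasFDerivAt,
      Submodule.tangentSpaceOf_eq _ ((hMψ hyψ).2 hy)]
  have hc : IsClosed (flat n d : Set (Eucl n)) := (flat n d).closed_of_finiteDimensional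
  have h1 : Tendsto (fun i => ‖z i - y‖⁻¹ • (ψ (z i) - ψ y - A (z i - y))) l (𝓝 0) := by
    have := (hasFDerivAt_iff_tendsto.1 hA.hasFDerivAt).comp hz
    rw [tendsto_zero_iff_norm_tendsto_zero]
    refine this.congr fun i => ?_
    simp [norm_smul]
  have h2 : Tendsto (fun i => ‖z i - y‖⁻¹ • (ψ (z i) - ψ y)) l (𝓝 (A u)) := by
    have := h1.add ((A.continuous.tendsto u).comp hu)
    rw [zero_add] at this
    refine this.congr fun i => ?_
    simp [smul_sub]
  refine hc.mem_of_tendsto h2 ?_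
  filter_upwards [hzM, hz.eventually (ψ.open_source.mem_nhds hyψ)] with i hi hi'
  exact (flat n d).smul_mem _ ((flat n d).sub_mem ((hMψ hi').2 hi) ((hMψ hyψ).2 hy))

/-- If a subspace `T` is close to `K ⊕ ℝθ` and has the same dimension, then the components along
`K` and `θ` control the vectors of `T`. -/
theorem norm_le_of_close {K T : Submodule ℝ (Eucl n)} {θ : Eucl n} (hθ : ‖θ‖ = 1) (hθK : θ ∈ Kᗮ)
    (hdim : Module.finrank ℝ T = Module.finrank ℝ K + 1)
    (hK : ∀ e ∈ K, ∃ v ∈ T, ‖v - e‖ ≤ 1 / 8 * ‖e‖) (hT : ∃ v ∈ T, ‖v - θ‖ ≤ 1 / 8)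
    {v : Eucl n} (hv : v ∈ T) {m : ℝ} (h1 : ‖K.starProjection v‖ ≤ m) (h2 : |inner ℝ θ v| ≤ m) :
    ‖v‖ ≤ 4 * m := by
  -- Orthogonal projection of `K ⊕ ℝθ` to `T`. Closeness makes it injective, equality of dimensions
  -- then makes it surjective, so `v` is the projection of some `p.1 + p.2 • θ`.
  let f : (K × ℝ) →ₗ[ℝ] T :=
    (T.orthogonalProjectionOnto : Eucl n →ₗ[ℝ] T) ∘ₗ
      (LinearMap.coprod K.subtype (LinearMap.toSpanSingleton ℝ _ θ))
  have hf : ∀ p : K × ℝ, (f p : Eucl n) = T.starProjection (p.1 + p.2 • θ) := fun p => rfl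
  have hproj : ∀ w : Eucl n, ∀ v ∈ T, ‖T.starProjection w - w‖ ≤ ‖v - w‖ := by
    intro w v hv
    rw [norm_sub_rev, norm_sub_rev v, Submodule.starProjection_minimal]
    exact ciInf_le ⟨0, by rintro _ ⟨x, rfl⟩; exact norm_nonneg _⟩ (⟨v, hv⟩ : T)
  have hclose : ∀ p : K × ℝ, ‖(f p : Eucl n) - (p.1 + p.2 • θ)‖ ≤
      1 / 8 * ‖(p.1 : Eucl n)‖ + 1 / 8 * |p.2| := by
    intro p
    obtain ⟨v1, hv1, h1⟩ := hK p.1 p.1.2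
    obtain ⟨v2, hv2, h2⟩ := hT
    rw [hf]
    refine (hproj _ _ (T.add_mem hv1 (T.smul_mem p.2 hv2))).trans ?_
    have : v1 + p.2 • v2 - (p.1 + p.2 • θ) = (v1 - p.1) + p.2 • (v2 - θ) := by module
    rw [this]
    refine (norm_add_le _ _).trans (add_le_add h1 ?_)
    rw [norm_smul, Real.norm_eq_abs, mul_comm]
    exact mul_le_mul_of_nonneg_right h2 (abs_nonneg _)
  have hcomp : ∀ p : K × ℝ, ‖(p.1 : Eucl n)‖ ≤ ‖K.starProjection (f p : Eucl n)‖ +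
      ‖(f p : Eucl n) - (p.1 + p.2 • θ)‖ ∧ |p.2| ≤ |inner ℝ θ (f p : Eucl n)| +
      ‖(f p : Eucl n) - (p.1 + p.2 • θ)‖ := by
    intro p
    set w : Eucl n := p.1 + p.2 • θ with hw
    have hKθ : K.starProjection θ = 0 := (Submodule.starProjection_apply_eq_zero_iff K).2 hθK
    have e1 : K.starProjection w = p.1 := by
      rw [hw, map_add, map_smul, hKθ, Submodule.starProjection_eq_self_iff.2 p.1.2]; simp
    have e2 : inner ℝ θ w = p.2 := by
      rw [hw, inner_add_right, real_inner_smul_right, real_inner_self_eq_norm_sq, hθ,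
        Submodule.inner_left_of_mem_orthogonal p.1.2 hθK]; simp
    constructor
    · have : (p.1 : Eucl n) = K.starProjection (f p : Eucl n) - K.starProjection ((f p : Eucl n) - w) := by
        rw [map_sub, e1]; abel
      calc ‖(p.1 : Eucl n)‖ = ‖K.starProjection (f p : Eucl n) - K.starProjection ((f p : Eucl n) - w)‖ := by
            rw [← this]
        _ ≤ _ := (norm_sub_le _ _).trans (add_le_add le_rfl (Submodule.norm_starProjection_apply_le _ _))
    · have : p.2 = inner ℝ θ (f p : Eucl n) - inner ℝ θ ((f p : Eucl n) - w) := by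
        rw [inner_sub_right, e2]; ring
      calc |p.2| = |inner ℝ θ (f p : Eucl n) - inner ℝ θ ((f p : Eucl n) - w)| := by rw [← this]
        _ ≤ |inner ℝ θ (f p : Eucl n)| + |inner ℝ θ ((f p : Eucl n) - w)| := abs_sub _ _
        _ ≤ _ := by
          refine add_le_add le_rfl ((abs_real_inner_le_norm _ _).trans ?_)
          rw [hθ, one_mul]
  have hinj : Function.Injective f := by
    rw [← LinearMap.ker_eq_bot, LinearMap.ker_eq_bot']
    intro p hp
    have a := hcomp p
    have b := hclose p
    simp only [hp, ZeroMemClass.coe_zero, map_zero, norm_zero, inner_zero_right, abs_zero] at a b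
    have c1 := norm_nonneg (p.1 : Eucl n)
    have c2 := abs_nonneg p.2
    have d1 : ‖(p.1 : Eucl n)‖ = 0 := by linarith [a.1, a.2]
    have d2 : |p.2| = 0 := by linarith [a.1, a.2]
    exact Prod.ext (by simpa using d1) (by simpa using d2)
  have hsurj : Function.Surjective f :=
    (LinearMap.injective_iff_surjective_of_finrank_eq_finrank (by simp [hdim])).1 hinj
  obtain ⟨p, hp⟩ := hsurj ⟨v, hv⟩
  have a := hcomp p
  have b := hclose p
  have hp' : (f p : Eucl n) = v := by rw [hp]
  rw [hp'] at a b
  have c : ‖v‖ ≤ ‖(p.1 : Eucl n)‖ + |p.2| + ‖v - (p.1 + p.2 • θ)‖ := by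
    have : v = p.1 + p.2 • θ + (v - (p.1 + p.2 • θ)) := by abel
    calc ‖v‖ = ‖(p.1 : Eucl n) + p.2 • θ + (v - (p.1 + p.2 • θ))‖ := by rw [← this]
      _ ≤ _ := (norm_add_le _ _).trans (add_le_add ((norm_add_le _ _).trans (by
          rw [norm_smul, hθ, mul_one, Real.norm_eq_abs])) le_rfl)
  -- For s = ‖p.1‖ + |p.2| the estimates give s ≤ 2m + s/4 and ‖v‖ ≤ 9s/8, hence even ‖v‖ ≤ 3m.
  linarith [a.1, a.2, norm_nonneg (p.1 : Eucl n), abs_nonneg p.2]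

end Tangent

/-! ### Definable curves tending to the origin -/

section Curves

variable {L : FirstOrder.Language} [L.Structure ℝ] [hL : Fact (IsOMinimal L)] {n k : ℕ}

theorem DefReal.norm {g : ℝ → Eucl n} (hg : ∀ i, DefReal L fun s => g s i) :
    DefReal L fun s => ‖g s‖ :=
  DefVec.norm (f := fun v : Fin 1 → ℝ => g (v 0)) hg

theorem DefReal.eventually_differentiableAt_eucl {g : ℝ → Eucl n}
    (hg : ∀ i, DefReal L fun s => g s i) : ∀ᶠ s in 𝓝[>] (0 : ℝ), DifferentiableAt ℝ g s := by
  have : ∀ᶠ s in 𝓝[>] (0 : ℝ), ∀ i, DifferentiableAt ℝ (fun s => g s i) s :=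
    eventually_all.2 fun i => (hg i).eventually_differentiableAt 0
  filter_upwards [this] with s hs
  exact differentiableAt_euclidean.2 hs

theorem deriv_apply_eucl {g : ℝ → Eucl n} {s : ℝ} (hg : DifferentiableAt ℝ g s) (i : Fin n) :
    (deriv g s) i = deriv (fun s => g s i) s :=
  (((EuclideanSpace.proj i : Eucl n →L[ℝ] ℝ).hasFDerivAt.comp_hasDerivAt s
    hg.hasDerivAt).deriv).symm

theorem eventually_deriv_norm_pos {g : ℝ → Eucl n} (hg : ∀ i, DefReal L fun s => g s i)
    (h0 : Tendsto g (𝓝[>] 0) (𝓝 0)) (hne : ∀ᶠ s in 𝓝[>] (0 : ℝ), g s ≠ 0) :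
    ∀ᶠ s in 𝓝[>] (0 : ℝ), 0 < deriv (fun s => ‖g s‖) s :=
  (DefReal.norm hg).eventually_deriv_pos (hne.mono fun s hs => norm_pos_iff.2 hs) (by
    simpa using h0.norm)

/-- The velocity of a definable curve tending to the origin is asymptotically radial. -/
theorem eventually_norm_deriv_sub_le {g : ℝ → Eucl n} (hg : ∀ i, DefReal L fun s => g s i)
    (h0 : Tendsto g (𝓝[>] 0) (𝓝 0)) (hne : ∀ᶠ s in 𝓝[>] (0 : ℝ), g s ≠ 0) {η : ℝ} (hη : 0 < η) :
    ∀ᶠ s in 𝓝[>] (0 : ℝ), ‖deriv g s - (deriv (fun s => ‖g s‖) s / ‖g s‖) • g s‖ ≤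
      η * deriv (fun s => ‖g s‖) s := by
  have hpos := eventually_deriv_norm_pos hg h0 hne
  have hρ0 : Tendsto (fun s => ‖g s‖) (𝓝[>] 0) (𝓝 0) := by simpa using h0.norm
  -- Each bounded definable quotient `g s i / ‖g s‖` has a limit, and the quotient of the
  -- derivatives has the same limit.
  have hcomp : ∀ i, Tendsto (fun s => deriv (fun s => g s i) s / deriv (fun s => ‖g s‖) s -
      g s i / ‖g s‖) (𝓝[>] 0) (𝓝 0) := by
    intro i
    obtain ⟨c, hc⟩ := ((hg i).div (DefReal.norm hg)).exists_tendsto_of_abs_le (a := 0) (C := 1)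
      (.of_forall fun s => by
        rw [abs_div, abs_norm]
        exact div_le_one_of_le₀ (PiLp.norm_apply_le (g s) i) (norm_nonneg _))
    have hi0 : Tendsto (fun s => g s i) (𝓝[>] 0) (𝓝 0) := by
      simpa [Function.comp_def] using
        ((EuclideanSpace.proj i : Eucl n →L[ℝ] ℝ).continuous.tendsto 0).comp h0
    have := (hg i).tendsto_deriv_div (DefReal.norm hg) hi0 hρ0 (hpos.mono fun s hs => hs.ne') hc
    simpa using this.sub hc
  have hvec : Tendsto (fun s => (WithLp.toLp 2 fun i => deriv (fun s => g s i) s /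
      deriv (fun s => ‖g s‖) s - g s i / ‖g s‖ : Eucl n)) (𝓝[>] 0) (𝓝 0) :=
    ((PiLp.continuous_toLp 2 _).tendsto 0).comp (tendsto_pi_nhds.2 hcomp)
  have hev := hvec.norm.eventually (gt_mem_nhds (by simpa using hη))
  filter_upwards [hev, hpos, DefReal.eventually_differentiableAt_eucl hg] with s hs hp hd
  have : deriv g s - (deriv (fun s => ‖g s‖) s / ‖g s‖) • g s = deriv (fun s => ‖g s‖) s •
      (WithLp.toLp 2 fun i => deriv (fun s => g s i) s / deriv (fun s => ‖g s‖) s -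
        g s i / ‖g s‖ : Eucl n) := by
    ext i
    simp only [PiLp.sub_apply, PiLp.smul_apply, smul_eq_mul, deriv_apply_eucl hd]
    field_simp
  rw [this, norm_smul, Real.norm_of_nonneg hp.le, mul_comm]
  exact mul_le_mul_of_nonneg_right hs.le hp.le

end Curves

/-! ### The radial direction is asymptotically tangent -/

section RadialTangent

variable {L : FirstOrder.Language} [L.Structure ℝ] [hL : Fact (IsOMinimal L)] {n k : ℕ}

/-- The points of `Y` near which the secants of `Y` stay away from the normal direction. -/
def secantFarSet (k : ℕ) (Y : Set (Eucl n)) (c : ℝ) : Set (Eucl n) :=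
  {y | y ∈ Y ∧ ∃ δ : ℝ, 0 < δ ∧ ∀ z, z ∈ Y → ‖z - y‖ < δ →
    |inner ℝ (z - y) (normalPart n k y)| ≤ c * (‖z - y‖ * ‖normalPart n k y‖)}

theorem DefVec.normalPart {α : Type} {f : (α → ℝ) → Eucl n} (hf : DefVec L f) :
    DefVec L fun v => normalPart n k (f v) := by
  intro i
  simp only [normalPart_apply, PiLp.sub_apply, flat_starProjection_apply]
  refine .sub (hf i) ?_
  split_ifs
  exacts [hf i, .const _]

/-- This is why bad points are described by secants: the condition quantifies over points of `Y`
only, so no definability of tangent spaces is needed. -/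
theorem isDefinableSet_secantFarSet {Y : Set (Eucl n)} (hY : IsDefinableSet L Y) (c : ℝ) :
    IsDefinableSet L (secantFarSet k Y c) := by
  have : DefPred L fun v : Fin n → ℝ => WithLp.toLp 2 v ∈ secantFarSet k Y c := by
    refine .and hY (.ex (.and (.lt (.const _) (.proj _)) (.allVec (.imp (.mem hY (.toLp _))
      (.imp (.lt (DefVec.norm (.sub (.toLp _) ?_)) (.proj _)) (.le (.abs (DefVec.inner (.sub (.toLp _) ?_)
        (.normalPart ?_))) (.mul (.const _) (.mul (DefVec.norm (.sub (.toLp _) ?_))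
          (DefVec.norm (.normalPart ?_)))))))))) <;>
    exact .toLp _
  exact this

/-- Outside the set there are arbitrarily short secants whose directions make an angle of cosine
greater than `c` with the normal line. A limit direction `u` is tangent, and the projection of the
normal part to `ℝu` is the required vector. -/
theorem exists_tangent_near_of_notMem_secantFarSet {d : ℕ} {Y : Set (Eucl n)}
    (hY : IsCpSubmanifold 1 d Y)
    {c : ℝ} {y : Eucl n} (hy : y ∈ Y) (hc : 0 ≤ c) (hyc : y ∉ secantFarSet k Y c) :
    ∃ v ∈ tangentSpaceOf Y y,
      ‖normalPart n k y - v‖ ^ 2 ≤ (1 - c ^ 2) * ‖normalPart n k y‖ ^ 2 := by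
  set h := normalPart n k y
  have key : ∀ m : ℕ, ∃ z ∈ Y, ‖z - y‖ < 1 / ((m : ℝ) + 1) ∧
      c * (‖z - y‖ * ‖h‖) < |inner ℝ (z - y) h| := by
    intro m
    by_contra hcon
    push Not at hcon
    exact hyc ⟨hy, 1 / ((m : ℝ) + 1), by positivity, fun z hz hz' => hcon z hz hz'⟩
  choose z hzY hz hzc using key
  have hne : ∀ m, z m - y ≠ 0 := by
    intro m h0
    have := hzc m
    simp [h0] at this
  have hmem : ∀ m, ‖z m - y‖⁻¹ • (z m - y) ∈ Metric.sphere (0 : Eucl n) 1 := by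
    intro m
    simp [norm_smul, norm_ne_zero_iff.2 (hne m)]
  obtain ⟨u, hu, σ, hσ, hlim⟩ := (isCompact_sphere (0 : Eucl n) 1).tendsto_subseq hmem
  have hzlim : Tendsto z atTop (𝓝 y) := by
    rw [tendsto_iff_norm_sub_tendsto_zero]
    exact squeeze_zero (fun _ => norm_nonneg _) (fun m => (hz m).le)
      tendsto_one_div_add_atTop_nhds_zero_nat
  have huT : u ∈ tangentSpaceOf Y y := mem_tangentSpaceOf_of_tendsto_secant hY hy
    (hzlim.comp hσ.tendsto_atTop) (.of_forall fun m => hzY _) hlim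
  have hu1 : ‖u‖ = 1 := by simpa using hu
  have hin : c * ‖h‖ ≤ |inner ℝ u h| := by
    refine ge_of_tendsto ((hlim.inner tendsto_const_nhds).abs) (.of_forall fun m => ?_)
    have h1 := hzc (σ m)
    have h2 := norm_pos_iff.2 (hne (σ m))
    simp only [Function.comp, real_inner_smul_left, abs_mul, abs_inv, abs_norm]
    rw [inv_mul_eq_div, le_div_iff₀ h2]
    nlinarith
  refine ⟨inner ℝ u h • u, Submodule.smul_mem _ _ huT, ?_⟩
  have h3 : (c * ‖h‖) ^ 2 ≤ (inner ℝ u h) ^ 2 := by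
    rw [← sq_abs (inner ℝ u h)]
    exact pow_le_pow_left₀ (by positivity) hin 2
  rw [norm_sub_sq_real, real_inner_smul_right, real_inner_comm u h, norm_smul, hu1, mul_one,
    Real.norm_eq_abs, sq_abs]
  nlinarith

/-- A tangent vector is the velocity of a curve in `Y` that is straight in a chart, so the
inequality for secants passes to the limit. -/
theorem inner_le_of_mem_secantFarSet {d : ℕ} {Y : Set (Eucl n)} (hY : IsCpSubmanifold 1 d Y)
    {c : ℝ} {y : Eucl n} (hyc : y ∈ secantFarSet k Y c) {v : Eucl n}
    (hv : v ∈ tangentSpaceOf Y y) :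
    |inner ℝ v (normalPart n k y)| ≤ c * (‖v‖ * ‖normalPart n k y‖) := by
  obtain ⟨hy, δ, hδ, hsec⟩ := hyc
  obtain ⟨hd, hch⟩ := hY
  obtain ⟨ψ, hyψ, hψ, hYψ⟩ := hch y hy
  obtain ⟨A, hA, hA'⟩ := hψ.exists_equiv hyψ
  rw [tangentSpaceOf_isImage hYψ hyψ hA.hasFDerivAt hA'.hasFDerivAt,
    Submodule.tangentSpaceOf_eq _ ((hYψ hyψ).2 hy)] at hv
  set γ : ℝ → Eucl n := fun t => ψ.symm (ψ y + t • A v)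
  have hline : HasDerivAt (fun t : ℝ => ψ y + t • A v) (A v) 0 := by
    simpa using ((hasDerivAt_id (0 : ℝ)).smul_const (A v)).const_add (ψ y)
  have hγ : HasDerivAt γ v 0 := by
    have := HasFDerivAt.comp_hasDerivAt (0 : ℝ) (f := fun t : ℝ => ψ y + t • A v)
      (by simpa using hA'.hasFDerivAt) hline
    rwa [ContinuousLinearEquiv.coe_coe, A.symm_apply_apply] at this
  have hγ0 : γ 0 = y := by simp [γ, ψ.left_inv hyψ]
  have hlim := hasDerivAt_iff_tendsto_slope.1 hγ
  have htar : ∀ᶠ t in 𝓝 (0 : ℝ), ψ y + t • A v ∈ ψ.target :=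
    hline.continuousAt.eventually_mem (ψ.open_target.mem_nhds (by simpa using ψ.map_source hyψ))
  have hnear : ∀ᶠ t in 𝓝 (0 : ℝ), ‖γ t - y‖ < δ := by
    have := hγ.continuousAt.eventually_mem (Metric.ball_mem_nhds (γ 0) hδ)
    simpa [hγ0, dist_eq_norm] using this
  refine le_of_tendsto_of_tendsto ((hlim.inner tendsto_const_nhds).abs)
    ((hlim.norm.mul_const _).const_mul c) ?_
  filter_upwards [nhdsWithin_le_nhds htar, nhdsWithin_le_nhds hnear] with t h1 h2
  have hmem : γ t ∈ Y := (hYψ.symm h1).2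
    ((flat n d).add_mem ((hYψ hyψ).2 hy) ((flat n d).smul_mem _ hv))
  have := hsec _ hmem h2
  rw [slope_def_module, hγ0, real_inner_smul_left, norm_smul, abs_mul, Real.norm_eq_abs]
  calc _ ≤ |(t - 0)⁻¹| * (c * (‖γ t - y‖ * ‖normalPart n k y‖)) :=
        mul_le_mul_of_nonneg_left this (abs_nonneg _)
    _ = _ := by ring

end RadialTangent

/-! ### The integral condition against the logarithmic derivative -/

section RadialTangent

variable {L : FirstOrder.Language} [L.Structure ℝ] [hL : Fact (IsOMinimal L)] {n k : ℕ}

theorem Submodule.infEDist_eq (T : Submodule ℝ (Eucl n)) (u : Eucl n) :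
    Metric.infEDist u (T : Set (Eucl n)) = ENNReal.ofReal ‖u - T.starProjection u‖ := by
  apply le_antisymm
  · refine (Metric.infEDist_le_edist_of_mem (T.starProjection_apply_mem u)).trans ?_
    rw [edist_dist, dist_eq_norm]
  · refine Metric.le_infEDist.2 fun v hv => ?_
    rw [edist_dist, dist_eq_norm]
    refine ENNReal.ofReal_le_ofReal ?_
    rw [Submodule.starProjection_minimal]
    exact ciInf_le ⟨0, by rintro _ ⟨x, rfl⟩; exact norm_nonneg _⟩ (⟨v, hv⟩ : T)

theorem ofReal_norm_sub_starProjection_le {E T : Submodule ℝ (Eucl n)} {e : Eucl n} (he : e ∈ E) :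
    ENNReal.ofReal ‖e - T.starProjection e‖ ≤ ENNReal.ofReal ‖e‖ * gapDist E T := by
  rcases eq_or_ne e 0 with rfl | h0
  · simp
  have hpos : 0 < ‖e‖ := norm_pos_iff.2 h0
  have h1 : Metric.infEDist (‖e‖⁻¹ • e) (T : Set (Eucl n)) ≤ gapDist E T :=
    le_iSup_of_le (‖e‖⁻¹ • e) (le_iSup_of_le (E.smul_mem _ he) (le_iSup_of_le (by
      simp [norm_smul, hpos.ne']) le_rfl))
  rw [Submodule.infEDist_eq, map_smul, ← smul_sub, norm_smul, norm_inv, norm_norm] at h1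
  calc ENNReal.ofReal ‖e - T.starProjection e‖
      = ENNReal.ofReal ‖e‖ * ENNReal.ofReal (‖e‖⁻¹ * ‖e - T.starProjection e‖) := by
        rw [← ENNReal.ofReal_mul hpos.le]; congr 1; field_simp
    _ ≤ _ := by gcongr

/-- Completing the square: with v the projection of h, the difference of the two sides is at least
(‖v‖ - c‖h‖)². -/
theorem mul_norm_le_norm_sub_of_inner_le {T : Submodule ℝ (Eucl n)} {h : Eucl n} {c : ℝ}
    (hT : ∀ v ∈ T, |inner ℝ v h| ≤ c * (‖v‖ * ‖h‖)) :
    (1 - c ^ 2) * ‖h‖ ^ 2 ≤ ‖h - T.starProjection h‖ ^ 2 := by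
  set v := T.starProjection h
  have h1 : inner ℝ v h ≤ c * (‖v‖ * ‖h‖) :=
    (le_abs_self _).trans (hT v (T.starProjection_apply_mem h))
  rw [norm_sub_sq_real, real_inner_comm v h]
  nlinarith [sq_nonneg (‖v‖ - c * ‖h‖)]

/-- The integrand is the derivative of log ρ, which is unbounded near `0`. -/
theorem lintegral_ofReal_logDeriv_eq_top {ρ : ℝ → ℝ} {b : ℝ} (hb : 0 < b)
    (hpos : ∀ s ∈ Ioo 0 b, 0 < ρ s) (hd : ∀ s ∈ Ioo 0 b, DifferentiableAt ℝ ρ s)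
    (hd' : ∀ s ∈ Ioo 0 b, 0 < deriv ρ s) (h0 : Tendsto ρ (𝓝[>] 0) (𝓝 0)) :
    ∫⁻ s in Ioo 0 b, ENNReal.ofReal (deriv ρ s / ρ s) = ∞ := by
  by_contra hcon
  have hev : ∀ᶠ s in 𝓝[>] (0 : ℝ), s ∈ Ioo 0 b := Ioo_mem_nhdsGT hb
  have hder : ∀ s ∈ Ioo 0 b, HasDerivAt (fun s => Real.log (ρ s)) (deriv ρ s / ρ s) s :=
    fun s hs => (hd s hs).hasDerivAt.log (hpos s hs).ne'
  refine not_integrableOn_of_tendsto_norm_atTop_of_deriv_isBigO_filter (𝓝[>] (0 : ℝ))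
    (f := fun s => Real.log (ρ s)) (g := deriv fun s => Real.log (ρ s)) (k := Ioo 0 b)
    (Ioo_mem_nhdsGT hb) (hev.mono fun s hs => (hder s hs).differentiableAt) ?_
    (Asymptotics.isBigO_refl _ _) ⟨(measurable_deriv _).aestronglyMeasurable, ?_⟩
  · simp only [Real.norm_eq_abs]
    refine tendsto_abs_atBot_atTop.comp (Real.tendsto_log_nhdsNE_zero.comp ?_)
    exact tendsto_nhdsWithin_iff.2 ⟨h0, hev.mono fun s hs => (hpos s hs).ne'⟩
  · refine lt_of_le_of_lt (le_of_eq ?_) (lt_top_iff_ne_top.2 hcon)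
    refine setLIntegral_congr_fun measurableSet_Ioo fun s hs => ?_
    rw [(hder s hs).deriv, ← ofReal_norm, Real.norm_of_nonneg (div_pos (hd' s hs) (hpos s hs)).le]

/-- Under the integral condition, the direction normal to `ℝᵏ × 0` becomes tangent to `Y` when
the origin is approached. -/
theorem eventually_exists_tangent_near_normalPart {d : ℕ} {Y : Set (Eucl n)}
    (hYdef : IsDefinableSet L Y) (hY : IsCpSubmanifold 1 d Y) (hYK : ∀ y ∈ Y, y ∉ flat n k)
    {R : ℝ → ℝ≥0∞} (hR : ∀ y ∈ Y, gapDist (flat n k) (tangentSpaceOf Y y) ≤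
      R ‖(flat n k).starProjection y‖ * ENNReal.ofReal ‖normalPart n k y‖)
    {ε : ℝ} (hε : 0 < ε) (hint : ∫⁻ t in Icc 0 ε, R t < ∞) {η : ℝ} (hη : 0 < η) :
    ∀ᶠ y in 𝓝[Y] 0, ∃ v ∈ tangentSpaceOf Y y, ‖normalPart n k y - v‖ ≤ η * ‖normalPart n k y‖ := by
  wlog hη1 : η < 1 generalizing η
  · filter_upwards [this (η := 1 / 2) (by norm_num) (by norm_num)] with y ⟨v, hv, hv'⟩
    exact ⟨v, hv, hv'.trans (mul_le_mul_of_nonneg_right (by linarith) (norm_nonneg _))⟩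
  -- The cosine of the angle whose sine is `η`: secants at larger angles keep the normal direction
  -- at relative distance at least `η` from the tangent space.
  set c := √(1 - η ^ 2) with hc
  have hc2 : 1 - c ^ 2 = η ^ 2 := by rw [hc, Real.sq_sqrt (by nlinarith)]; ring
  by_contra hcon
  have hcl : (0 : Eucl n) ∈ closure (secantFarSet k Y c) := by
    rw [mem_closure_iff_nhdsWithin_neBot, ← frequently_true_iff_neBot]
    have hf : ∃ᶠ y in 𝓝[Y] 0, y ∈ secantFarSet k Y c := by
      refine (Filter.not_eventually.1 hcon).mp ?_
      filter_upwards [self_mem_nhdsWithin] with y hy hno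
      by_contra hmem
      obtain ⟨v, hv, hv'⟩ := exists_tangent_near_of_notMem_secantFarSet hY hy (Real.sqrt_nonneg _) hmem
      rw [hc2, ← mul_pow] at hv'
      exact hno ⟨v, hv, le_of_sq_le_sq hv' (by positivity)⟩
    rw [frequently_nhdsWithin_iff] at hf ⊢
    exact hf.mono fun y hy => ⟨trivial, hy.1⟩
  obtain ⟨γ, hγdef, hγ⟩ := exists_definable_curve (isDefinableSet_secantFarSet hYdef c) hcl
  have hpos : ∀ᶠ s in 𝓝[>] (0 : ℝ), 0 < s := self_mem_nhdsWithin
  have hγ0 : Tendsto γ (𝓝[>] 0) (𝓝 0) := by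
    rw [tendsto_zero_iff_norm_tendsto_zero]
    refine squeeze_zero' (.of_forall fun _ => norm_nonneg _) (hpos.mono fun s hs => (hγ s hs).2.le)
      (tendsto_nhdsWithin_of_tendsto_nhds tendsto_id)
  set h : ℝ → Eucl n := fun s => normalPart n k (γ s) with hh
  set x : ℝ → Eucl n := fun s => (flat n k).starProjection (γ s) with hx
  have hhdef : ∀ i, DefReal L fun s => h s i :=
    DefVec.normalPart (f := fun v : Fin 1 → ℝ => γ (v 0)) hγdef
  have hxdef : ∀ i, DefReal L fun s => x s i := by
    intro i
    have := (hγdef i).sub (hhdef i)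
    simpa [hh, hx, normalPart_apply] using this
  have hh0 : Tendsto h (𝓝[>] 0) (𝓝 0) := by
    simpa [Function.comp_def] using ((normalPart n k).continuous.tendsto 0).comp hγ0
  have hx0 : Tendsto x (𝓝[>] 0) (𝓝 0) := by
    simpa [Function.comp_def] using ((flat n k).starProjection.continuous.tendsto 0).comp hγ0
  have hhne : ∀ s > 0, h s ≠ 0 := fun s hs h0 =>
    hYK _ (hγ s hs).1.1 (normalPart_eq_zero_iff.1 h0)
  have hhne' : ∀ᶠ s in 𝓝[>] (0 : ℝ), h s ≠ 0 := hpos.mono hhne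
  set ρ : ℝ → ℝ := fun s => ‖h s‖ with hρ
  -- the velocity of the curve, compared with the tangent spaces
  have hmain : ∀ᶠ s in 𝓝[>] (0 : ℝ), DifferentiableAt ℝ γ s ∧ 0 < deriv ρ s ∧
      η / 2 * deriv ρ s ≤ ‖deriv x s - (tangentSpaceOf Y (γ s)).starProjection (deriv x s)‖ := by
    filter_upwards [hpos, DefReal.eventually_differentiableAt_eucl hγdef,
      eventually_deriv_norm_pos hhdef hh0 hhne',
      eventually_norm_deriv_sub_le hhdef hh0 hhne' (η := η / 2) (by positivity)] with s hs hd hp hle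
    refine ⟨hd, hp, ?_⟩
    set T := tangentSpaceOf Y (γ s)
    have hγT : deriv γ s ∈ T := by
      refine Submodule.subset_span ⟨fun t => γ (s + t), by simp, ?_, ?_⟩
      · have : ∀ᶠ t in 𝓝 (0 : ℝ), 0 < s + t :=
          ((continuous_const.add continuous_id).tendsto (0 : ℝ)).eventually
            (lt_mem_nhds (by simpa using hs))
        exact this.mono fun t ht => (hγ _ ht).1.1
      · have : HasDerivAt γ (deriv γ s) (s + 0) := by simpa using hd.hasDerivAt
        exact this.comp_const_add s 0
    have hdh : deriv h s = normalPart n k (deriv γ s) :=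
      ((normalPart n k).hasFDerivAt.comp_hasDerivAt s hd.hasDerivAt).deriv
    have hdx : deriv x s = (flat n k).starProjection (deriv γ s) :=
      ((flat n k).starProjection.hasFDerivAt.comp_hasDerivAt s hd.hasDerivAt).deriv
    have hsum : deriv x s + deriv h s = deriv γ s := by
      rw [hdh, hdx, starProjection_add_normalPart]
    have hbad : η * ρ s ≤ ‖h s - T.starProjection (h s)‖ := by
      have := mul_norm_le_norm_sub_of_inner_le (T := T) (h := h s) (c := c)
        fun v hv => inner_le_of_mem_secantFarSet hY (hγ s hs).1 hv
      rw [hc2, ← mul_pow] at this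
      exact le_of_sq_le_sq this (norm_nonneg _)
    have hρs : 0 < ρ s := norm_pos_iff.2 (hhne s hs)
    set a := deriv ρ s / ρ s with ha
    have haρ : a * ρ s = deriv ρ s := div_mul_cancel₀ _ hρs.ne'
    have hapos : 0 < a := div_pos hp hρs
    -- Projection to the orthogonal complement of `T`. It kills the velocity of the curve, so the
    -- horizontal and vertical velocities have opposite images; the vertical one is nearly `a • h
    -- s`, whose image has norm at least `η * deriv ρ s`.
    set Q : Eucl n →L[ℝ] Eucl n := ContinuousLinearMap.id ℝ _ - T.starProjection with hQ
    have hQle : ∀ w, ‖Q w‖ ≤ ‖w‖ := by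
      intro w
      have : Q w = Tᗮ.starProjection w := by
        simp [hQ, Submodule.starProjection_orthogonal_val]
      rw [this]
      exact Submodule.norm_starProjection_apply_le _ _
    have hQγ : Q (deriv γ s) = 0 := by
      simp [hQ, Submodule.starProjection_eq_self_iff.2 hγT]
    have hQx : Q (deriv x s) = - Q (deriv h s) := by
      rw [← hsum, map_add] at hQγ
      exact eq_neg_of_add_eq_zero_left hQγ
    have h1 : ‖Q (a • h s)‖ = a * ‖h s - T.starProjection (h s)‖ := by
      rw [map_smul, norm_smul, Real.norm_of_nonneg hapos.le]; rfl
    have h2 : ‖Q (deriv h s - a • h s)‖ ≤ η / 2 * deriv ρ s := (hQle _).trans hle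
    have h3 : ‖Q (a • h s)‖ ≤ ‖Q (deriv h s)‖ + ‖Q (deriv h s - a • h s)‖ := by
      have : Q (a • h s) = Q (deriv h s) - Q (deriv h s - a • h s) := by rw [← map_sub]; congr 1; abel
      rw [this]; exact norm_sub_le _ _
    have h4 : ‖Q (deriv x s)‖ = ‖Q (deriv h s)‖ := by rw [hQx, norm_neg]
    change _ ≤ ‖Q (deriv x s)‖
    have h5 : a * (η * ρ s) ≤ a * ‖h s - T.starProjection (h s)‖ :=
      mul_le_mul_of_nonneg_left hbad hapos.le
    have h6 : a * (η * ρ s) = η * deriv ρ s := by rw [← haρ]; ring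
    linarith
  set τ : ℝ → ℝ := fun s => ‖x s‖ with hτ
  have hτdef : DefReal L τ := DefReal.norm hxdef
  rcases eventually_nhdsGT_or_not (P := fun s => τ s = 0) (.eq hτdef (.const 0)) 0 with hz | hz
  · -- the curve lies over the origin
    obtain ⟨b, hb, hb'⟩ := mem_nhdsGT_iff_exists_Ioo_subset.1 (hmain.and hz)
    obtain ⟨s, hs⟩ := exists_between (show (0 : ℝ) < b from hb)
    have hdx : deriv x s = 0 := by
      have : x =ᶠ[𝓝 s] fun _ => 0 := by
        filter_upwards [Ioo_mem_nhds hs.1 hs.2] with t ht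
        exact norm_eq_zero.1 (hb' ht).2
      rw [this.deriv_eq, deriv_const]
    obtain ⟨-, h1, h2⟩ := (hb' hs).1
    rw [hdx] at h2
    simp at h2
    nlinarith
  · have hxne : ∀ᶠ s in 𝓝[>] (0 : ℝ), x s ≠ 0 := hz.mono fun s hs h0 => hs (by simp [hτ, h0])
    have hτ0 : Tendsto τ (𝓝[>] 0) (𝓝 0) := by simpa using hx0.norm
    obtain ⟨b, hb, hb'⟩ := mem_nhdsGT_iff_exists_Ioo_subset.1 ((((hmain.and
      (eventually_deriv_norm_pos hxdef hx0 hxne)).and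
      (eventually_norm_deriv_sub_le hxdef hx0 hxne one_pos)).and
      ((hτdef.eventually_differentiableAt 0).and
        ((DefReal.norm hhdef).eventually_differentiableAt 0))).and
      (hτ0.eventually (gt_mem_nhds hε)))
    have hb : 0 < b := hb
    have htop := lintegral_ofReal_logDeriv_eq_top (ρ := ρ) hb
      (fun s hs => norm_pos_iff.2 (hhne s hs.1)) (fun s hs => (hb' hs).1.2.2)
      (fun s hs => (hb' hs).1.1.1.1.2.1) (by simpa using hh0.norm)
    have hmono : StrictMonoOn τ (Ioo 0 b) := by
      refine strictMonoOn_of_deriv_pos (convex_Ioo 0 b)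
        (fun s hs => (hb' hs).1.2.1.continuousAt.continuousWithinAt) fun s hs => ?_
      exact (hb' (interior_subset hs)).1.1.1.2
    -- Substitution t = τ(s) by injectivity of τ alone; this formula requires no measurability of
    -- `R`.
    have hchange := lintegral_image_eq_lintegral_abs_deriv_mul measurableSet_Ioo
      (fun s (hs : s ∈ Ioo 0 b) => (hb' hs).1.2.1.hasDerivAt.hasDerivWithinAt) hmono.injOn R
    have hsub : τ '' Ioo 0 b ⊆ Icc 0 ε := by
      rintro _ ⟨s, hs, rfl⟩
      exact ⟨norm_nonneg _, (hb' hs).2.le⟩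
    -- Pointwise, (η/2)ρ' ≤ 2τ'R(τ)ρ. The factor 2 bounds |x'| by 2τ', because x' is within τ' of
    -- its radial model.
    have hle : ∫⁻ s in Ioo 0 b, ENNReal.ofReal (deriv ρ s / ρ s) ≤
        ∫⁻ s in Ioo 0 b, ENNReal.ofReal (4 / η) * (ENNReal.ofReal |deriv τ s| * R (τ s)) := by
      refine setLIntegral_mono' measurableSet_Ioo fun s hs => ?_
      obtain ⟨⟨⟨⟨⟨-, hp, hmn⟩, hτp⟩, hxd⟩, -⟩, -⟩ := hb' hs
      have hτp : 0 < deriv τ s := hτp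
      have hρs : 0 < ρ s := norm_pos_iff.2 (hhne s hs.1)
      have hdxK : deriv x s ∈ flat n k := by
        by_cases hd : DifferentiableAt ℝ γ s
        · have : deriv x s = (flat n k).starProjection (deriv γ s) :=
            ((flat n k).starProjection.hasFDerivAt.comp_hasDerivAt s hd.hasDerivAt).deriv
          rw [this]; exact Submodule.starProjection_apply_mem _ _
        · exact absurd (hb' hs).1.1.1.1.1 hd
      have hxle : ‖deriv x s‖ ≤ 2 * deriv τ s := by
        have h1 : ‖(deriv τ s / ‖x s‖) • x s‖ ≤ deriv τ s := by
          rw [norm_smul, norm_div, norm_norm, Real.norm_of_nonneg hτp.le]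
          rw [div_mul_eq_mul_div]
          exact div_le_of_le_mul₀ (norm_nonneg _) hτp.le le_rfl
        have h2 : ‖deriv x s‖ ≤ ‖deriv x s - (deriv τ s / ‖x s‖) • x s‖ +
            ‖(deriv τ s / ‖x s‖) • x s‖ := by
          simpa using norm_add_le (deriv x s - (deriv τ s / ‖x s‖) • x s)
            ((deriv τ s / ‖x s‖) • x s)
        linarith
      have h1 : ENNReal.ofReal (η / 2 * deriv ρ s) ≤
          ENNReal.ofReal (2 * deriv τ s) * (R (τ s) * ENNReal.ofReal (ρ s)) :=
        calc _ ≤ _ := ENNReal.ofReal_le_ofReal hmn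
          _ ≤ _ := ofReal_norm_sub_starProjection_le hdxK
          _ ≤ _ := mul_le_mul' (ENNReal.ofReal_le_ofReal hxle) (hR _ (hγ s hs.1).1.1)
      have h2 : deriv ρ s / ρ s = (2 / (η * ρ s)) * (η / 2 * deriv ρ s) := by field_simp
      rw [h2, ENNReal.ofReal_mul (by positivity)]
      calc _ ≤ ENNReal.ofReal (2 / (η * ρ s)) *
            (ENNReal.ofReal (2 * deriv τ s) * (R (τ s) * ENNReal.ofReal (ρ s))) := by gcongr
        _ = (ENNReal.ofReal (2 / (η * ρ s)) * ENNReal.ofReal (2 * deriv τ s) *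
            ENNReal.ofReal (ρ s)) * R (τ s) := by ring
        _ = _ := by
          rw [← mul_assoc, ← ENNReal.ofReal_mul (by positivity), ← ENNReal.ofReal_mul (by positivity),
            ← ENNReal.ofReal_mul (by positivity), abs_of_pos hτp]
          congr 2
          field_simp
          norm_num
    rw [lintegral_const_mul' _ _ ENNReal.ofReal_ne_top, ← hchange, htop, top_le_iff] at hle
    exact (ENNReal.mul_lt_top ENNReal.ofReal_lt_top
      ((lintegral_mono_set hsub).trans_lt hint)).ne hle

end RadialTangent

/-! ### Proper local homeomorphisms onto simply connected spaces -/

section Covering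

variable {V W : Type*} [TopologicalSpace V] [T2Space V] [TopologicalSpace W]

/-- The fibres are compact and discrete, hence finite, and properness makes the map closed. -/
theorem IsLocalHomeomorph.isCoveringMap_of_isProperMap [T1Space W] {q : V → W}
    (hq : IsLocalHomeomorph q) (hp : IsProperMap q) : IsCoveringMap q := by
  rw [isCoveringMap_iff_isCoveringMapOn_univ]
  have hdisc : ∀ w, IsDiscrete (q ⁻¹' {w}) := fun w =>
    IsDiscrete.of_openPartialHomeomorph q subset_rfl fun e _ => by
      obtain ⟨φ, h1, h2⟩ := hq e
      exact ⟨φ, h1, h2.symm⟩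
  exact hp.isClosedMap.isCoveringMapOn_of_isLocalHomeomorphOn
    (fun w _ => (hp.isCompact_preimage isCompact_singleton).finite (hdisc w))
    (fun x _ => hq x)

/-- A proper local homeomorphism onto a simply connected space is a homeomorphism as soon as some
fibre is contained in a connected set. -/
theorem IsLocalHomeomorph.exists_continuous_inverse [T1Space W] [SimplyConnectedSpace W]
    [LocallyPathConnectedSpace W] [Nonempty V] {q : V → W} (hq : IsLocalHomeomorph q)
    (hp : IsProperMap q) {C : Set V} (hC : IsPreconnected C) {w₀ : W}
    (hw₀ : ∀ v, q v = w₀ → v ∈ C) :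
    ∃ F : C(W, V), (∀ w, q (F w) = w) ∧ ∀ v, F (q v) = v := by
  have cov := hq.isCoveringMap_of_isProperMap hp
  have lift : ∀ v, ∃ F : C(W, V), F (q v) = v ∧ ∀ w, q (F w) = w := fun v => by
    obtain ⟨F, ⟨h1, h2⟩, -⟩ := cov.existsUnique_continuousMap_lifts (.id W) (q v) v rfl
    exact ⟨F, h1, fun w => congrFun h2 w⟩
  obtain ⟨F, -, hF⟩ := lift (Classical.arbitrary V)
  refine ⟨F, hF, fun v => ?_⟩
  -- The sheet swept out by the section `F`; it is clopen and meets `C`, so it contains `C`. A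
  -- section through any other point also hits `C` over `w₀`, where it agrees with `F`, and
  -- uniqueness of lifts makes the two equal.
  set Z := {z | F (q z) = z} with hZ
  have hcont : Continuous fun z => F (q z) := F.continuous.comp hq.continuous
  have hZc : IsClosed Z := isClosed_eq hcont continuous_id
  have hZo : IsOpen Z := by
    rw [isOpen_iff_mem_nhds]
    intro z hz
    obtain ⟨φ, h1, h2⟩ := hq z
    have hz' : F (q z) ∈ φ.source := by rw [show F (q z) = z from hz]; exact h1
    filter_upwards [φ.open_source.mem_nhds h1,
      hcont.continuousAt.eventually_mem (φ.open_source.mem_nhds hz')] with y hy hy'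
    refine φ.injOn hy' hy ?_
    rw [← h2]
    exact hF _
  have hCZ : C ⊆ Z := by
    refine hC.subset_isClopen ⟨hZc, hZo⟩ ⟨F w₀, hw₀ _ (hF _), ?_⟩
    change F (q (F w₀)) = F w₀
    rw [hF]
  obtain ⟨G, hG, hG'⟩ := lift v
  have hw : F w₀ = G w₀ := by
    have : F (q (G w₀)) = G w₀ := hCZ (hw₀ _ (hG' _))
    rwa [hG'] at this
  have := cov.eq_of_comp_eq F.continuous G.continuous
    (funext fun w => (hF w).trans (hG' w).symm) w₀ hw
  rw [this, hG]

end Covering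

/-! ### Cylindrical coordinates along `ℝᵏ × 0` -/

section Cylindrical

variable {n k : ℕ}

/-- The projection to `ℝᵏ × 0` and the distance to it. -/
noncomputable def cylCoord (n k : ℕ) (y : Eucl n) : flat n k × ℝ :=
  ((flat n k).orthogonalProjectionOnto y, ‖normalPart n k y‖)

theorem continuous_cylCoord : Continuous (cylCoord n k) :=
  ((flat n k).orthogonalProjectionOnto.continuous).prodMk (normalPart n k).continuous.norm

theorem cylCoord_fst_coe (y : Eucl n) : ((cylCoord n k y).1 : Eucl n) = (flat n k).starProjection y :=
  rfl

theorem norm_le_cylCoord (y : Eucl n) : ‖y‖ ≤ ‖(cylCoord n k y).1‖ + (cylCoord n k y).2 := by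
  conv_lhs => rw [← starProjection_add_normalPart (d := k) y]
  exact norm_add_le _ _

theorem hasFDerivAt_cylCoord {y : Eucl n} (hy : normalPart n k y ≠ 0) :
    ∃ A : Eucl n →L[ℝ] flat n k × ℝ, HasFDerivAt (cylCoord n k) A y ∧ ∀ v, A v =
      ((flat n k).orthogonalProjectionOnto v, inner ℝ (‖normalPart n k y‖⁻¹ • normalPart n k y) v) := by
  have hpos : 0 < ‖normalPart n k y‖ := norm_pos_iff.2 hy
  have h1 : HasFDerivAt (fun z => ‖normalPart n k z‖ ^ 2) _ y :=
    ((normalPart n k).hasFDerivAt (x := y)).norm_sq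
  have h2 := h1.sqrt (by positivity)
  have h3 : (fun z : Eucl n => √(‖normalPart n k z‖ ^ 2)) = fun z => ‖normalPart n k z‖ := by
    ext z; rw [Real.sqrt_sq (norm_nonneg _)]
  rw [h3] at h2
  refine ⟨_, ((flat n k).orthogonalProjectionOnto.hasFDerivAt).prodMk h2, fun v => ?_⟩
  refine Prod.ext rfl ?_
  simp only [ContinuousLinearMap.prod_apply, _root_.smul_apply, smul_eq_mul,
    ContinuousLinearMap.comp_apply, innerSL_apply_apply, real_inner_smul_left,
    inner_normalPart_left, Real.sqrt_sq (norm_nonneg (normalPart n k y))]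
  field_simp
  ring

theorem contDiffAt_cylCoord {y : Eucl n} (hy : normalPart n k y ≠ 0) :
    ContDiffAt ℝ 1 (cylCoord n k) y :=
  ((flat n k).orthogonalProjectionOnto.contDiff.contDiffAt).prodMk
    ((normalPart n k).contDiff.contDiffAt.norm ℝ hy)

/-- `T` is close to the span of `ℝᵏ × 0` and the normal part of `y`. -/
def CloseTangent (k : ℕ) (T : Submodule ℝ (Eucl n)) (y : Eucl n) : Prop :=
  (∀ e ∈ flat n k, ∃ v ∈ T, ‖v - e‖ ≤ 1 / 8 * ‖e‖) ∧
    ∃ v ∈ T, ‖normalPart n k y - v‖ ≤ 1 / 8 * ‖normalPart n k y‖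

theorem CloseTangent.norm_le {T : Submodule ℝ (Eucl n)} {y : Eucl n} (h : CloseTangent k T y)
    (hy : normalPart n k y ≠ 0) (hk : k ≤ n) (hdim : Module.finrank ℝ T = k + 1) {v : Eucl n}
    (hv : v ∈ T) {m : ℝ} (h1 : ‖(flat n k).starProjection v‖ ≤ m)
    (h2 : |inner ℝ (‖normalPart n k y‖⁻¹ • normalPart n k y) v| ≤ m) : ‖v‖ ≤ 4 * m := by
  have hpos : 0 < ‖normalPart n k y‖ := norm_pos_iff.2 hy
  refine norm_le_of_close (K := flat n k) ?_ (Submodule.smul_mem _ _ (normalPart_mem_orthogonal y))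
    (by rw [hdim, finrank_flat hk]) h.1 ?_ hv h1 h2
  · rw [norm_smul, norm_inv, norm_norm, inv_mul_cancel₀ hpos.ne']
  · obtain ⟨w, hw, hw'⟩ := h.2
    refine ⟨‖normalPart n k y‖⁻¹ • w, T.smul_mem _ hw, ?_⟩
    rw [← smul_sub, norm_smul, norm_inv, norm_norm, inv_mul_le_iff₀ hpos, norm_sub_rev]
    linarith

/-- Cylindrical coordinates are local coordinates of `Y` where its tangent spaces are close to the
span of `ℝᵏ × 0` and the normal direction. -/
theorem exists_local_section {Y : Set (Eucl n)} (hY : IsCpSubmanifold 1 (k + 1) Y) {y : Eucl n}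
    (hy : y ∈ Y) (hy0 : normalPart n k y ≠ 0) (hclose : CloseTangent k (tangentSpaceOf Y y) y) :
    ∃ σ : flat n k × ℝ → Eucl n, ContDiffAt ℝ 1 σ (cylCoord n k y) ∧ σ (cylCoord n k y) = y ∧
      (∀ᶠ p in 𝓝 (cylCoord n k y), σ p ∈ Y ∧ cylCoord n k (σ p) = p) ∧
      ∀ᶠ z in 𝓝[Y] y, σ (cylCoord n k z) = z := by
  have hdim := finrank_tangentSpaceOf hY hy
  obtain ⟨hk, hch⟩ := hY
  obtain ⟨ψ, hyψ, hψ, hYψ⟩ := hch y hy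
  obtain ⟨A, hA, hA'⟩ := hψ.exists_equiv hyψ
  obtain ⟨B, hB, hB'⟩ := hasFDerivAt_cylCoord hy0
  set a : flat n (k + 1) := ⟨ψ y, (hYψ hyψ).2 hy⟩ with ha
  have hay : ψ.symm a = y := ψ.left_inv hyψ
  have hatar : (a : Eucl n) ∈ ψ.target := ψ.map_source hyψ
  set f : flat n (k + 1) → flat n k × ℝ := fun z => cylCoord n k (ψ.symm z) with hf
  have hfa : f a = cylCoord n k y := by rw [hf]; simp only [hay]
  have hsymm : ContDiffAt ℝ 1 ψ.symm (a : Eucl n) := hψ.symm.contDiffAt hatar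
  have hfc : ContDiffAt ℝ 1 f a := by
    have h1 : ContDiffAt ℝ 1 (fun z : flat n (k + 1) => ψ.symm (z : Eucl n)) a :=
      hsymm.comp a (flat n (k + 1)).subtypeL.contDiff.contDiffAt
    exact ContDiffAt.comp a (by rw [hay]; exact contDiffAt_cylCoord hy0) h1
  set f' : flat n (k + 1) →L[ℝ] flat n k × ℝ :=
    B.comp ((A.symm : Eucl n →L[ℝ] Eucl n).comp (flat n (k + 1)).subtypeL) with hf'
  have hfd : HasFDerivAt f f' a := by
    have h1 : HasFDerivAt (fun z : flat n (k + 1) => ψ.symm (z : Eucl n)) _ a :=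
      HasFDerivAt.comp a (g := ψ.symm) hA'.hasFDerivAt (flat n (k + 1)).subtypeL.hasFDerivAt
    exact HasFDerivAt.comp a (by rw [hay]; exact hB) h1
  -- A kernel element gives a tangent vector of `Y` with zero horizontal and zero radial component,
  -- which closeness of the tangent space excludes (the bound with `m = 0`).
  have hinj : Function.Injective f' := by
    rw [← ContinuousLinearMap.coe_coe, ← LinearMap.ker_eq_bot, LinearMap.ker_eq_bot']
    intro z hz
    have hv : A.symm (z : Eucl n) ∈ tangentSpaceOf Y y := by
      rw [tangentSpaceOf_isImage hYψ hyψ hA.hasFDerivAt hA'.hasFDerivAt,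
        Submodule.tangentSpaceOf_eq _ ((hYψ hyψ).2 hy)]
      simp
    have hz' : B (A.symm (z : Eucl n)) = 0 := hz
    rw [hB', Prod.mk_eq_zero] at hz'
    have h1 : (flat n k).starProjection (A.symm (z : Eucl n)) = 0 := by
      rw [Submodule.starProjection_apply, hz'.1]; rfl
    have := hclose.norm_le hy0 (by omega) hdim hv (m := 0) (by rw [h1, norm_zero])
      (by rw [hz'.2, abs_zero])
    rw [mul_zero, norm_le_zero_iff] at this
    simpa using this
  have hrank : Module.finrank ℝ (flat n (k + 1)) = Module.finrank ℝ (flat n k × ℝ) := by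
    rw [finrank_flat hk, Module.finrank_prod, finrank_flat (by omega), Module.finrank_self]
  let E : flat n (k + 1) ≃L[ℝ] flat n k × ℝ :=
    (LinearEquiv.ofInjectiveOfFinrankEq (f' : flat n (k + 1) →ₗ[ℝ] flat n k × ℝ) hinj hrank).toContinuousLinearEquiv
  have hE : (E : flat n (k + 1) →L[ℝ] flat n k × ℝ) = f' := by
    ext v <;> rfl
  rw [← hE] at hfd
  set e := hfc.toOpenPartialHomeomorph f hfd (by simp) with he
  have hea : a ∈ e.source := hfc.mem_toOpenPartialHomeomorph_source hfd (by simp)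
  have hecoe : ∀ z, e z = f z := fun z => rfl
  have hsec : ContDiffAt ℝ 1 e.symm (f a) := hfc.to_localInverse hfd (by simp)
  have hsa : e.symm (f a) = a := e.left_inv hea
  have hmt : f a ∈ e.target := e.map_source hea
  refine ⟨fun p => ψ.symm (e.symm p), ?_, ?_, ?_, ?_⟩
  · rw [← hfa]
    have h1 : ContDiffAt ℝ 1 (fun p => ((e.symm p : flat n (k + 1)) : Eucl n)) (f a) :=
      (flat n (k + 1)).subtypeL.contDiff.contDiffAt.comp (f a) hsec
    exact ContDiffAt.comp (f a) (by rw [hsa]; exact hsymm) h1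
  · simp only [← hfa, hsa, hay]
  · rw [← hfa]
    have hct : ContinuousAt (fun p => ((e.symm p : flat n (k + 1)) : Eucl n)) (f a) :=
      continuous_subtype_val.continuousAt.comp (e.continuousAt_symm hmt)
    filter_upwards [e.open_target.mem_nhds hmt,
      hct.eventually_mem (ψ.open_target.mem_nhds (by rw [hsa]; exact hatar))] with p hp hp'
    refine ⟨(hYψ.symm hp').2 (e.symm p).2, ?_⟩
    exact e.right_inv hp
  · obtain ⟨O, hO, hOe⟩ := isOpen_induced_iff.1 e.open_source
    have hyO : ψ y ∈ O := by
      have : a ∈ (Subtype.val ⁻¹' O : Set (flat n (k + 1))) := hOe ▸ hea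
      exact this
    filter_upwards [self_mem_nhdsWithin, nhdsWithin_le_nhds (ψ.open_source.mem_nhds hyψ),
      nhdsWithin_le_nhds ((ψ.continuousAt hyψ).eventually_mem (hO.mem_nhds hyO))] with z hz hzs hzO
    set w : flat n (k + 1) := ⟨ψ z, (hYψ hzs).2 hz⟩
    have hw : w ∈ e.source := by rw [← hOe]; exact hzO
    have hew : e w = cylCoord n k z := by
      rw [hecoe, hf]; simp only [w, ψ.left_inv hzs]
    rw [← hew, e.left_inv hw]
    exact ψ.left_inv hzs

end Cylindrical

/-! ### The cylindrical parametrization as a one-sheeted covering -/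

section Cylindrical

variable {n k : ℕ}

/-- The image in cylindrical coordinates of a punctured tubular neighbourhood of the origin. -/
def cylBox (n k : ℕ) (a b : ℝ) : Set (flat n k × ℝ) := {p | ‖p.1‖ < a ∧ 0 < p.2 ∧ p.2 < b}

theorem cylBox_eq (a b : ℝ) : cylBox n k a b = Metric.ball 0 a ×ˢ Ioo 0 b := by
  ext p; simp [cylBox]

theorem isOpen_cylBox (a b : ℝ) : IsOpen (cylBox n k a b) := by
  rw [cylBox_eq]; exact Metric.isOpen_ball.prod isOpen_Ioo

theorem convex_cylBox (a b : ℝ) : Convex ℝ (cylBox n k a b) := by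
  rw [cylBox_eq]; exact (convex_ball 0 a).prod (convex_Ioo 0 b)

/-- `Ψ` parametrizes `Y` near the origin by cylindrical coordinates. -/
structure IsCylParam (k : ℕ) (Y : Set (Eucl n)) (a b : ℝ) (Ψ : flat n k × ℝ → Eucl n) : Prop where
  pos_left : 0 < a
  pos_right : 0 < b
  contDiffAt : ∀ p ∈ cylBox n k a b, ContDiffAt ℝ 1 Ψ p
  mem : ∀ p ∈ cylBox n k a b, Ψ p ∈ Y
  coord : ∀ p ∈ cylBox n k a b, cylCoord n k (Ψ p) = p
  close : ∀ p ∈ cylBox n k a b, CloseTangent k (tangentSpaceOf Y (Ψ p)) (Ψ p)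
  eq_of_mem : ∀ y ∈ Y, cylCoord n k y ∈ cylBox n k a b → Ψ (cylCoord n k y) = y

/-- If `Y` is connected near the origin and its tangent spaces approach the span of `ℝᵏ × 0` and the
normal direction, then `Y` is parametrized near the origin by cylindrical coordinates. -/
theorem exists_isCylParam {Y : Set (Eucl n)} (hY : IsCpSubmanifold 1 (k + 1) Y)
    (hYK : ∀ y ∈ Y, y ∉ flat n k) {R : ℝ} (hR : 0 < R)
    (hcl : IsClosed ((Y ∪ flat n k) ∩ Metric.closedBall 0 R))
    (hclose : ∀ᶠ y in 𝓝[Y] 0, CloseTangent k (tangentSpaceOf Y y) y)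
    (hconn : ∀ U ∈ 𝓝 (0 : Eucl n), ∃ C ⊆ Y ∩ U, IsPreconnected C ∧ ∃ U' ∈ 𝓝 (0 : Eucl n), Y ∩ U' ⊆ C)
    (h0 : (0 : Eucl n) ∈ closure Y) :
    ∃ a b Ψ, IsCylParam k Y a b Ψ := by
  obtain ⟨R₁, hR₁, hR₁'⟩ : ∃ R₁ > 0, ∀ y ∈ Y, ‖y‖ < R₁ → CloseTangent k (tangentSpaceOf Y y) y := by
    obtain ⟨ε, hε, h⟩ := Metric.eventually_nhds_iff.1 (eventually_nhdsWithin_iff.1 hclose)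
    exact ⟨ε, hε, fun y hy hyε => h (by simpa using hyε) hy⟩
  -- Points over the box have norm below `a + a`, which must not exceed either radius.
  set a := min R R₁ / 2 with ha_def
  have ha : 0 < a := by have := lt_min hR hR₁; positivity
  have haR : a + a ≤ R := by rw [ha_def]; linarith [min_le_left R R₁]
  have haR₁ : a + a ≤ R₁ := by rw [ha_def]; linarith [min_le_right R R₁]
  set W := cylBox n k a a with hW
  set V : Set (Eucl n) := Y ∩ cylCoord n k ⁻¹' W with hV
  have hVlt : ∀ y, cylCoord n k y ∈ W → ‖y‖ < a + a := fun y hy =>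
    (norm_le_cylCoord y).trans_lt (add_lt_add hy.1 hy.2.2)
  have hVclose : ∀ y ∈ V, CloseTangent k (tangentSpaceOf Y y) y := fun y hy =>
    hR₁' y hy.1 ((hVlt y hy.2).trans_le haR₁)
  have hVne : ∀ y ∈ V, normalPart n k y ≠ 0 := fun y hy h =>
    hYK y hy.1 (normalPart_eq_zero_iff.1 h)
  let q : V → W := fun v => ⟨cylCoord n k v, v.2.2⟩
  have hqc : Continuous q :=
    (continuous_cylCoord.comp continuous_subtype_val).subtype_mk _
  -- local sections
  have hloc : ∀ v : V, ∃ σ : flat n k × ℝ → Eucl n, ContDiffAt ℝ 1 σ (cylCoord n k v) ∧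
      σ (cylCoord n k v) = v ∧ (∀ᶠ p in 𝓝 (cylCoord n k v), σ p ∈ Y ∧ cylCoord n k (σ p) = p) ∧
      ∀ᶠ z in 𝓝[Y] (v : Eucl n), σ (cylCoord n k z) = z := fun v =>
    exists_local_section hY v.2.1 (hVne v v.2) (hVclose v v.2)
  have hopen : IsOpenMap q := by
    rw [isOpenMap_iff_nhds_le]
    intro v N hN
    obtain ⟨σ, hσc, hσv, hσ, -⟩ := hloc v
    rw [mem_map] at hN
    obtain ⟨O, hO, hON⟩ := mem_nhds_subtype _ _ _ |>.1 hN
    have h1 : ∀ᶠ p in 𝓝 (cylCoord n k (v : Eucl n)), σ p ∈ O :=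
      hσc.continuousAt.eventually_mem (by rw [hσv]; exact hO)
    have h2 : ∀ᶠ w : W in 𝓝 (q v), σ w ∈ O ∧ σ w ∈ Y ∧ cylCoord n k (σ w) = w :=
      (continuous_subtype_val.tendsto (q v)).eventually (h1.and hσ)
    filter_upwards [h2] with w hw
    have hwV : σ w ∈ V := ⟨hw.2.1, by rw [mem_preimage, hw.2.2]; exact w.2⟩
    have : (⟨σ w, hwV⟩ : V) ∈ q ⁻¹' N := hON hw.1
    have hqw : q ⟨σ w, hwV⟩ = w := Subtype.ext hw.2.2
    rwa [mem_preimage, hqw] at this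
  have hqloc : IsLocalHomeomorph q := by
    rw [isLocalHomeomorph_iff_isOpenEmbedding_restrict]
    intro v
    obtain ⟨σ, -, -, -, hσ⟩ := hloc v
    have hσ' : ∀ᶠ z : V in 𝓝 v, σ (cylCoord n k z) = z := by
      have : Tendsto (Subtype.val : V → Eucl n) (𝓝 v) (𝓝[Y] (v : Eucl n)) :=
        tendsto_nhdsWithin_iff.2 ⟨continuous_subtype_val.tendsto v, .of_forall fun z => z.2.1⟩
      exact this.eventually hσ
    obtain ⟨U, hU, hUo, hvU⟩ := eventually_nhds_iff.1 hσ'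
    refine ⟨U, hUo.mem_nhds hvU, .of_continuous_injective_isOpenMap
      (hqc.comp continuous_subtype_val) ?_ (hopen.domRestrict hUo)⟩
    intro z z' hzz
    have hzz' : cylCoord n k z.1 = cylCoord n k z'.1 := congrArg Subtype.val hzz
    have h1 := hU z.1 z.2
    rw [hzz', hU z'.1 z'.2] at h1
    exact Subtype.ext (Subtype.ext h1.symm)
  -- The preimage of a compact set is compact because it can be computed in the compact set `(Y ∪
  -- flat n k) ∩ closedBall 0 R`: points of `flat n k` have height `0` and never lie over the box.
  have hprop : IsProperMap q := by
    rw [isProperMap_iff_isCompact_preimage]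
    refine ⟨hqc, fun Q hQ => ?_⟩
    rw [Subtype.isCompact_iff]
    have hQ' : IsClosed (Subtype.val '' Q) := (hQ.image continuous_subtype_val).isClosed
    have : Subtype.val '' (q ⁻¹' Q) =
        ((Y ∪ flat n k) ∩ Metric.closedBall 0 R) ∩ cylCoord n k ⁻¹' (Subtype.val '' Q) := by
      ext y
      constructor
      · rintro ⟨v, hv, rfl⟩
        refine ⟨⟨Or.inl v.2.1, ?_⟩, ⟨q v, hv, rfl⟩⟩
        simpa using ((hVlt v v.2.2).trans_le haR).le
      · rintro ⟨⟨hy, -⟩, w, hw, hwy⟩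
        have hyW : cylCoord n k y ∈ W := hwy ▸ w.2
        have hyY : y ∈ Y := by
          refine hy.resolve_right fun hyK => ?_
          have : (cylCoord n k y).2 = 0 := by simp [cylCoord, normalPart_eq_zero_iff.2 hyK]
          exact absurd hyW.2.1 (by rw [this]; exact lt_irrefl _)
        refine ⟨⟨y, hyY, hyW⟩, ?_, rfl⟩
        have : q ⟨y, hyY, hyW⟩ = w := Subtype.ext hwy.symm
        rw [mem_preimage, this]; exact hw
    rw [this]
    refine IsCompact.inter_right ?_ (hQ'.preimage continuous_cylCoord)
    exact (isCompact_closedBall (0 : Eucl n) R).of_isClosed_subset hcl inter_subset_right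
  -- topology of the base
  have hWne : W.Nonempty := ⟨(0, a / 2), by simpa using ha, by simpa using ha, by simpa using ha⟩
  have : ContractibleSpace W := (convex_cylBox a a).contractibleSpace hWne
  have : LocallyPathConnectedSpace W := (isOpen_cylBox a a).locallyPathConnectedSpace
  -- the points of `Y` close to the origin
  have hnear : ∀ᶠ y in 𝓝 (0 : Eucl n), y ∈ Y → y ∈ V := by
    filter_upwards [Metric.ball_mem_nhds (0 : Eucl n) ha] with y hy hyY
    have hy : ‖y‖ < a := by simpa using hy
    exact ⟨hyY, (norm_starProjection_flat_le y).trans_lt hy,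
      norm_pos_iff.2 fun h => hYK y hyY (normalPart_eq_zero_iff.1 h), (norm_normalPart_le y).trans_lt hy⟩
  obtain ⟨C, hCU, hC, U', hU', hUC⟩ := hconn _ hnear
  have hCV : C ⊆ V := fun y hy => (hCU hy).2 (hCU hy).1
  have : Nonempty V := by
    rw [mem_closure_iff_nhds] at h0
    obtain ⟨y, hy, hyY⟩ := h0 _ hnear
    exact ⟨⟨y, hy hyY⟩⟩
  obtain ⟨ε, hε, hεU⟩ := Metric.mem_nhds_iff.1 hU'
  have hmin : 0 < min a ε / 2 := by have := lt_min ha hε; positivity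
  -- The base point lies over the origin at a height below `ε`, so its whole fibre lies in the
  -- `ε`-ball and hence in the connected set `C`.
  obtain ⟨F, hF, hF'⟩ := hqloc.exists_continuous_inverse hprop (C := Subtype.val ⁻¹' C)
    (w₀ := ⟨(0, min a ε / 2), by simpa using ha, hmin, by
      change min a ε / 2 < a
      linarith [min_le_left a ε]⟩)
    (by
      rw [Topology.IsInducing.subtypeVal.isPreconnected_image.symm, Subtype.image_preimage_coe,
        inter_eq_right.2 hCV]
      exact hC) (by
      intro v hv
      have hv' : cylCoord n k (v : Eucl n) = (0, min a ε / 2) := congrArg Subtype.val hv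
      refine hUC ⟨v.2.1, hεU ?_⟩
      rw [mem_ball_zero_iff]
      refine (norm_le_cylCoord (k := k) (v : Eucl n)).trans_lt ?_
      rw [hv', norm_zero, zero_add]
      change min a ε / 2 < ε
      linarith [min_le_right a ε])
  classical
  set Ψ : flat n k × ℝ → Eucl n := fun p => if hp : p ∈ W then (F ⟨p, hp⟩ : Eucl n) else 0 with hΨ
  have hΨF : ∀ p (hp : p ∈ W), Ψ p = F ⟨p, hp⟩ := fun p hp => by simp [hΨ, hp]
  have hΨV : ∀ p ∈ W, Ψ p ∈ V := fun p hp => by rw [hΨF p hp]; exact (F _).2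
  have hΨq : ∀ p ∈ W, cylCoord n k (Ψ p) = p := fun p hp => by
    rw [hΨF p hp]; exact congrArg Subtype.val (hF ⟨p, hp⟩)
  refine ⟨a, a, Ψ, ha, ha, fun p hp => ?_, fun p hp => (hΨV p hp).1, hΨq,
    fun p hp => hVclose _ (hΨV p hp), fun y hy hyW => ?_⟩
  -- The continuous inverse agrees near `p` with a local section of class C¹, which gives its
  -- smoothness.
  · obtain ⟨σ, hσc, -, -, hσ⟩ := hloc ⟨Ψ p, hΨV p hp⟩
    simp only [hΨq p hp] at hσc
    refine hσc.congr_of_eventuallyEq ?_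
    have hcont : ContinuousAt Ψ p := by
      have h1 : ContinuousOn Ψ W := by
        rw [continuousOn_iff_continuous_domRestrict]
        have : W.domRestrict Ψ = fun w => (F w : Eucl n) := by
          ext1 w; exact hΨF w w.2
        rw [this]
        exact continuous_subtype_val.comp F.continuous
      exact h1.continuousAt ((isOpen_cylBox a a).mem_nhds hp)
    have hW' : ∀ᶠ p' in 𝓝 p, p' ∈ W := (isOpen_cylBox a a).mem_nhds hp
    have ht : Tendsto Ψ (𝓝 p) (𝓝[Y] (Ψ p)) :=
      tendsto_nhdsWithin_iff.2 ⟨hcont, hW'.mono fun p' hp' => (hΨV p' hp').1⟩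
    filter_upwards [ht.eventually hσ, hW'] with p' h1 h2
    rw [← h1, hΨq p' h2]
  · have := congrArg Subtype.val (hF' ⟨y, hy, hyW⟩)
    rw [hΨF _ hyW]
    exact this

namespace IsCylParam

variable {Y : Set (Eucl n)} {a b : ℝ} {Ψ : flat n k × ℝ → Eucl n}

theorem snd_eq (h : IsCylParam k Y a b Ψ) {p : flat n k × ℝ} (hp : p ∈ cylBox n k a b) :
    ‖normalPart n k (Ψ p)‖ = p.2 := congrArg Prod.snd (h.coord p hp)

theorem fst_eq (h : IsCylParam k Y a b Ψ) {p : flat n k × ℝ} (hp : p ∈ cylBox n k a b) :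
    (flat n k).starProjection (Ψ p) = p.1 :=
  congrArg (fun q : flat n k × ℝ => (q.1 : Eucl n)) (h.coord p hp)

theorem normalPart_eq (h : IsCylParam k Y a b Ψ) {p : flat n k × ℝ} (hp : p ∈ cylBox n k a b) :
    normalPart n k (Ψ p) = Ψ p - p.1 := by rw [normalPart_apply, h.fst_eq hp]

theorem normalPart_ne_zero (h : IsCylParam k Y a b Ψ) {p : flat n k × ℝ}
    (hp : p ∈ cylBox n k a b) : normalPart n k (Ψ p) ≠ 0 := by
  rw [← norm_pos_iff, h.snd_eq hp]; exact hp.2.1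

/-- The derivative of the parametrization differs from the obvious guess at most by the distance
of the latter to the tangent space. -/
theorem norm_fderiv_sub_le (h : IsCylParam k Y a b Ψ) (hY : IsCpSubmanifold 1 (k + 1) Y)
    {p : flat n k × ℝ} (hp : p ∈ cylBox n k a b) (e : flat n k) (l : ℝ) {v : Eucl n}
    (hv : v ∈ tangentSpaceOf Y (Ψ p)) :
    ‖fderiv ℝ Ψ p (e, l) - (e + l • p.2⁻¹ • normalPart n k (Ψ p))‖ ≤
      5 * ‖(e + l • p.2⁻¹ • normalPart n k (Ψ p)) - v‖ := by
  set D := fderiv ℝ Ψ p with hD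
  have hDp : HasFDerivAt Ψ D p := ((h.contDiffAt p hp).differentiableAt (by simp)).hasFDerivAt
  have hW : ∀ᶠ p' in 𝓝 p, p' ∈ cylBox n k a b := (isOpen_cylBox a b).mem_nhds hp
  set θ := p.2⁻¹ • normalPart n k (Ψ p) with hθ
  set w : Eucl n := e + l • θ with hw
  have hline : HasDerivAt (fun t : ℝ => p + t • (e, l)) (e, l) 0 := by
    simpa using ((hasDerivAt_id (0 : ℝ)).smul_const (e, l)).const_add p
  have hDT : D (e, l) ∈ tangentSpaceOf Y (Ψ p) := by
    refine Submodule.subset_span ⟨fun t => Ψ (p + t • (e, l)), by simp, ?_, ?_⟩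
    · have : ∀ᶠ t : ℝ in 𝓝 0, p + t • (e, l) ∈ cylBox n k a b :=
        hline.continuousAt.eventually_mem (by simpa using hW)
      exact this.mono fun t ht => h.mem _ ht
    · exact HasFDerivAt.comp_hasDerivAt (0 : ℝ) (by simpa using hDp) hline
  obtain ⟨A, hA, hA'⟩ := hasFDerivAt_cylCoord (h.normalPart_ne_zero hp)
  rw [h.snd_eq hp, ← hθ] at hA'
  have hAD : A (D (e, l)) = (e, l) := by
    have h1 : HasFDerivAt (fun p' => cylCoord n k (Ψ p')) (A.comp D) p := hA.comp p hDp
    have h2 : HasFDerivAt (fun p' => cylCoord n k (Ψ p')) (ContinuousLinearMap.id ℝ _) p :=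
      (hasFDerivAt_id p).congr_of_eventuallyEq (hW.mono fun p' hp' => h.coord p' hp')
    exact DFunLike.congr_fun (h1.unique h2) (e, l)
  have hθn : ‖θ‖ = 1 := by
    rw [hθ, norm_smul, h.snd_eq hp, norm_inv, Real.norm_of_nonneg hp.2.1.le,
      inv_mul_cancel₀ hp.2.1.ne']
  have hθK : θ ∈ (flat n k)ᗮ := Submodule.smul_mem _ _ (normalPart_mem_orthogonal _)
  have hAw : A w = (e, l) := by
    rw [hA']
    refine Prod.ext ?_ ?_
    · rw [hw, map_add, map_smul, Submodule.orthogonalProjectionOnto_apply_of_mem_orthogonal hθK]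
      simp
    · change inner ℝ θ w = l
      rw [hw, inner_add_right, real_inner_smul_right, real_inner_self_eq_norm_sq, hθn,
        Submodule.inner_left_of_mem_orthogonal e.2 hθK]; simp
  have hdiff : A (D (e, l) - v) = A (w - v) := by rw [map_sub, map_sub, hAD, hAw]
  rw [hA', hA', Prod.mk.injEq] at hdiff
  -- The vector `D (e, l) - v` is tangent and has the same horizontal and radial components as `w -
  -- v`. The constant 5 is this 4 plus 1 from the triangle inequality.
  have h1 : ‖D (e, l) - v‖ ≤ 4 * ‖w - v‖ := by
    refine (h.close p hp).norm_le (h.normalPart_ne_zero hp) (by have := hY.1; omega)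
      (finrank_tangentSpaceOf hY (h.mem p hp)) (Submodule.sub_mem _ hDT hv) ?_ ?_
    · have : (flat n k).starProjection (D (e, l) - v) = (flat n k).starProjection (w - v) :=
        congrArg Subtype.val hdiff.1
      rw [this]; exact norm_starProjection_flat_le _
    · rw [h.snd_eq hp, ← hθ, hdiff.2]
      refine (abs_real_inner_le_norm _ _).trans ?_
      rw [hθn, one_mul]
  calc ‖D (e, l) - w‖ = ‖(D (e, l) - v) - (w - v)‖ := by congr 1; abel
    _ ≤ ‖D (e, l) - v‖ + ‖w - v‖ := norm_sub_le _ _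
    _ ≤ _ := by linarith

end IsCylParam

end Cylindrical

/-! ### Convergence of the normal direction -/

section Direction

variable {L : FirstOrder.Language} [L.Structure ℝ] [hL : Fact (IsOMinimal L)] {n k : ℕ}

/-- The unit vector pointing from `ℝᵏ × 0` to `y`. -/
noncomputable def normalDir (n k : ℕ) (y : Eucl n) : Eucl n := ‖normalPart n k y‖⁻¹ • normalPart n k y

theorem norm_normalDir {y : Eucl n} (hy : normalPart n k y ≠ 0) : ‖normalDir n k y‖ = 1 := by
  rw [normalDir, norm_smul, norm_inv, norm_norm, inv_mul_cancel₀ (norm_ne_zero_iff.2 hy)]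

theorem norm_normalDir_le (y : Eucl n) : ‖normalDir n k y‖ ≤ 1 := by
  rw [normalDir, norm_smul, norm_inv, norm_norm]
  exact inv_mul_le_one

variable {Y : Set (Eucl n)} {a b : ℝ} {Ψ : flat n k × ℝ → Eucl n}

theorem zero_mem_cylBox_iff {ρ : ℝ} (ha : 0 < a) :
    ((0, ρ) : flat n k × ℝ) ∈ cylBox n k a b ↔ 0 < ρ ∧ ρ < b := by
  simp [cylBox, ha]

/-- Along the fibre over the origin the normal direction converges. -/
theorem IsCylParam.exists_tendsto_fiber (h : IsCylParam k Y a b Ψ) (hYdef : IsDefinableSet L Y) :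
    ∃ θ : Eucl n, Tendsto (fun ρ : ℝ => normalDir n k (Ψ (0, ρ))) (𝓝[>] 0) (𝓝 θ) := by
  classical
  -- The value 0 outside `(0, b)` makes the function total. Its graph is described by the unique
  -- point of `Y` over the origin at height ρ, so that only definability of `Y` is needed, not of
  -- `Ψ`.
  set g : ℝ → Eucl n := fun ρ => if 0 < ρ ∧ ρ < b then normalDir n k (Ψ (0, ρ)) else 0 with hg
  have hgdef : ∀ i, DefReal L fun ρ => g ρ i := by
    intro i
    apply DefFn.of_graph
    have : DefPred L fun w : Fin 1 ⊕ Fin 1 → ℝ =>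
        (((0 < w (.inl 0) ∧ w (.inl 0) < b) ∧ ∃ y : Eucl n, y ∈ Y ∧
          ‖y - normalPart n k y‖ = 0 ∧ ‖normalPart n k y‖ = w (.inl 0) ∧
          (‖normalPart n k y‖)⁻¹ * normalPart n k y i = w (.inr 0)) ∨
        ¬ (0 < w (.inl 0) ∧ w (.inl 0) < b) ∧ w (.inr 0) = 0) := by
      refine .or (.and (.and (.lt (.const _) (.proj _)) (.lt (.proj _) (.const _))) (.exVec
        (.and (.mem hYdef (.toLp _)) (.and (.eq (DefVec.norm (.sub (.toLp _) (.normalPart (.toLp _))))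
        (.const _)) (.and (.eq (DefVec.norm (.normalPart (.toLp _))) (.proj _)) (.eq (.mul (.inv
        (DefVec.norm (.normalPart (.toLp _)))) (DefVec.normalPart (.toLp _) i)) (.proj _)))))))
        (.and (.not (.and (.lt (.const _) (.proj _)) (.lt (.proj _) (.const _))))
          (.eq (.proj _) (.const _)))
    convert! this using 3 with w
    change g (w (Sum.inl 0)) i = w (Sum.inr 0) ↔ _
    generalize w (.inl 0) = ρ
    generalize w (.inr 0) = c
    by_cases hρ : 0 < ρ ∧ ρ < b
    · have hp := (zero_mem_cylBox_iff (n := n) (k := k) h.pos_left).2 hρ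
      simp only [hg, hρ, and_self, if_true, true_and, not_true_eq_false, false_and, or_false]
      constructor
      · intro hc
        refine ⟨Ψ (0, ρ), h.mem _ hp, ?_, h.snd_eq hp, hc⟩
        rw [h.normalPart_eq hp]; simp
      · rintro ⟨y, hy, h1, h2, h3⟩
        have hyp : cylCoord n k y = (0, ρ) := by
          refine Prod.ext (Subtype.ext ?_) h2
          rw [cylCoord_fst_coe, eq_sub_of_add_eq (starProjection_add_normalPart (d := k) y)]
          exact norm_eq_zero.1 h1
        have := h.eq_of_mem y hy (hyp ▸ hp)
        rw [hyp] at this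
        rw [this]; exact h3
    · simp only [hg, hρ, if_false, false_and, false_or, not_false_eq_true, true_and]
      exact eq_comm
  have hlim : ∀ i, ∃ c, Tendsto (fun ρ => g ρ i) (𝓝[>] 0) (𝓝 c) := fun i =>
    (hgdef i).exists_tendsto_of_abs_le (C := 1) (.of_forall fun ρ => by
      refine (PiLp.norm_apply_le (g ρ) i).trans ?_
      simp only [hg]
      split_ifs
      · exact norm_normalDir_le _
      · simp)
  choose c hc using hlim
  refine ⟨WithLp.toLp 2 c, ?_⟩
  have h1 : Tendsto g (𝓝[>] 0) (𝓝 (WithLp.toLp 2 c)) :=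
    ((PiLp.continuous_toLp 2 _).tendsto c).comp (tendsto_pi_nhds.2 hc)
  refine h1.congr' ?_
  filter_upwards [Ioo_mem_nhdsGT h.pos_right] with ρ hρ
  simp only [hg, if_pos (show 0 < ρ ∧ ρ < b from hρ)]

/-- The normal directions at a point of `Y` and at the corresponding point of the fibre over the
origin are compared by the integral of the ratio function. -/
theorem IsCylParam.enorm_normalDir_sub_le (h : IsCylParam k Y a b Ψ)
    (hY : IsCpSubmanifold 1 (k + 1) Y) {R : ℝ → ℝ≥0∞}
    (hR : ∀ y ∈ Y, gapDist (flat n k) (tangentSpaceOf Y y) ≤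
      R ‖(flat n k).starProjection y‖ * ENNReal.ofReal ‖normalPart n k y‖)
    {p : flat n k × ℝ} (hp : p ∈ cylBox n k a b) :
    ‖normalDir n k (Ψ p) - normalDir n k (Ψ (0, p.2))‖ₑ ≤ 5 * ∫⁻ t in Icc 0 ‖p.1‖, R t := by
  rcases eq_or_ne p.1 0 with h0 | h0
  · have : p = (0, p.2) := Prod.ext h0 rfl
    rw [← this]; simp
  have hx : 0 < ‖p.1‖ := norm_pos_iff.2 h0
  set u : flat n k := ‖p.1‖⁻¹ • p.1 with hu
  have hu1 : ‖u‖ = 1 := by rw [hu, norm_smul, norm_inv, norm_norm, inv_mul_cancel₀ hx.ne']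
  set l : ℝ → flat n k × ℝ := fun t => (t • u, p.2) with hl
  have hlW : ∀ t ∈ Icc 0 ‖p.1‖, l t ∈ cylBox n k a b := by
    intro t ht
    refine ⟨?_, hp.2⟩
    rw [hl, norm_smul, hu1, mul_one, Real.norm_of_nonneg ht.1]
    exact ht.2.trans_lt hp.1
  -- The normal direction along the horizontal segment from `(0, p.2)` to `p`. As the height is
  -- fixed, differentiating it involves only the horizontal derivative of `Ψ`.
  set f : ℝ → Eucl n := fun t => p.2⁻¹ • (Ψ (l t) - t • (u : Eucl n)) with hf
  have hfdir : ∀ t ∈ Icc 0 ‖p.1‖, f t = normalDir n k (Ψ (l t)) := by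
    intro t ht
    rw [normalDir, h.snd_eq (hlW t ht), h.normalPart_eq (hlW t ht)]
    rfl
  have hlc : ContDiff ℝ 1 l := (contDiff_id.smul contDiff_const).prodMk contDiff_const
  have hfc : ContDiffOn ℝ 1 f (Icc 0 ‖p.1‖) := fun t ht =>
    (((((h.contDiffAt _ (hlW t ht)).comp t hlc.contDiffAt).sub
      (contDiff_id.smul contDiff_const).contDiffAt)).const_smul p.2⁻¹).contDiffWithinAt
  have hld : ∀ t, HasDerivAt l (u, 0) t := fun t => by
    have h1 : HasDerivAt (fun t : ℝ => t • u) u t := by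
      simpa using (hasDerivAt_id t).smul_const u
    exact h1.prodMk (hasDerivAt_const t p.2)
  have hfd : ∀ t ∈ Icc 0 ‖p.1‖, deriv f t = p.2⁻¹ • (fderiv ℝ Ψ (l t) (u, 0) - u) := by
    intro t ht
    have h1 : HasDerivAt (fun t => Ψ (l t)) (fderiv ℝ Ψ (l t) (u, 0)) t :=
      HasFDerivAt.comp_hasDerivAt t
        ((h.contDiffAt _ (hlW t ht)).differentiableAt (by simp)).hasFDerivAt (hld t)
    have h2 : HasDerivAt (fun t : ℝ => t • (u : Eucl n)) (u : Eucl n) t := by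
      simpa using (hasDerivAt_id t).smul_const (u : Eucl n)
    exact ((h1.sub h2).const_smul p.2⁻¹).deriv
  have hend : f ‖p.1‖ - f 0 = normalDir n k (Ψ p) - normalDir n k (Ψ (0, p.2)) := by
    rw [hfdir _ ⟨hx.le, le_rfl⟩, hfdir _ ⟨le_rfl, hx.le⟩]
    have e1 : l ‖p.1‖ = p := by
      refine Prod.ext ?_ rfl
      simp only [hl, hu, smul_smul, mul_inv_cancel₀ hx.ne', one_smul]
    have e2 : l 0 = (0, p.2) := by simp [hl]
    rw [e1, e2]
  rw [← hend]
  refine (enorm_sub_le_lintegral_deriv_of_contDiffOn_Icc hfc hx.le).trans ?_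
  rw [← lintegral_const_mul' _ _ (by simp)]
  refine setLIntegral_mono' measurableSet_Icc fun t ht => ?_
  have hW := hlW t ht
  set T := tangentSpaceOf Y (Ψ (l t))
  -- With `l = 0` and `v` the projection of `u`, the error is five times the distance from `u` to
  -- the tangent space, hence at most `5 * R t * p.2`; the height cancels against the factor `p.2⁻¹`
  -- in `f`.
  have h1 := h.norm_fderiv_sub_le hY hW u 0 (T.starProjection_apply_mem (u : Eucl n))
  simp only [zero_smul, add_zero] at h1
  have h2 : ENNReal.ofReal ‖(u : Eucl n) - T.starProjection u‖ ≤ R t * ENNReal.ofReal p.2 := by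
    refine (ofReal_norm_sub_starProjection_le u.2).trans ?_
    have hun : ‖(u : Eucl n)‖ = 1 := hu1
    rw [hun, ENNReal.ofReal_one, one_mul]
    have := hR _ (h.mem _ hW)
    rw [h.fst_eq hW, h.snd_eq hW] at this
    have e : ‖((l t).1 : Eucl n)‖ = t := by
      change ‖t • u‖ = t
      rw [norm_smul, hu1, mul_one, Real.norm_of_nonneg ht.1]
    rwa [e] at this
  have hp2 : 0 < p.2 := hp.2.1
  rw [hfd t ht, ← ofReal_norm, norm_smul, norm_inv, Real.norm_of_nonneg hp2.le]
  calc ENNReal.ofReal (p.2⁻¹ * ‖fderiv ℝ Ψ (l t) (u, 0) - u‖)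
      ≤ ENNReal.ofReal (p.2⁻¹ * (5 * ‖(u : Eucl n) - T.starProjection u‖)) :=
        ENNReal.ofReal_le_ofReal (mul_le_mul_of_nonneg_left h1 (by positivity))
    _ = ENNReal.ofReal (5 * p.2⁻¹) * ENNReal.ofReal ‖(u : Eucl n) - T.starProjection u‖ := by
        rw [← ENNReal.ofReal_mul (by positivity)]; congr 1; ring
    _ ≤ ENNReal.ofReal (5 * p.2⁻¹) * (R t * ENNReal.ofReal p.2) := by gcongr
    _ = (ENNReal.ofReal (5 * p.2⁻¹) * ENNReal.ofReal p.2) * R t := by ring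
    _ = 5 * R t := by
        rw [← ENNReal.ofReal_mul (by positivity), mul_assoc, inv_mul_cancel₀ hp2.ne']
        simp

/-- Under the integral condition, the normal direction converges at the origin. -/
theorem IsCylParam.exists_tendsto_normalDir (h : IsCylParam k Y a b Ψ)
    (hYdef : IsDefinableSet L Y) (hY : IsCpSubmanifold 1 (k + 1) Y)
    (hYK : ∀ y ∈ Y, y ∉ flat n k) {R : ℝ → ℝ≥0∞}
    (hR : ∀ y ∈ Y, gapDist (flat n k) (tangentSpaceOf Y y) ≤
      R ‖(flat n k).starProjection y‖ * ENNReal.ofReal ‖normalPart n k y‖)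
    {ε : ℝ} (hε : 0 < ε) (hint : ∫⁻ t in Icc 0 ε, R t < ∞) :
    ∃ θ : Eucl n, Tendsto (normalDir n k) (𝓝[Y] 0) (𝓝 θ) := by
  obtain ⟨θ, hθ⟩ := h.exists_tendsto_fiber hYdef
  refine ⟨θ, ?_⟩
  -- Absolute continuity of the integral, applied on `[0, ε]`, where it is finite.
  have hint0 : Tendsto (fun t : ℝ => ∫⁻ s in Icc 0 t, R s) (𝓝 0) (𝓝 0) := by
    have h1 : Tendsto (fun t : ℝ => ∫⁻ s in Icc 0 t, R s ∂(volume.restrict (Icc 0 ε))) (𝓝 0) (𝓝 0) := by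
      refine tendsto_setLIntegral_zero hint.ne ?_
      refine tendsto_of_tendsto_of_tendsto_of_le_of_le tendsto_const_nhds
        (h := fun t => ENNReal.ofReal t) ?_ (fun _ => zero_le) fun t => ?_
      · simpa using ENNReal.continuous_ofReal.tendsto (0 : ℝ)
      · refine (Measure.restrict_apply_le _ _).trans ?_
        rw [Real.volume_Icc, sub_zero]
    refine h1.congr' ?_
    filter_upwards [gt_mem_nhds hε] with t ht
    rw [Measure.restrict_restrict measurableSet_Icc, inter_eq_left.2 (Icc_subset_Icc_right ht.le)]
  have hx0 : Tendsto (fun y : Eucl n => ‖(flat n k).starProjection y‖) (𝓝[Y] 0) (𝓝 0) := by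
    have : Continuous fun y : Eucl n => ‖(flat n k).starProjection y‖ := by fun_prop
    simpa using (this.tendsto 0).mono_left nhdsWithin_le_nhds
  have hr0 : Tendsto (fun y : Eucl n => ‖normalPart n k y‖) (𝓝[Y] 0) (𝓝[>] 0) := by
    refine tendsto_nhdsWithin_iff.2 ⟨?_, ?_⟩
    · have : Continuous fun y : Eucl n => ‖normalPart n k y‖ := by fun_prop
      simpa using (this.tendsto 0).mono_left nhdsWithin_le_nhds
    · filter_upwards [self_mem_nhdsWithin] with y hy
      exact norm_pos_iff.2 fun h => hYK y hy (normalPart_eq_zero_iff.1 h)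
  have hfib := hθ.comp hr0
  rw [tendsto_iff_edist_tendsto_0] at hfib ⊢
  have hsum : Tendsto (fun y : Eucl n => (5 * ∫⁻ s in Icc 0 ‖(flat n k).starProjection y‖, R s) +
      edist (normalDir n k (Ψ (0, ‖normalPart n k y‖))) θ) (𝓝[Y] 0) (𝓝 0) := by
    have := (ENNReal.Tendsto.const_mul (a := 5) (hint0.comp hx0) (Or.inr (by simp))).add hfib
    simpa [Function.comp_def] using this
  refine tendsto_of_tendsto_of_tendsto_of_le_of_le' tendsto_const_nhds hsum
    (.of_forall fun _ => zero_le) ?_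
  filter_upwards [self_mem_nhdsWithin, hx0.eventually (gt_mem_nhds h.pos_left),
    (hr0.mono_right nhdsWithin_le_nhds).eventually (gt_mem_nhds h.pos_right),
    hr0.eventually self_mem_nhdsWithin] with y hy h1 h2 h3
  have hp : cylCoord n k y ∈ cylBox n k a b := ⟨h1, h3, h2⟩
  have := h.enorm_normalDir_sub_le hY hR hp
  rw [h.eq_of_mem y hy hp] at this
  refine (edist_triangle _ (normalDir n k (Ψ (0, ‖normalPart n k y‖))) _).trans ?_
  refine add_le_add ?_ le_rfl
  rw [edist_eq_enorm_sub]
  exact this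

end Direction

/-! ### Behaviour of tangent spaces and normal directions under coordinate changes -/

section Transfer

variable {n k : ℕ}

theorem gapDist_mono {E E' : Submodule ℝ (Eucl n)} (h : E ≤ E') (T : Submodule ℝ (Eucl n)) :
    gapDist E T ≤ gapDist E' T :=
  iSup_mono fun _ => iSup_mono' fun hu => ⟨h hu, le_rfl⟩

theorem tendsto_gapDist_iff {ι : Type*} {l : Filter ι} {W : Submodule ℝ (Eucl n)}
    {T : ι → Submodule ℝ (Eucl n)} :
    Tendsto (fun i => gapDist W (T i)) l (𝓝 0) ↔
      ∀ η > 0, ∀ᶠ i in l, ∀ w ∈ W, ∃ v ∈ T i, ‖w - v‖ ≤ η * ‖w‖ := by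
  rw [ENNReal.tendsto_nhds_zero]
  constructor
  · intro h η hη
    filter_upwards [h (ENNReal.ofReal η) (by simpa using hη)] with i hi w hw
    refine ⟨_, (T i).starProjection_apply_mem w, ?_⟩
    rw [← ENNReal.ofReal_le_ofReal_iff (by positivity), mul_comm,
      ENNReal.ofReal_mul (norm_nonneg w)]
    exact (ofReal_norm_sub_starProjection_le hw).trans (by gcongr)
  · intro h ε hε
    -- Truncation by 1 covers the case `ε = ∞`.
    have hm : min ε 1 ≠ ∞ := (min_le_right ε 1).trans_lt ENNReal.one_lt_top |>.ne
    have hη : 0 < (min ε 1).toReal := ENNReal.toReal_pos (lt_min hε one_pos).ne' hm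
    filter_upwards [h _ hη] with i hi
    refine iSup_le fun u => iSup_le fun hu => iSup_le fun hu1 => ?_
    obtain ⟨v, hv, hv'⟩ := hi u hu
    refine (Metric.infEDist_le_edist_of_mem hv).trans ?_
    rw [edist_dist, dist_eq_norm]
    rw [hu1, mul_one] at hv'
    refine (ENNReal.ofReal_le_ofReal hv').trans ?_
    rw [ENNReal.ofReal_toReal hm]
    exact min_le_left _ _

/-- If `v`, tangent at `y`, approximates `w`, then its image under the derivative of `φ` at `y`
approximates `A w`, because this derivative tends to `A`. -/
theorem tendsto_gapDist_map {φ : OpenPartialHomeomorph (Eucl n) (Eucl n)} (hφ : IsCpChart 1 φ)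
    {M M' : Set (Eucl n)} (hM : φ.IsImage M M') {x : Eucl n} (hx : x ∈ φ.source)
    {A : Eucl n ≃L[ℝ] Eucl n} (hA : HasFDerivAt φ (A : Eucl n →L[ℝ] Eucl n) x)
    {W : Submodule ℝ (Eucl n)}
    (h : Tendsto (fun y => gapDist W (tangentSpaceOf M y)) (𝓝[M] x) (𝓝 0)) :
    Tendsto (fun y => gapDist (W.map (A : Eucl n →ₗ[ℝ] Eucl n)) (tangentSpaceOf M' y))
      (𝓝[M'] (φ x)) (𝓝 0) := by
  rw [← hM.map_nhdsWithin_eq hx, tendsto_map'_iff]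
  rw [tendsto_gapDist_iff] at h
  refine tendsto_gapDist_iff.2 fun η hη => ?_
  set C := ‖(A : Eucl n →L[ℝ] Eucl n)‖
  set C' := ‖(A.symm : Eucl n →L[ℝ] Eucl n)‖
  have hC : 0 ≤ C := norm_nonneg _
  have hC' : 0 ≤ C' := norm_nonneg _
  set η' := min 1 (η / ((C + 2) * (C' + 1))) with hη'
  have hη0 : 0 < η' := lt_min one_pos (by positivity)
  have hη1 : η' ≤ 1 := min_le_left _ _
  have hη2 : (C + 2) * η' * C' ≤ η := by
    have : η' ≤ η / ((C + 2) * (C' + 1)) := min_le_right _ _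
    rw [le_div_iff₀ (by positivity)] at this
    nlinarith [mul_nonneg (by positivity : 0 ≤ C + 2) hη0.le]
  have hcont : ContinuousAt (fderiv ℝ φ) x :=
    (hφ.contDiffAt hx).continuousAt_fderiv (by simp)
  have hnear : ∀ᶠ y in 𝓝 x, ‖fderiv ℝ φ y - (A : Eucl n →L[ℝ] Eucl n)‖ < η' := by
    have := hcont.eventually (Metric.ball_mem_nhds _ hη0)
    rw [hA.fderiv] at this
    simpa [dist_eq_norm] using this
  filter_upwards [h η' hη0, nhdsWithin_le_nhds hnear,
    nhdsWithin_le_nhds (φ.open_source.mem_nhds hx)] with y hy hD hyφ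
  rintro _ ⟨w, hw, rfl⟩
  obtain ⟨v, hv, hvw⟩ := hy w hw
  have hDy : HasFDerivAt φ (fderiv ℝ φ y) y :=
    ((hφ.contDiffAt hyφ).differentiableAt (by simp)).hasFDerivAt
  refine ⟨fderiv ℝ φ y v, map_tangentSpaceOf_le hDy ?_ ⟨v, hv, rfl⟩, ?_⟩
  · filter_upwards [self_mem_nhdsWithin, nhdsWithin_le_nhds (φ.open_source.mem_nhds hyφ)] with z hz hzφ
    exact (hM hzφ).2 hz
  set D := fderiv ℝ φ y
  have h1 : ‖(A : Eucl n →L[ℝ] Eucl n) w - D w‖ ≤ η' * ‖w‖ := by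
    rw [norm_sub_rev, ← _root_.sub_apply]
    exact (D - A : Eucl n →L[ℝ] Eucl n).le_of_opNorm_le hD.le w
  have hDn : ‖D‖ ≤ C + 1 := by
    have := norm_le_norm_add_norm_sub (A : Eucl n →L[ℝ] Eucl n) D
    rw [norm_sub_rev] at this
    linarith
  have h2 : ‖D (w - v)‖ ≤ (C + 1) * (η' * ‖w‖) :=
    (D.le_of_opNorm_le hDn _).trans (mul_le_mul_of_nonneg_left hvw (by positivity))
  have h3 : ‖w‖ ≤ C' * ‖A w‖ := by
    have := (A.symm : Eucl n →L[ℝ] Eucl n).le_opNorm (A w)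
    simpa using this
  change ‖A w - D v‖ ≤ η * ‖A w‖
  calc ‖A w - D v‖ = ‖(A w - D w) + D (w - v)‖ := by congr 1; rw [map_sub]; abel
    _ ≤ η' * ‖w‖ + (C + 1) * (η' * ‖w‖) := (norm_add_le _ _).trans (add_le_add h1 h2)
    _ = (C + 2) * η' * ‖w‖ := by ring
    _ ≤ (C + 2) * η' * (C' * ‖A w‖) := by gcongr
    _ = ((C + 2) * η' * C') * ‖A w‖ := by ring
    _ ≤ η * ‖A w‖ := by gcongr

theorem normalDir_eq_of_smul {y z : Eucl n} {c : ℝ} (hc : 0 < c)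
    (h : normalPart n k y = c • normalPart n k z) : normalDir n k y = normalDir n k z := by
  rw [normalDir, h, norm_smul, Real.norm_of_nonneg hc.le, smul_smul, normalDir, mul_inv, mul_assoc,
    mul_comm ‖normalPart n k z‖⁻¹ c, inv_mul_cancel_left₀ hc.ne']

theorem continuousAt_normalDir {y : Eucl n} (hy : normalPart n k y ≠ 0) :
    ContinuousAt (normalDir n k) y :=
  ContinuousAt.smul (((normalPart n k).continuous.norm.continuousAt).inv₀ (norm_ne_zero_iff.2 hy))
    (normalPart n k).continuous.continuousAt

/-- Strict differentiability on the pairs (y, π y) gives φ(y) - φ(π y) = A h + o(|h|), where h is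
the normal part of y. Since φ(π y) stays in ℝᵏ × 0, the left side has the same normal part as φ(y).
-/
theorem tendsto_normalDir_map {φ : OpenPartialHomeomorph (Eucl n) (Eucl n)}
    (hK : φ.IsImage (flat n k) (flat n k))
    {M M' : Set (Eucl n)} (hM : φ.IsImage M M') (hMK : ∀ y ∈ M, y ∉ flat n k) {x : Eucl n}
    (hx : x ∈ φ.source) (hxK : x ∈ flat n k) {A : Eucl n →L[ℝ] Eucl n}
    (hA : HasStrictFDerivAt φ A x) {θ : Eucl n} (hAθ : normalPart n k (A θ) ≠ 0)
    (hθ : Tendsto (normalDir n k) (𝓝[M] x) (𝓝 θ)) :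
    Tendsto (normalDir n k) (𝓝[M'] (φ x)) (𝓝 (normalDir n k (A θ))) := by
  rw [← hM.map_nhdsWithin_eq hx, tendsto_map'_iff]
  set π := (flat n k).starProjection
  have hπx : π x = x := Submodule.starProjection_eq_self_iff.2 hxK
  have hπ : Tendsto π (𝓝[M] x) (𝓝 x) := by
    have := π.continuous.tendsto x
    rw [hπx] at this
    exact this.mono_left nhdsWithin_le_nhds
  have hpair : Tendsto (fun y => (y, π y)) (𝓝[M] x) (𝓝 (x, x)) :=
    (tendsto_id.mono_left nhdsWithin_le_nhds).prodMk_nhds hπ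
  have ho := (hA.isLittleO.comp_tendsto hpair).norm_right.tendsto_inv_smul_nhds_zero
  have hsum := ((A.continuous.tendsto θ).comp hθ).add ho
  rw [add_zero] at hsum
  have hlim := (continuousAt_normalDir hAθ).tendsto.comp hsum
  refine hlim.congr' ?_
  filter_upwards [self_mem_nhdsWithin, hπ.eventually_mem (φ.open_source.mem_nhds hx)] with y hy hπy
  have hpos : 0 < ‖normalPart n k y‖ :=
    norm_pos_iff.2 fun h => hMK y hy (normalPart_eq_zero_iff.1 h)
  refine normalDir_eq_of_smul (inv_pos.2 hpos) ?_
  have h0 : normalPart n k (φ (π y)) = 0 :=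
    normalPart_eq_zero_iff.2 ((hK hπy).2 (Submodule.starProjection_apply_mem _ _))
  have e1 : y - π y = normalPart n k y := rfl
  simp only [Function.comp_apply, e1, normalDir, map_smul]
  rw [← smul_add, add_sub_cancel, map_smul, map_sub, h0, sub_zero]

/-- Near `x ∈ ℝᵏ × 0` the set `Y` approaches the half-space spanned by `ℝᵏ × 0` and `θ`, together
with its tangent spaces. -/
structure HasTangentHalfSpace (k : ℕ) (Y : Set (Eucl n)) (x θ : Eucl n) : Prop where
  norm_eq : ‖θ‖ = 1
  orth : θ ∈ (flat n k)ᗮ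
  dir : Tendsto (normalDir n k) (𝓝[Y] x) (𝓝 θ)
  tangent : Tendsto (fun y => gapDist (flat n k ⊔ Submodule.span ℝ {θ}) (tangentSpaceOf Y y))
    (𝓝[Y] x) (𝓝 0)

theorem HasTangentHalfSpace.notMem {Y : Set (Eucl n)} {x θ : Eucl n}
    (h : HasTangentHalfSpace k Y x θ) : θ ∉ flat n k := fun hθ => by
  have := Submodule.inner_left_of_mem_orthogonal hθ h.orth
  rw [real_inner_self_eq_norm_sq, h.norm_eq] at this
  norm_num at this

theorem normalDir_mem_orthogonal (y : Eucl n) : normalDir n k y ∈ (flat n k)ᗮ :=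
  Submodule.smul_mem _ _ (normalPart_mem_orthogonal y)

/-- Needed because the integral condition supplies a separate chart at each point of X, while
smoothness up to the boundary requires the limits at all nearby points in a single chart. -/
theorem HasTangentHalfSpace.map {φ : OpenPartialHomeomorph (Eucl n) (Eucl n)} (hφ : IsCpChart 1 φ)
    (hK : φ.IsImage (flat n k) (flat n k)) {M M' : Set (Eucl n)} (hM : φ.IsImage M M')
    (hMK : ∀ y ∈ M, y ∉ flat n k) {x θ : Eucl n} (hx : x ∈ φ.source) (hxK : x ∈ flat n k)
    (h : HasTangentHalfSpace k M x θ) : ∃ θ', HasTangentHalfSpace k M' (φ x) θ' := by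
  obtain ⟨A, hA, hA'⟩ := hφ.exists_equiv hx
  have hAK : ∀ v, v ∈ flat n k ↔ A v ∈ flat n k := fun v => by
    have := tangentSpaceOf_isImage hK hx hA.hasFDerivAt hA'.hasFDerivAt (v := v)
    rwa [Submodule.tangentSpaceOf_eq _ hxK, Submodule.tangentSpaceOf_eq _ ((hK hx).2 hxK)] at this
  have hAθ : normalPart n k (A θ) ≠ 0 := fun h0 =>
    h.notMem ((hAK θ).2 (normalPart_eq_zero_iff.1 h0))
  refine ⟨normalDir n k (A θ), norm_normalDir hAθ, normalDir_mem_orthogonal _,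
    tendsto_normalDir_map hK hM hMK hx hxK hA hAθ h.dir, ?_⟩
  refine tendsto_of_tendsto_of_tendsto_of_le_of_le tendsto_const_nhds
    (tendsto_gapDist_map hφ hM hx hA.hasFDerivAt h.tangent) (fun _ => zero_le)
    fun y => gapDist_mono ?_ _
  have hle : flat n k ≤ (flat n k ⊔ Submodule.span ℝ {θ}).map (A : Eucl n →ₗ[ℝ] Eucl n) :=
    fun e he => ⟨A.symm e, Submodule.mem_sup_left ((hAK _).2 (by simpa using he)), by simp⟩
  refine sup_le hle ((Submodule.span_singleton_le_iff_mem _ _).2 ?_)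
  refine Submodule.smul_mem _ _ ?_
  rw [normalPart_apply]
  refine Submodule.sub_mem _ ⟨θ, Submodule.mem_sup_right (Submodule.mem_span_singleton_self θ), rfl⟩
    (hle (Submodule.starProjection_apply_mem _ _))

end Transfer

/-! ### The pair of strata in adapted coordinates -/

section Model

variable {n k : ℕ}

theorem OpenPartialHomeomorph.IsImage.trans_isImage
    {φ ψ : OpenPartialHomeomorph (Eucl n) (Eucl n)} {s t u : Set (Eucl n)} (h : φ.IsImage s t)
    (h' : ψ.IsImage t u) : (φ.trans ψ).IsImage s u := fun x hx => by
  rw [φ.trans_source] at hx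
  exact (h' hx.2).trans (h hx.1)

theorem OpenPartialHomeomorph.isImage_image (φ : OpenPartialHomeomorph (Eucl n) (Eucl n))
    (Y : Set (Eucl n)) : φ.IsImage Y (φ '' (φ.source ∩ Y)) := fun x hx =>
  ⟨fun ⟨_, hy, hyx⟩ => φ.injOn hy.1 hx hyx ▸ hy.2, fun h => ⟨x, ⟨hx, h⟩, rfl⟩⟩

theorem IsCpSubmanifold.image {p d : ℕ} {Y : Set (Eucl n)} (hY : IsCpSubmanifold p d Y)
    {φ : OpenPartialHomeomorph (Eucl n) (Eucl n)} (hφ : IsCpChart p φ) :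
    IsCpSubmanifold p d (φ '' (φ.source ∩ Y)) := by
  refine ⟨hY.1, ?_⟩
  rintro _ ⟨y, ⟨hyφ, hyY⟩, rfl⟩
  obtain ⟨ψ, hyψ, hψ, hYψ⟩ := hY.2 y hyY
  refine ⟨φ.symm.trans ψ, ?_, hφ.symm.trans hψ, (φ.isImage_image Y).symm.trans_isImage hYψ⟩
  simpa [hyφ] using hyψ

theorem IsDefinableSet.image {L : FirstOrder.Language} [L.Structure ℝ] {Y : Set (Eucl n)}
    (hY : IsDefinableSet L Y) {φ : OpenPartialHomeomorph (Eucl n) (Eucl n)}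
    (hφ : IsDefinableChart L φ) : IsDefinableSet L (φ '' (φ.source ∩ Y)) := by
  have hφ' := DefPred.reindex (P := fun v : Fin n ⊕ Fin n → ℝ =>
    WithLp.toLp 2 (fun i => v (Sum.inl i)) ∈ φ.source ∧
      φ (WithLp.toLp 2 (fun i => v (Sum.inl i))) = WithLp.toLp 2 (fun i => v (Sum.inr i))) hφ Sum.swap
  have hY' := DefPred.reindex (P := fun v : Fin n → ℝ => WithLp.toLp 2 v ∈ Y) hY
    (Sum.inr : Fin n → Fin n ⊕ Fin n)
  have h := DefPred.exVec (P := fun (v : Fin n → ℝ) u =>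
    (u ∈ φ.source ∧ φ u = WithLp.toLp 2 v) ∧ u ∈ Y) (hφ'.and hY')
  unfold DefPred at h
  unfold IsDefinableSet
  convert! h using 3 with v
  constructor
  · rintro ⟨u, ⟨h1, h2⟩, h3⟩; exact ⟨u, ⟨h1, h3⟩, h2⟩
  · rintro ⟨u, ⟨h1, h3⟩, h2⟩; exact ⟨u, ⟨h1, h2⟩, h3⟩

/-- Transports local closedness to the chart in the form required by the properness argument: closed
inside a small ball. -/
theorem OpenPartialHomeomorph.IsImage.exists_isClosed_inter_closedBall
    {φ : OpenPartialHomeomorph (Eucl n) (Eucl n)} {S S' : Set (Eucl n)} (h : φ.IsImage S S')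
    (hS : IsLocallyClosed S) {x : Eucl n} (hxS : x ∈ S) (hx : x ∈ φ.source) :
    ∃ R > 0, IsClosed (S' ∩ Metric.closedBall (φ x) R) := by
  obtain ⟨U, Z, hU, hZ, rfl⟩ := hS
  have hO : φ.target ∩ φ.symm ⁻¹' U ∈ 𝓝 (φ x) :=
    (φ.symm.isOpen_inter_preimage hU).mem_nhds ⟨φ.map_source hx, by simpa [hx] using hxS.1⟩
  obtain ⟨R, hR, hRO⟩ := Metric.nhds_basis_closedBall.mem_iff.1 hO
  refine ⟨R, hR, ?_⟩
  have : S' ∩ Metric.closedBall (φ x) R = Metric.closedBall (φ x) R ∩ φ.symm ⁻¹' Z := by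
    ext w
    rw [inter_comm, mem_inter_iff, mem_inter_iff]
    refine and_congr_right fun hw => ?_
    rw [← h.symm_apply_mem_iff (hRO hw).1]
    exact and_iff_right (hRO hw).2
  rw [this]
  exact (φ.continuousOn_symm.mono fun w hw => (hRO hw).1).preimage_isClosed_of_isClosed
    Metric.isClosed_closedBall hZ

/-- Apart from the finite integral, this division-free bound is all that is used about the ratio
function. -/
theorem gapDist_le_ratioFun_mul (Y : Set (Eucl n)) (hYK : ∀ y ∈ Y, y ∉ flat n k) (y : Eucl n)
    (hy : y ∈ Y) : gapDist (flat n k) (tangentSpaceOf Y y) ≤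
      ratioFun k Y ‖(flat n k).starProjection y‖ * ENNReal.ofReal ‖normalPart n k y‖ := by
  have hpos : 0 < ‖normalPart n k y‖ :=
    norm_pos_iff.2 fun h => hYK y hy (normalPart_eq_zero_iff.1 h)
  have h1 : gapDist (flat n k) (tangentSpaceOf Y y) / edist y ((flat n k).starProjection y) ≤
      ratioFun k Y ‖(flat n k).starProjection y‖ :=
    le_iSup_of_le y (le_iSup_of_le hy (le_iSup_of_le rfl le_rfl))
  rw [edist_dist, dist_eq_norm, ← normalPart_apply] at h1
  exact (ENNReal.div_le_iff (by simpa using hpos.ne') ENNReal.ofReal_ne_top).1 h1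

/-- A vector e + cθ of the limit space is approximated with three errors of η/3: e by a tangent
vector, θ by the normal direction, and the normal direction by a tangent vector. -/
theorem HasTangentHalfSpace.of_tendsto {Y : Set (Eucl n)} {x θ : Eucl n} (hx : x ∈ closure Y)
    (hYK : ∀ y ∈ Y, y ∉ flat n k) (h1 : Tendsto (normalDir n k) (𝓝[Y] x) (𝓝 θ))
    (h2 : ∀ η > 0, ∀ᶠ y in 𝓝[Y] x, ∃ v ∈ tangentSpaceOf Y y,
      ‖normalPart n k y - v‖ ≤ η * ‖normalPart n k y‖)
    (h3 : Tendsto (fun y => gapDist (flat n k) (tangentSpaceOf Y y)) (𝓝[Y] x) (𝓝 0)) :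
    HasTangentHalfSpace k Y x θ := by
  have : (𝓝[Y] x).NeBot := mem_closure_iff_nhdsWithin_neBot.1 hx
  have hn : ∀ y ∈ Y, normalPart n k y ≠ 0 := fun y hy h => hYK y hy (normalPart_eq_zero_iff.1 h)
  have hθ : ‖θ‖ = 1 := by
    refine tendsto_nhds_unique h1.norm (tendsto_const_nhds.congr' ?_)
    filter_upwards [self_mem_nhdsWithin] with y hy
    exact (norm_normalDir (hn y hy)).symm
  have hθK : θ ∈ (flat n k)ᗮ :=
    ((flat n k)ᗮ).closed_of_finiteDimensional.mem_of_tendsto h1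
      (.of_forall fun y => normalDir_mem_orthogonal y)
  refine ⟨hθ, hθK, h1, tendsto_gapDist_iff.2 fun η hη => ?_⟩
  have hη3 : 0 < η / 3 := by positivity
  filter_upwards [self_mem_nhdsWithin, h2 _ hη3, tendsto_gapDist_iff.1 h3 _ hη3,
    h1.eventually (Metric.ball_mem_nhds θ hη3)] with y hy ⟨v₂, hv₂, hv₂'⟩ hfl hdir w hw
  obtain ⟨e, he, z, hz, rfl⟩ := Submodule.mem_sup.1 hw
  obtain ⟨c, rfl⟩ := Submodule.mem_span_singleton.1 hz
  obtain ⟨v₁, hv₁, hv₁'⟩ := hfl e he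
  set w := e + c • θ
  have hpos : 0 < ‖normalPart n k y‖ := norm_pos_iff.2 (hn y hy)
  have hew : ‖e‖ ≤ ‖w‖ := by
    have : (flat n k).starProjection w = e := by
      rw [map_add, map_smul, (Submodule.starProjection_apply_eq_zero_iff _).2 hθK,
        Submodule.starProjection_eq_self_iff.2 he]; simp
    rw [← this]; exact norm_starProjection_flat_le _
  have hcw : |c| ≤ ‖w‖ := by
    have : inner ℝ θ w = c := by
      rw [inner_add_right, real_inner_smul_right, real_inner_self_eq_norm_sq, hθ,
        Submodule.inner_left_of_mem_orthogonal he hθK]; simp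
    rw [← this]
    refine (abs_real_inner_le_norm _ _).trans ?_
    rw [hθ, one_mul]
  have hd : ‖θ - normalDir n k y‖ ≤ η / 3 := by
    rw [dist_comm, dist_eq_norm] at hdir
    exact hdir.le
  have hd2 : ‖normalDir n k y - ‖normalPart n k y‖⁻¹ • v₂‖ ≤ η / 3 := by
    rw [normalDir, ← smul_sub, norm_smul, norm_inv, norm_norm, inv_mul_le_iff₀ hpos, mul_comm]
    exact hv₂'
  refine ⟨v₁ + c • ‖normalPart n k y‖⁻¹ • v₂, Submodule.add_mem _ hv₁
    (Submodule.smul_mem _ _ (Submodule.smul_mem _ _ hv₂)), ?_⟩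
  calc ‖w - (v₁ + c • ‖normalPart n k y‖⁻¹ • v₂)‖
      = ‖(e - v₁) + c • ((θ - normalDir n k y) +
          (normalDir n k y - ‖normalPart n k y‖⁻¹ • v₂))‖ := by
        congr 1
        rw [sub_add_sub_cancel, smul_sub]
        simp only [w]; abel
    _ ≤ η / 3 * ‖e‖ + |c| * (η / 3 + η / 3) := by
        refine (norm_add_le _ _).trans (add_le_add hv₁' ?_)
        rw [norm_smul, Real.norm_eq_abs]
        gcongr
        exact (norm_add_le _ _).trans (add_le_add hd hd2)
    _ ≤ η / 3 * ‖w‖ + ‖w‖ * (η / 3 + η / 3) := by gcongr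
    _ = η * ‖w‖ := by ring

theorem IsCylParam.mono {Y : Set (Eucl n)} {a b a' b' : ℝ} {Ψ : flat n k × ℝ → Eucl n}
    (h : IsCylParam k Y a b Ψ) (ha : 0 < a') (hb : 0 < b') (haa : a' ≤ a) (hbb : b' ≤ b) :
    IsCylParam k Y a' b' Ψ := by
  have hsub : cylBox n k a' b' ⊆ cylBox n k a b := fun p hp =>
    ⟨hp.1.trans_le haa, hp.2.1, hp.2.2.trans_le hbb⟩
  exact ⟨ha, hb, fun p hp => h.contDiffAt p (hsub hp), fun p hp => h.mem p (hsub hp),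
    fun p hp => h.coord p (hsub hp), fun p hp => h.close p (hsub hp),
    fun y hy hp => h.eq_of_mem y hy (hsub hp)⟩

/-- In suitable coordinates around a point of the smaller stratum, this stratum is `ℝᵏ × 0`, and the
larger one has a cylindrical parametrization and a tangent half-space. -/
theorem exists_chart_isCylParam {L : FirstOrder.Language} [L.Structure ℝ] (hL : IsOMinimal L)
    {X Y : Set (Eucl n)} (hYdef : IsDefinableSet L Y) (hY : IsCpSubmanifold 1 (k + 1) Y)
    (hdisj : Disjoint X Y) (hclosed : IsLocallyClosed (X ∪ Y)) {x : Eucl n} (hxX : x ∈ X)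
    (hxY : x ∈ closure Y) (hloc : ∀ᶠ ε in 𝓝[>] (0 : ℝ), IsConnected (Y ∩ Metric.ball x ε))
    (ha : ConditionA Y X x) (hr : ConditionRInt L k Y X x) :
    ∃ (φ : OpenPartialHomeomorph (Eucl n) (Eucl n)) (Y' : Set (Eucl n)),
      x ∈ φ.source ∧ φ x = 0 ∧ IsCpChart 1 φ ∧ φ.IsImage X (flat n k) ∧ φ.IsImage Y Y' ∧
      IsCpSubmanifold 1 (k + 1) Y' ∧ (∀ y ∈ Y', y ∉ flat n k) ∧
      (∃ a b Ψ, IsCylParam k Y' a b Ψ ∧ Metric.ball 0 a ⊆ φ.target) ∧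
      ∃ θ, HasTangentHalfSpace k Y' 0 θ := by
  have : Fact (IsOMinimal L) := ⟨hL⟩
  obtain ⟨φ, hxφ, hφx, hφ2, hφdef, hXφ, ε, hε, hint⟩ := hr
  have hφ : IsCpChart 1 φ := hφ2.mono (by norm_num)
  set Y' := φ '' (φ.source ∩ Y) with hY'
  have hYφ : φ.IsImage Y Y' := φ.isImage_image Y
  have hY'sub : IsCpSubmanifold 1 (k + 1) Y' := hY.image hφ
  have hY'def : IsDefinableSet L Y' := hYdef.image hφdef
  have hY'K : ∀ y ∈ Y', y ∉ flat n k := by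
    rintro _ ⟨y, ⟨hyφ, hyY⟩, rfl⟩ hyK
    exact disjoint_left.1 hdisj ((hXφ hyφ).1 hyK) hyY
  have hR := gapDist_le_ratioFun_mul Y' hY'K
  have h0 : (0 : Eucl n) ∈ closure Y' := hφx ▸ (hYφ.closure hxφ).2 hxY
  have h3 : Tendsto (fun y => gapDist (flat n k) (tangentSpaceOf Y' y)) (𝓝[Y'] 0) (𝓝 0) := by
    obtain ⟨A, hA, hA'⟩ := hφ.exists_equiv hxφ
    have h := tendsto_gapDist_map hφ hYφ hxφ hA.hasFDerivAt ha
    rw [hφx] at h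
    refine tendsto_of_tendsto_of_tendsto_of_le_of_le tendsto_const_nhds h (fun _ => zero_le)
      fun y => gapDist_mono ?_ _
    intro e he
    refine ⟨A.symm e, ?_, by simp⟩
    refine (tangentSpaceOf_isImage hXφ hxφ hA.hasFDerivAt hA'.hasFDerivAt).2 ?_
    rw [Submodule.tangentSpaceOf_eq _ ((hXφ hxφ).2 hxX)]
    simpa using he
  have h2 : ∀ η > 0, ∀ᶠ y in 𝓝[Y'] 0, ∃ v ∈ tangentSpaceOf Y' y,
      ‖normalPart n k y - v‖ ≤ η * ‖normalPart n k y‖ := fun η hη =>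
    eventually_exists_tangent_near_normalPart hY'def hY'sub hY'K hR hε hint hη
  have hclose : ∀ᶠ y in 𝓝[Y'] 0, CloseTangent k (tangentSpaceOf Y' y) y := by
    filter_upwards [h2 (1 / 8) (by norm_num), tendsto_gapDist_iff.1 h3 (1 / 8) (by norm_num)]
      with y hy1 hy2
    refine ⟨fun e he => ?_, hy1⟩
    obtain ⟨v, hv, hv'⟩ := hy2 e he
    exact ⟨v, hv, by rwa [norm_sub_rev]⟩
  have hconn : ∀ U ∈ 𝓝 (0 : Eucl n), ∃ C ⊆ Y' ∩ U, IsPreconnected C ∧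
      ∃ U' ∈ 𝓝 (0 : Eucl n), Y' ∩ U' ⊆ C := by
    intro U hU
    have hU' : φ ⁻¹' U ∩ φ.source ∈ 𝓝 x :=
      inter_mem ((φ.continuousAt hxφ).preimage_mem_nhds (by rwa [hφx]))
        (φ.open_source.mem_nhds hxφ)
    obtain ⟨δ, hδ, hδU⟩ := Metric.mem_nhds_iff.1 hU'
    -- Connectedness is known for balls in the original coordinates; the image of a small one serves
    -- as the connected set in the chart.
    obtain ⟨r, hr, hr0, hrδ⟩ := (hloc.and (Ioo_mem_nhdsGT hδ)).exists
    have hsub := (Metric.ball_subset_ball hrδ.le).trans hδU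
    refine ⟨φ '' (Y ∩ Metric.ball x r), ?_, hr.isPreconnected.image _
      (φ.continuousOn.mono fun y hy => (hsub hy.2).2), φ.target ∩ φ.symm ⁻¹' Metric.ball x r, ?_, ?_⟩
    · rintro _ ⟨y, hy, rfl⟩
      exact ⟨⟨y, ⟨(hsub hy.2).2, hy.1⟩, rfl⟩, (hsub hy.2).1⟩
    · rw [← hφx]
      refine (φ.symm.isOpen_inter_preimage Metric.isOpen_ball).mem_nhds ⟨φ.map_source hxφ, ?_⟩
      simpa [hxφ] using hr0
    · rintro _ ⟨⟨y, ⟨hyφ, hyY⟩, rfl⟩, -, hyr⟩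
      rw [mem_preimage, φ.left_inv hyφ] at hyr
      exact ⟨y, ⟨hyY, hyr⟩, rfl⟩
  obtain ⟨R, hR0, hcl⟩ := (hYφ.union hXφ).exists_isClosed_inter_closedBall
    (by rwa [union_comm]) (Or.inr hxX) hxφ
  rw [hφx] at hcl
  obtain ⟨a, b, Ψ, hΨ⟩ := exists_isCylParam hY'sub hY'K hR0 hcl hclose hconn h0
  obtain ⟨θ, hθ⟩ := hΨ.exists_tendsto_normalDir hY'def hY'sub hY'K hR hε hint
  obtain ⟨δ, hδ, hδU⟩ := Metric.mem_nhds_iff.1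
    (φ.open_target.mem_nhds (hφx ▸ φ.map_source hxφ : (0 : Eucl n) ∈ φ.target))
  -- The box is narrowed so that its base lies in the target of the chart; all points of the base
  -- then come from X.
  refine ⟨φ, Y', hxφ, hφx, hφ, hXφ, hYφ, hY'sub, hY'K, ⟨min a δ, b, Ψ,
    hΨ.mono (lt_min hΨ.pos_left hδ) hΨ.pos_right (min_le_left _ _) le_rfl,
    (Metric.ball_subset_ball (min_le_right _ _)).trans hδU⟩, θ, .of_tendsto h0 hY'K hθ h2 h3⟩

end Model

/-! ### Extension of the parametrization across the boundary -/

section Extension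

variable {n k : ℕ}

/-- The normal component of the parametrization `Ψ`, extended to an odd function of the last
variable. -/
noncomputable def cylExt (Ψ : flat n k × ℝ → Eucl n) (p : flat n k × ℝ) : Eucl n :=
  p.2 • normalDir n k (Ψ (p.1, |p.2|))

/-- The reflection of the last variable. -/
noncomputable def cylRefl (n k : ℕ) : (flat n k × ℝ) ≃L[ℝ] (flat n k × ℝ) :=
  (ContinuousLinearEquiv.refl ℝ _).prodCongr (ContinuousLinearEquiv.neg ℝ)

theorem cylRefl_apply (p : flat n k × ℝ) : cylRefl n k p = (p.1, -p.2) := rfl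

theorem cylExt_eq_neg (Ψ : flat n k × ℝ → Eucl n) : cylExt Ψ = -(cylExt Ψ ∘ cylRefl n k) := by
  ext1 p
  simp [cylExt, cylRefl_apply]

/-- Oddness reduces the behaviour of the derivative below the boundary to that above it. -/
theorem fderiv_cylExt (Ψ : flat n k × ℝ → Eucl n) (p : flat n k × ℝ) :
    fderiv ℝ (cylExt Ψ) p =
      -(fderiv ℝ (cylExt Ψ) (cylRefl n k p)).comp (cylRefl n k : (flat n k × ℝ) →L[ℝ] _) := by
  conv_lhs => rw [cylExt_eq_neg]
  rw [fderiv_neg, ContinuousLinearEquiv.comp_right_fderiv]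

theorem cylExt_zero (Ψ : flat n k × ℝ → Eucl n) (x : flat n k) : cylExt Ψ (x, 0) = 0 := by
  simp [cylExt]

namespace IsCylParam

variable {Y : Set (Eucl n)} {a b : ℝ} {Ψ : flat n k × ℝ → Eucl n}

theorem cylExt_eq (h : IsCylParam k Y a b Ψ) {p : flat n k × ℝ} (hp : p ∈ cylBox n k a b) :
    cylExt Ψ p = Ψ p - p.1 := by
  rw [cylExt, abs_of_pos hp.2.1, Prod.mk.eta, normalDir, h.snd_eq hp, h.normalPart_eq hp,
    smul_smul, mul_inv_cancel₀ hp.2.1.ne', one_smul]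

theorem tendsto_nhdsWithin (h : IsCylParam k Y a b Ψ) (x : flat n k) :
    Tendsto Ψ (𝓝[cylBox n k a b] (x, 0)) (𝓝[Y] (x : Eucl n)) := by
  have hW : ∀ᶠ p in 𝓝[cylBox n k a b] ((x, 0) : flat n k × ℝ), p ∈ cylBox n k a b :=
    self_mem_nhdsWithin
  refine tendsto_nhdsWithin_iff.2 ⟨?_, hW.mono h.mem⟩
  have h1 : Tendsto (fun p : flat n k × ℝ => (p.1 : Eucl n)) (𝓝[cylBox n k a b] (x, 0)) (𝓝 x) :=
    ((continuous_subtype_val.comp continuous_fst).tendsto (x, (0 : ℝ))).mono_left nhdsWithin_le_nhds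
  have h2 : Tendsto (fun p : flat n k × ℝ => p.2) (𝓝[cylBox n k a b] (x, 0)) (𝓝 0) :=
    (continuous_snd.tendsto (x, (0 : ℝ))).mono_left nhdsWithin_le_nhds
  have h3 : Tendsto (fun p => Ψ p - p.1) (𝓝[cylBox n k a b] (x, 0)) (𝓝 0) := by
    refine tendsto_zero_iff_norm_tendsto_zero.2 (h2.congr' ?_)
    filter_upwards [hW] with p hp
    rw [← h.normalPart_eq hp, h.snd_eq hp]
  simpa using h3.add h1

/-- The deviation from the linear map is `p.2` times the difference of a normal direction and `θ`,
which tends to 0. -/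
theorem hasFDerivAt_cylExt (h : IsCylParam k Y a b Ψ) {x : flat n k} (hx : ‖x‖ < a) {θ : Eucl n}
    (hθ : Tendsto (normalDir n k) (𝓝[Y] (x : Eucl n)) (𝓝 θ)) :
    HasFDerivAt (cylExt Ψ) ((ContinuousLinearMap.snd ℝ (flat n k) ℝ).smulRight θ) (x, 0) := by
  have hlim := hθ.comp (h.tendsto_nhdsWithin x)
  refine .of_isLittleO (Asymptotics.isLittleO_iff.2 fun c hc => ?_)
  have hev := hlim.eventually (Metric.ball_mem_nhds θ hc)
  have habs : Tendsto (fun p : flat n k × ℝ => (p.1, |p.2|)) (𝓝 (x, 0)) (𝓝 (x, 0)) := by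
    have : Continuous fun p : flat n k × ℝ => (p.1, |p.2|) := by fun_prop
    simpa using this.tendsto (x, 0)
  have h1 : ∀ᶠ p in 𝓝 ((x, 0) : flat n k × ℝ), ‖p.1‖ < a :=
    (continuous_fst.norm.tendsto (x, (0 : ℝ))).eventually (gt_mem_nhds hx)
  have h2 : ∀ᶠ p in 𝓝 ((x, 0) : flat n k × ℝ), |p.2| < b :=
    (continuous_snd.abs.tendsto (x, (0 : ℝ))).eventually (gt_mem_nhds (by simpa using h.pos_right))
  filter_upwards [habs.eventually (eventually_nhdsWithin_iff.1 hev), h1, h2] with p hp hp1 hp2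
  rw [cylExt_zero, sub_zero]
  have e : cylExt Ψ p - ((ContinuousLinearMap.snd ℝ (flat n k) ℝ).smulRight θ) (p - (x, 0)) =
      p.2 • (normalDir n k (Ψ (p.1, |p.2|)) - θ) := by
    simp [cylExt, smul_sub]
  rw [e, norm_smul]
  have hle : ‖p.2‖ ≤ ‖p - (x, 0)‖ := by
    have := norm_snd_le (p - (x, (0 : ℝ)))
    simpa using this
  rcases eq_or_ne p.2 0 with h0 | h0
  · rw [h0, norm_zero, zero_mul]; positivity
  have := hp ⟨hp1, abs_pos.2 h0, hp2⟩
  rw [Function.comp_apply, dist_eq_norm] at this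
  rw [mul_comm]
  gcongr

theorem hasFDerivAt_cylExt_of_mem (h : IsCylParam k Y a b Ψ) {p : flat n k × ℝ}
    (hp : p ∈ cylBox n k a b) : HasFDerivAt (cylExt Ψ)
      (fderiv ℝ Ψ p - (flat n k).subtypeL.comp (ContinuousLinearMap.fst ℝ (flat n k) ℝ)) p := by
  have h1 : HasFDerivAt Ψ (fderiv ℝ Ψ p) p :=
    ((h.contDiffAt p hp).differentiableAt (by simp)).hasFDerivAt
  have h2 := ((flat n k).subtypeL.comp (ContinuousLinearMap.fst ℝ (flat n k) ℝ)).hasFDerivAt (x := p)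
  refine (h1.sub h2).congr_of_eventuallyEq ?_
  filter_upwards [(isOpen_cylBox a b).mem_nhds hp] with q hq
  exact h.cylExt_eq hq

theorem contDiffAt_cylExt_of_mem (h : IsCylParam k Y a b Ψ) {p : flat n k × ℝ}
    (hp : p ∈ cylBox n k a b) : ContDiffAt ℝ 1 (cylExt Ψ) p := by
  refine ((h.contDiffAt p hp).sub ((flat n k).subtypeL.comp
    (ContinuousLinearMap.fst ℝ (flat n k) ℝ)).contDiff.contDiffAt).congr_of_eventuallyEq ?_
  filter_upwards [(isOpen_cylBox a b).mem_nhds hp] with q hq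
  exact h.cylExt_eq hq

/-- The derivative of Ψ at (e, l) is compared with e + lN, where N is the normal direction.
Subtracting e leaves lN, close to lθ. Both N → θ and the convergence of tangent spaces are needed.
-/
theorem tendsto_fderiv_cylExt (h : IsCylParam k Y a b Ψ) (hY : IsCpSubmanifold 1 (k + 1) Y)
    {x : flat n k} {θ : Eucl n} (hθ : HasTangentHalfSpace k Y x θ) :
    Tendsto (fderiv ℝ (cylExt Ψ)) (𝓝[cylBox n k a b] (x, 0))
      (𝓝 ((ContinuousLinearMap.snd ℝ (flat n k) ℝ).smulRight θ)) := by
  have hΨ := h.tendsto_nhdsWithin x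
  have hdir := hθ.dir.comp hΨ
  refine (Metric.tendsto_nhds (α := (flat n k × ℝ) →L[ℝ] Eucl n)).2 fun ε hε => ?_
  -- The total error is 5·(2 + 1) + 1 = 16 times `ε / 32`, that is, half of `ε`.
  have hη : 0 < ε / 32 := by positivity
  filter_upwards [self_mem_nhdsWithin, hdir.eventually (Metric.ball_mem_nhds θ hη),
    hΨ.eventually (tendsto_gapDist_iff.1 hθ.tangent _ hη)] with p hp hN hT
  rw [(h.hasFDerivAt_cylExt_of_mem hp).fderiv]
  refine (dist_eq_norm (E := (flat n k × ℝ) →L[ℝ] Eucl n) _ _).trans_lt ?_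
  refine (ContinuousLinearMap.opNorm_le_bound _ (by positivity : 0 ≤ 16 * (ε / 32)) ?_).trans_lt
    (by linarith)
  rintro ⟨e, l⟩
  set m := ‖((e, l) : flat n k × ℝ)‖
  have hem : ‖(e : Eucl n)‖ ≤ m := norm_fst_le (e, l)
  have hlm : |l| ≤ m := norm_snd_le (e, l)
  set N := normalDir n k (Ψ p) with hNdef
  rw [Function.comp_apply, dist_eq_norm] at hN
  obtain ⟨v, hv, hv'⟩ := hT (e + l • θ) (Submodule.add_mem_sup e.2
    (Submodule.smul_mem _ _ (Submodule.mem_span_singleton_self θ)))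
  have h1 := h.norm_fderiv_sub_le hY hp e l hv
  have hN' : p.2⁻¹ • normalPart n k (Ψ p) = N := by rw [hNdef, normalDir, h.snd_eq hp]
  rw [hN'] at h1
  have h2 : ‖(e : Eucl n) + l • θ‖ ≤ 2 * m := by
    refine (norm_add_le _ _).trans ?_
    rw [norm_smul, hθ.norm_eq, mul_one, Real.norm_eq_abs]
    linarith
  have h3 : ‖l • (N - θ)‖ ≤ ε / 32 * m := by
    rw [norm_smul, Real.norm_eq_abs, mul_comm]
    gcongr
  have h4 : ‖(e : Eucl n) + l • N - v‖ ≤ ε / 32 * (2 * m) + ε / 32 * m := by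
    calc ‖(e : Eucl n) + l • N - v‖ = ‖((e : Eucl n) + l • θ - v) + l • (N - θ)‖ := by
          congr 1; rw [smul_sub]; abel
      _ ≤ _ := (norm_add_le _ _).trans (add_le_add (hv'.trans (by gcongr)) h3)
  calc ‖(fderiv ℝ Ψ p - (flat n k).subtypeL.comp (ContinuousLinearMap.fst ℝ (flat n k) ℝ) -
        (ContinuousLinearMap.snd ℝ (flat n k) ℝ).smulRight θ) (e, l)‖
      = ‖(fderiv ℝ Ψ p (e, l) - (e + l • N)) + l • (N - θ)‖ := by
        congr 1
        change fderiv ℝ Ψ p (e, l) - (e : Eucl n) - l • θ = _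
        rw [smul_sub]; abel
    _ ≤ 5 * (ε / 32 * (2 * m) + ε / 32 * m) + ε / 32 * m :=
        (norm_add_le _ _).trans (add_le_add (h1.trans (by gcongr)) h3)
    _ = 16 * (ε / 32) * m := by ring

/-- Off the boundary level the extension is C¹ by parity. On that level it is differentiable, and
its derivative is the limit of the derivatives from both sides. -/
theorem contDiffOn_cylExt (h : IsCylParam k Y a b Ψ) (hY : IsCpSubmanifold 1 (k + 1) Y)
    (hT : ∀ x : flat n k, ‖x‖ < a → ∃ θ, HasTangentHalfSpace k Y x θ) :
    ContDiffOn ℝ 1 (cylExt Ψ) {p | ‖p.1‖ < a ∧ |p.2| < b} := by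
  set B : Set (flat n k × ℝ) := {p | ‖p.1‖ < a ∧ |p.2| < b} with hB
  have hBo : IsOpen B :=
    (isOpen_lt continuous_fst.norm continuous_const).inter
      (isOpen_lt continuous_snd.abs continuous_const)
  set A : Set (flat n k × ℝ) := {p ∈ B | p.2 ≠ 0} with hA
  have hAeq : A = cylBox n k a b ∪ cylRefl n k ⁻¹' cylBox n k a b := by
    ext p
    constructor
    · rintro ⟨⟨h1, h2⟩, h3⟩
      rcases h3.lt_or_gt with h3 | h3
      · exact Or.inr ⟨h1, neg_pos.2 h3, by simpa [cylRefl_apply, abs_of_neg h3] using h2⟩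
      · exact Or.inl ⟨h1, h3, by simpa [abs_of_pos h3] using h2⟩
    · rintro (⟨h1, h2, h3⟩ | ⟨h1, h2, h3⟩)
      · exact ⟨⟨h1, by rwa [abs_of_pos h2]⟩, h2.ne'⟩
      · simp only [cylRefl_apply] at h1 h2 h3
        exact ⟨⟨h1, by rwa [abs_of_neg (neg_pos.1 h2)]⟩, (neg_pos.1 h2).ne⟩
  have hcd : ∀ p ∈ A, ContDiffAt ℝ 1 (cylExt Ψ) p := by
    intro p hp
    rw [hAeq] at hp
    rcases hp with hp | hp
    · exact h.contDiffAt_cylExt_of_mem hp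
    · rw [cylExt_eq_neg]
      exact ((h.contDiffAt_cylExt_of_mem hp).comp p (cylRefl n k).contDiff.contDiffAt).neg
  have hBA : B ⊆ closure A := by
    intro p hp
    rw [mem_closure_iff_nhds]
    intro U hU
    have hc : Tendsto (fun s : ℝ => (p.1, s)) (𝓝 p.2) (𝓝 p) :=
      (by fun_prop : Continuous fun s : ℝ => (p.1, s)).tendsto p.2
    have h1 : ∀ᶠ s in 𝓝[≠] p.2, (p.1, s) ∈ U ∩ B :=
      nhdsWithin_le_nhds (hc (inter_mem hU (hBo.mem_nhds hp)))
    have h2 : ∀ᶠ s in 𝓝[≠] p.2, s ≠ 0 := by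
      rcases eq_or_ne p.2 0 with h0 | h0
      · rw [h0]; exact self_mem_nhdsWithin
      · exact nhdsWithin_le_nhds (isOpen_ne.mem_nhds h0)
    obtain ⟨s, hs, hs0⟩ := (h1.and h2).exists
    exact ⟨(p.1, s), hs.1, hs.2, hs0⟩
  have hmain : ∀ p ∈ B, DifferentiableAt ℝ (cylExt Ψ) p ∧
      Tendsto (fderiv ℝ (cylExt Ψ)) (𝓝[A] p) (𝓝 (fderiv ℝ (cylExt Ψ) p)) := by
    rintro ⟨x, s⟩ hp
    rcases eq_or_ne s 0 with rfl | hs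
    · obtain ⟨θ, hθ⟩ := hT x hp.1
      have hd := h.hasFDerivAt_cylExt hp.1 hθ.dir
      refine ⟨hd.differentiableAt, ?_⟩
      have hr := h.tendsto_fderiv_cylExt hY hθ
      rw [hd.fderiv, hAeq, nhdsWithin_union]
      refine hr.sup ?_
      have hrefl : Tendsto (cylRefl n k) (𝓝[cylRefl n k ⁻¹' cylBox n k a b] (x, 0))
          (𝓝[cylBox n k a b] (x, 0)) := by
        refine tendsto_nhdsWithin_iff.2 ⟨?_, self_mem_nhdsWithin⟩
        have := (cylRefl n k).continuous.tendsto (x, 0)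
        rw [cylRefl_apply, neg_zero] at this
        exact this.mono_left nhdsWithin_le_nhds
      have hcomp : Continuous fun D : (flat n k × ℝ) →L[ℝ] Eucl n =>
          -(D.comp (cylRefl n k : (flat n k × ℝ) →L[ℝ] (flat n k × ℝ))) := by fun_prop
      have h2 := (hcomp.tendsto _).comp (hr.comp hrefl)
      have e : -(((ContinuousLinearMap.snd ℝ (flat n k) ℝ).smulRight θ).comp
          (cylRefl n k : (flat n k × ℝ) →L[ℝ] (flat n k × ℝ))) =
          (ContinuousLinearMap.snd ℝ (flat n k) ℝ).smulRight θ := by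
        refine ContinuousLinearMap.ext fun q => ?_
        change -((-q.2) • θ) = q.2 • θ
        simp
      rw [e] at h2
      exact h2.congr fun p => (fderiv_cylExt Ψ p).symm
    · have := hcd (x, s) ⟨hp, hs⟩
      exact ⟨this.differentiableAt (by simp),
        (this.continuousAt_fderiv (by simp)).tendsto.mono_left nhdsWithin_le_nhds⟩
  -- Limits along the dense set `A` suffice: the extension of a function by such limits is
  -- automatically continuous on `B`.
  have hcont : ContinuousOn (fderiv ℝ (cylExt Ψ)) B := by
    refine (continuousOn_extendFrom hBA fun p hp => ⟨_, (hmain p hp).2⟩).congr fun p hp => ?_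
    exact (extendFrom_eq (hBA hp) (hmain p hp).2).symm
  have := (contDiffOn_succ_iff_fderiv_of_isOpen (n := 0) (𝕜 := ℝ) (f := cylExt Ψ) hBo).2
    ⟨fun p hp => (hmain p hp).1.differentiableWithinAt, by simp, contDiffOn_zero.2 hcont⟩
  simpa using this

end IsCylParam

end Extension

/-! ### Boundary charts -/

section BoundaryChart

variable {n k : ℕ}

theorem starProjection_flat_single (hk : k < n) :
    (flat n k).starProjection (EuclideanSpace.single ⟨k, hk⟩ (1 : ℝ)) = 0 := by
  ext i
  rw [flat_starProjection_apply]
  split_ifs with hi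
  · have : i ≠ ⟨k, hk⟩ := fun h => by simp [h] at hi
    simp [this]
  · simp

theorem normalPart_succ (hk : k < n) (z : Eucl n) :
    normalPart n (k + 1) z =
      normalPart n k z - z ⟨k, hk⟩ • EuclideanSpace.single ⟨k, hk⟩ (1 : ℝ) := by
  ext i
  simp only [normalPart_apply, PiLp.sub_apply, PiLp.smul_apply, flat_starProjection_apply]
  rcases lt_trichotomy i.val k with hi | hi | hi
  · have : i ≠ ⟨k, hk⟩ := fun h => by simp [h] at hi
    simp [hi, this, hi.trans (Nat.lt_succ_self k)]
  · obtain rfl : i = ⟨k, hk⟩ := Fin.ext hi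
    simp
  · have : i ≠ ⟨k, hk⟩ := fun h => by simp [h] at hi
    simp [this, hi.not_gt, hi.not_ge]

/-- A linear isometry which fixes `ℝᵏ × 0` and carries the next basis vector to a given unit
normal vector. -/
theorem exists_isometry_single_eq (hk : k < n) {θ : Eucl n} (hθ : ‖θ‖ = 1)
    (hθK : θ ∈ (flat n k)ᗮ) :
    ∃ Λ : Eucl n ≃ₗᵢ[ℝ] Eucl n, (∀ e ∈ flat n k, Λ e = e) ∧
      Λ (EuclideanSpace.single ⟨k, hk⟩ (1 : ℝ)) = θ := by
  set ek : Eucl n := EuclideanSpace.single ⟨k, hk⟩ (1 : ℝ) with hek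
  have hekK : ek ∈ (flat n k)ᗮ :=
    (Submodule.starProjection_apply_eq_zero_iff _).1 (starProjection_flat_single hk)
  -- The reflection exchanging the unit vectors `ek` and `θ`; both are normal to `flat n k`, which
  -- is therefore fixed.
  refine ⟨(Submodule.span ℝ {ek - θ})ᗮ.reflection, fun e he => ?_,
    Submodule.reflection_sub (by rw [hθ, hek]; simp)⟩
  refine Submodule.reflection_mem_subspace_eq_self ?_
  rw [Submodule.mem_orthogonal_singleton_iff_inner_right]
  exact Submodule.inner_left_of_mem_orthogonal he (Submodule.sub_mem _ hekK hθK)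

/-- The half-space is mapped to X ∪ Y by π z + `cylExt`, and the remaining coordinates are added
through the isometry Λ. The derivative at 0 is Λ itself, so the map is a local diffeomorphism; the
boundary chart is its inverse. -/
theorem IsCylParam.exists_boundary_chart {Y : Set (Eucl n)} {a b : ℝ} {Ψ : flat n k × ℝ → Eucl n}
    (h : IsCylParam k Y a b Ψ) (hY : IsCpSubmanifold 1 (k + 1) Y) (hYK : ∀ y ∈ Y, y ∉ flat n k)
    (hT : ∀ x : flat n k, ‖x‖ < a → ∃ θ, HasTangentHalfSpace k Y x θ) :
    ∃ G : OpenPartialHomeomorph (Eucl n) (Eucl n), 0 ∈ G.source ∧ IsCpChart 1 G ∧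
      G.IsImage (flat n k ∪ Y) (halfFlat n k) ∧ G.IsImage (flat n k) (flat n k) := by
  have hk : k < n := hY.1
  obtain ⟨θ, hθ⟩ := hT 0 (by simpa using h.pos_left)
  obtain ⟨Λ, hΛK, hΛe⟩ := exists_isometry_single_eq hk hθ.norm_eq hθ.orth
  set kk : Fin n := ⟨k, hk⟩
  set ek : Eucl n := EuclideanSpace.single kk (1 : ℝ) with hek
  set π := (flat n k).starProjection with hπ
  have hπe : π ek = 0 := starProjection_flat_single hk
  have hsucc : ∀ z, normalPart n (k + 1) z = normalPart n k z - z kk • ek := normalPart_succ hk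
  let P : Eucl n →L[ℝ] flat n k × ℝ :=
    (flat n k).orthogonalProjectionOnto.prod (EuclideanSpace.proj kk)
  have hP1 : ∀ z, ((P z).1 : Eucl n) = π z := fun z => rfl
  have hP2 : ∀ z, (P z).2 = z kk := fun z => rfl
  set F : Eucl n → Eucl n := fun z =>
    π z + cylExt Ψ (P z) + Λ (normalPart n (k + 1) z) with hF
  have hFflat : ∀ z ∈ flat n (k + 1), F z = (P z).1 + cylExt Ψ (P z) := fun z hz => by
    simp only [hF, normalPart_eq_zero_iff.2 hz, map_zero, add_zero, hP1]
  set B : Set (flat n k × ℝ) := {p | ‖p.1‖ < a ∧ |p.2| < b} with hB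
  have hBo : IsOpen B :=
    (isOpen_lt continuous_fst.norm continuous_const).inter
      (isOpen_lt continuous_snd.abs continuous_const)
  have hB0 : (0 : flat n k × ℝ) ∈ B := ⟨by simpa using h.pos_left, by simpa using h.pos_right⟩
  set V : Set (Eucl n) := P ⁻¹' B with hV
  have hVo : IsOpen V := hBo.preimage P.continuous
  have hV0 : (0 : Eucl n) ∈ V := by rw [hV, mem_preimage, map_zero]; exact hB0
  have hFc : ContDiffOn ℝ 1 F V :=
    (π.contDiff.contDiffOn.add ((h.contDiffOn_cylExt hY hT).comp P.contDiff.contDiffOn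
      fun z hz => hz)).add ((Λ.contDiff.comp (normalPart n (k + 1)).contDiff).contDiffOn)
  have hF' : HasFDerivAt F (Λ.toContinuousLinearEquiv : Eucl n →L[ℝ] Eucl n) 0 := by
    have hc : HasFDerivAt (cylExt Ψ) ((ContinuousLinearMap.snd ℝ (flat n k) ℝ).smulRight θ) (P 0) := by
      rw [map_zero]
      exact h.hasFDerivAt_cylExt (x := 0) (by simpa using h.pos_left) hθ.dir
    have hd := ((π.hasFDerivAt (x := (0 : Eucl n))).add (hc.comp 0 P.hasFDerivAt)).add
      ((Λ.toContinuousLinearEquiv : Eucl n →L[ℝ] Eucl n).hasFDerivAt.comp 0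
        (normalPart n (k + 1)).hasFDerivAt)
    refine hd.congr_fderiv (ContinuousLinearMap.ext fun v => ?_)
    change π v + v kk • θ + Λ (normalPart n (k + 1) v) = Λ v
    rw [hsucc, map_sub, map_smul, hΛe]
    conv_rhs => rw [← starProjection_add_normalPart (d := k) v, map_add,
      hΛK _ (Submodule.starProjection_apply_mem _ _)]
    abel
  -- the point of the half-space which is mapped to a given point
  set ζ : Eucl n → Eucl n := fun w => π w + ‖normalPart n k w‖ • ek with hζ
  have hζc : Continuous ζ := by fun_prop
  have hζP : ∀ w, P (ζ w) = cylCoord n k w := fun w => by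
    refine Prod.ext (Subtype.ext ?_) ?_
    · rw [hP1, map_add, map_smul, hπe, smul_zero, add_zero]
      exact Submodule.starProjection_eq_self_iff.2 (Submodule.starProjection_apply_mem _ _)
    · rw [hP2]
      simp [hζ, hπ, hek, kk, cylCoord, flat_starProjection_apply]
  have hζhalf : ∀ w, ζ w ∈ halfFlat n k := fun w => by
    have h2 : ζ w kk = ‖normalPart n k w‖ := congrArg Prod.snd (hζP w)
    refine ⟨normalPart_eq_zero_iff.1 ?_, fun i hi => ?_⟩
    · have h1 : π (ζ w) = π w := congrArg (fun p : flat n k × ℝ => (p.1 : Eucl n)) (hζP w)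
      rw [hsucc, h2, normalPart_apply, ← hπ, h1, hζ]
      simp
    · obtain rfl : i = kk := Fin.ext hi
      rw [h2]; exact norm_nonneg _
  have hζflat : ∀ w ∈ flat n k, ζ w = w := fun w hw => by
    simp only [hζ, normalPart_eq_zero_iff.2 hw, norm_zero, zero_smul, add_zero]
    exact Submodule.starProjection_eq_self_iff.2 hw
  have hFζ : ∀ w ∈ (flat n k : Set (Eucl n)) ∪ Y, cylCoord n k w ∈ B → F (ζ w) = w := by
    rintro w hw hwB
    rw [hFflat _ (hζhalf w).1, hζP]
    rcases hw with hw | hw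
    · have : cylCoord n k w = ((cylCoord n k w).1, 0) :=
        Prod.ext rfl (by simp [cylCoord, normalPart_eq_zero_iff.2 hw])
      rw [this, cylExt_zero, add_zero, cylCoord_fst_coe]
      exact Submodule.starProjection_eq_self_iff.2 hw
    · have hpos : 0 < (cylCoord n k w).2 :=
        norm_pos_iff.2 fun h0 => hYK w hw (normalPart_eq_zero_iff.1 h0)
      have hbox : cylCoord n k w ∈ cylBox n k a b :=
        ⟨hwB.1, hpos, (le_abs_self _).trans_lt hwB.2⟩
      rw [h.cylExt_eq hbox, h.eq_of_mem w hw hbox]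
      abel
  have hFhalf : ∀ z ∈ halfFlat n k, z ∈ V → F z ∈ (flat n k : Set (Eucl n)) ∪ Y := by
    intro z hz hzV
    rw [hFflat z hz.1]
    rcases (hz.2 kk rfl).eq_or_lt with h0 | h0
    · have : P z = ((P z).1, 0) := Prod.ext rfl h0.symm
      rw [this, cylExt_zero, add_zero]
      exact Or.inl (P z).1.2
    · have hbox : P z ∈ cylBox n k a b := ⟨hzV.1, h0, (le_abs_self _).trans_lt hzV.2⟩
      rw [h.cylExt_eq hbox, add_sub_cancel]
      exact Or.inr (h.mem _ hbox)
  have hFK : ∀ z ∈ flat n k, F z = z := by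
    intro z hz
    have : P z = ((P z).1, 0) := Prod.ext rfl (hz kk le_rfl)
    rw [hFflat z (flat_mono (Nat.le_succ k) hz), this, cylExt_zero, add_zero, hP1]
    exact Submodule.starProjection_eq_self_iff.2 hz
  have hF0 : F 0 = 0 := hFK 0 (zero_mem _)
  have hFc0 : ContDiffAt ℝ 1 F 0 := hFc.contDiffAt (hVo.mem_nhds hV0)
  set e := hFc0.toOpenPartialHomeomorph F hF' one_ne_zero with he
  have heF : ∀ z, e z = F z := fun z => rfl
  have he0 : 0 ∈ e.source := hFc0.mem_toOpenPartialHomeomorph_source hF' one_ne_zero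
  set Q : Set (Eucl n) := ζ ⁻¹' e.source ∩ cylCoord n k ⁻¹' B
  have hQo : IsOpen Q := (e.open_source.preimage hζc).inter (hBo.preimage continuous_cylCoord)
  have hQ0 : (0 : Eucl n) ∈ Q := by
    refine ⟨?_, ?_⟩
    · rw [mem_preimage, hζflat 0 (zero_mem _)]; exact he0
    · rw [mem_preimage, ← hζP, hζflat 0 (zero_mem _), map_zero]; exact hB0
  -- The first factor keeps the derivative invertible, so that the inverse is C¹ on the whole
  -- domain. The second keeps `ζ (F z)` in the domain of injectivity, so that points sent to X ∪ Y
  -- must come from the half-space.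
  set O : Set (Eucl n) := (V ∩ fderiv ℝ F ⁻¹' range ((↑) : (Eucl n ≃L[ℝ] Eucl n) → _)) ∩
    (V ∩ F ⁻¹' Q) with hO
  have hOo : IsOpen O :=
    ((hFc.continuousOn_fderiv_of_isOpen hVo le_rfl).isOpen_inter_preimage hVo
      ContinuousLinearEquiv.isOpen).inter (hFc.continuousOn.isOpen_inter_preimage hVo hQo)
  have hO0 : (0 : Eucl n) ∈ O :=
    ⟨⟨hV0, _, hF'.fderiv.symm⟩, hV0, by rw [mem_preimage, hF0]; exact hQ0⟩
  set ψ := e.restrOpen O hOo with hψ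
  have hψF : ∀ z, ψ z = F z := fun z => rfl
  have hψs : ψ.source = e.source ∩ O := e.restrOpen_source O hOo
  have hψchart : IsCpChart 1 ψ := by
    refine ⟨hFc.mono fun z hz => ?_, fun w hw => ?_⟩
    · rw [hψs] at hz; exact hz.2.1.1
    · have hz : ψ.symm w ∈ ψ.source := ψ.map_target hw
      rw [hψs] at hz
      obtain ⟨⟨hzV, D, hD⟩, -⟩ := hz.2
      have hcd : ContDiffAt ℝ 1 F (ψ.symm w) := hFc.contDiffAt (hVo.mem_nhds hzV)
      refine (ψ.contDiffAt_symm (f₀' := D) hw ?_ hcd).contDiffWithinAt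
      rw [hD]
      exact (hcd.differentiableAt (by simp)).hasFDerivAt
  have hback : ∀ z ∈ ψ.source, F z ∈ (flat n k : Set (Eucl n)) ∪ Y → ζ (F z) = z := by
    intro z hz hFz
    rw [hψs] at hz
    exact e.injOn hz.2.2.2.1 hz.1 (hFζ _ hFz hz.2.2.2.2)
  refine ⟨ψ.symm, ?_, hψchart.symm, OpenPartialHomeomorph.IsImage.symm fun z hz => ?_,
    OpenPartialHomeomorph.IsImage.symm fun z hz => ?_⟩
  · have := ψ.map_source (x := 0) (by rw [hψs]; exact ⟨he0, hO0⟩)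
    rwa [hψF, hF0] at this
  · rw [hψF]
    refine ⟨fun hFz => hback z hz hFz ▸ hζhalf _, fun hzh => hFhalf z hzh ?_⟩
    rw [hψs] at hz
    exact hz.2.1.1
  · rw [hψF]
    refine ⟨fun hFz => ?_, fun hzK => ?_⟩
    · have h1 := hback z hz (Or.inl hFz)
      rw [hζflat _ hFz] at h1
      rwa [← h1]
    · rw [hFK z hzK]; exact hzK

end BoundaryChart

/-! ### Assembly of boundary and interior charts -/

theorem corollary3p10 (L : FirstOrder.Language) [L.Structure ℝ] (hL : IsOMinimal L)
    (n k : ℕ) (X Y : Set (Eucl n))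
    (hXdef : IsDefinableSet L X) (hYdef : IsDefinableSet L Y)
    (hX : IsCpSubmanifold 2 k X) (hY : IsCpSubmanifold 2 (k + 1) Y)
    (hXconn : IsConnected X) (hYconn : IsConnected Y)
    (hdisj : Disjoint X Y) (hfront : X ⊆ closure Y) (hclosed : IsLocallyClosed (X ∪ Y))
    (hloc : ∀ x ∈ X, ∀ᶠ ε in 𝓝[>] (0 : ℝ), IsConnected (Y ∩ Metric.ball x ε))
    (ha : ∀ x ∈ X, ConditionA Y X x)
    (hr : ∀ x ∈ X, ConditionRInt L k Y X x) :
    IsCpSubmanifoldWithBoundary 1 k (X ∪ Y) X := by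
  have hY1 : IsCpSubmanifold 1 (k + 1) Y :=
    ⟨hY.1, fun y hy => by
      obtain ⟨φ, h1, h2, h3⟩ := hY.2 y hy
      exact ⟨φ, h1, h2.mono (by norm_num), h3⟩⟩
  have hchart := fun x (hx : x ∈ X) => exists_chart_isCylParam hL hYdef hY1 hdisj hclosed hx
    (hfront hx) (hloc x hx) (ha x hx) (hr x hx)
  refine ⟨hY.1, subset_union_left, fun x hx => ?_, fun y hy => ?_⟩
  · obtain ⟨φ, Y', hxφ, hφx, hφ, hXφ, hYφ, hY', hY'K, ⟨a, b, Ψ, hΨ, haφ⟩, -⟩ := hchart x hx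
    -- At a nearby boundary point the tangent half-space is obtained in that point's own chart and
    -- carried over by the transition map.
    have hT : ∀ x' : flat n k, ‖x'‖ < a → ∃ θ, HasTangentHalfSpace k Y' x' θ := by
      intro x' hx'
      have hx'φ : (x' : Eucl n) ∈ φ.target := haφ (by simpa using hx')
      have huX : φ.symm x' ∈ X := (hXφ.symm_apply_mem_iff hx'φ).2 x'.2
      obtain ⟨φ', Y'', huφ', hφ'u, hφ', hXφ', hYφ', -, hY''K, -, θ, hθ⟩ := hchart _ huX
      have h0 : φ'.symm 0 = φ.symm x' := by rw [← hφ'u, φ'.left_inv huφ']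
      have hsrc : (0 : Eucl n) ∈ (φ'.symm.trans φ).source := by
        rw [φ'.symm.trans_source]
        refine ⟨hφ'u ▸ φ'.map_source huφ', ?_⟩
        rw [mem_preimage, h0]; exact φ.map_target hx'φ
      have hval : (φ'.symm.trans φ) 0 = x' := by
        rw [OpenPartialHomeomorph.coe_trans, Function.comp_apply, h0, φ.right_inv hx'φ]
      rw [← hval]
      exact hθ.map (hφ'.symm.trans hφ) (hXφ'.symm.trans_isImage hXφ)
        (hYφ'.symm.trans_isImage hYφ) hY''K hsrc (zero_mem _)
    obtain ⟨G, hG0, hG, hGM, hGK⟩ := hΨ.exists_boundary_chart hY' hY'K hT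
    refine ⟨φ.trans G, ?_, hφ.trans hG, (hXφ.union hYφ).trans_isImage hGM, hXφ.trans_isImage hGK⟩
    rw [φ.trans_source]
    exact ⟨hxφ, by rwa [mem_preimage, hφx]⟩
  · obtain ⟨φ, hyφ, hφ, hYφ⟩ := hY1.2 y (hy.1.resolve_left hy.2)
    -- A chart of Y meets no point of X: such a point would be in the closure of Y, hence be sent to
    -- the closed set `flat n (k + 1)`, hence belong to Y.
    refine ⟨φ, hyφ, hφ, fun z hz => (hYφ hz).trans ⟨Or.inr, fun h => h.resolve_left fun hzX => ?_⟩⟩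
    have h1 := (hYφ.closure hz).2 (hfront hzX)
    rw [(flat n (k + 1)).closed_of_finiteDimensional.closure_eq] at h1
    exact disjoint_left.1 hdisj hzX ((hYφ hz).1 h1)
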